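/- **Conventions.** Positions, factors and leaves are numbered from $0$, and $[a..b)$ is a half-open interval. Let $T$ be a nonempty string of length $n$ with $\sigma$ distinct symbols. *Collage systems.* A collage system of size $m$ has $m$ nonterminals, one of them the starting nonterminal. Each nonterminal $X$ has one rule of the form $X\to a$, $X\to YZ$, $X\to Y^r$ with $r>2$, or $X\to Y[b..e)$ with $0\le b<e\le|Y|$ (a truncation rule), where $|Y|$ is the length of the string derived from $Y$. Nonterminals are sorted so that each rule refers to smaller nonterminals only, and every nonterminal is involved in expanding the starting one. The system is *internal* (an ICS) if every nonterminal can be reached from the starting one without using truncation rules. It is a system for $T$ if the starting nonterminal derives $T$; it is smallest if no ICS for $T$ has fewer nonterminals. *Grammar tree.* In the binary parse tree, a node labelled $X$ has the child $a$; the children $Y,Z$; the children $Y$ and $Y^{r-1}$ (a leaf); or the child $Y[b..e)$ (a leaf), according to its rule. The grammar tree is obtained by deleting all descendants of every node that is not the leftmost one with its label. The strings derived from its leaves form the *ICS-factorization* $T=F_0\cdots F_{h-1}$. Each factor longer than $1$ is categorized. It is of *type A* if its leaf is labelled by a nonterminal $X$; it then refers to a node labelled $X$ further left. It is of *type B* if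 its leaf is labelled $Y^{r-1}$; it then refers to its left sibling. It is of *type C* if its leaf is labelled $Y[b..e)$; it then refers to a node labelled $Y$. The referred node covers leaves $i_k,\dots,j_k$. *Conditions.* Let $T=F_0\cdots F_{h-1}$ be any factorization into nonempty factors in which each $F_k$ longer than $1$ has a type and integers $0\le i_k\le j_k<h$. Let $s_k$ be the starting position of $F_k$ and let $s_h=n$. The conditions are: 1. Type A: $j_k<k$ and $F_k=F_{i_k}\cdots F_{j_k}$. Type B: $j_k=k-1$ and $F_k=(F_{i_k}\cdots F_{j_k})^{r-1}$ for some $r\ge3$. Type C: $k<i_k$ or $k>j_k$, and $F_k$ is a substring of $F_{i_k}\cdots F_{j_k}$. 2. Let $I$ consist of all intervals $[s_{i_k}..s_{j_k+1})$ and, for type-B factors, also $[s_{i_k}..s_{k+1})$. No two intervals of $I$ cross, and no interval of $I$ consists of a single type-B factor. 3. There are integers $D_k\ge0$ with $D_k=0$ if $|F_k|=1$ and $D_k>\max\{D_{i_k},\dots,D_{j_k}\}$ if $|F_k|>1$. *Formulation.* The following formulation uses Boolean variables with the stated meanings. - $f_{i,\ell}$: $T[i..i+\ell)$ is a factor. -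 $p_i$ ($0\le i\le n$): $i$ is the start of a factor, or $i=n$. - $\mathrm{refA}_{i',i,\ell}$, $\mathrm{refB}_{i',i,\ell}$, $\mathrm{refC}_{i',\ell',i,\ell}$: $T[i..i+\ell)$ is a factor of type A, B, C that refers to $T[i'..i'+\ell)$, $T[i'..i)$, $T[i'..i'+\ell')$ respectively. These variables are used only for subscripts for which the strings satisfy condition 1. - $\mathrm{dref}_{i',\ell',i}$: the factor starting at $i$ refers to $[i'..i'+\ell')$. - $q_{i',\ell'}$: $[i'..i'+\ell')\in I$. - $\mathrm{depth}_{i,\ell,d}$: the maximum reference depth in $T[i..i+\ell)$ is at least $d$. - Auxiliary variables of a sequential counter encoding of at-most-one constraints. The hard clauses are the clausal forms of the following constraints. - $p_0$ and $p_n$. - $f_{i,\ell}\Leftrightarrow p_i\wedge\neg p_{i+1}\wedge\dots\wedge\neg p_{i+\ell-1}\wedge p_{i+\ell}$. - For $\ell\ge2$: $f_{i,\ell}$ is equivalent to the disjunction of all ref-variables for $T[i..i+\ell)$, and at most one of them is true. - $\mathrm{dref}$ is equivalent to the disjunction of the ref-variables giving that reference, and $q_{i',\ell'}$ to the disjunction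 of all $\mathrm{dref}_{i',\ell',i}$ and all $\mathrm{refB}_{i',i,\ell}$ with $i'+\ell'=i+\ell$. - $q_{i',\ell'}\Rightarrow p_{i'}\wedge p_{i'+\ell'}$. Also $\neg q_{i_1,\ell_1}\vee\neg q_{i_2,\ell_2}$ if $i_1<i_2<i_1+\ell_1<i_2+\ell_2$, and $\neg q_{i,\ell}\vee\neg\mathrm{refB}_{i',i,\ell}$. - $\mathrm{depth}_{i,1,0}$, $\neg\mathrm{depth}_{i,1,n}$ and $\mathrm{depth}_{i,1,d+1}\Rightarrow\mathrm{depth}_{i,1,d}$. Also $\neg p_{i+1}\Rightarrow(\mathrm{depth}_{i+1,1,d}\Leftrightarrow\mathrm{depth}_{i,1,d})$, and $\mathrm{depth}_{i,\ell,d}\Leftrightarrow\bigvee_{j=i}^{i+\ell-1}\mathrm{depth}_{j,1,d}$. - $\mathrm{dref}_{i',\ell',i}\wedge\mathrm{depth}_{i',\ell',d}\Rightarrow\mathrm{depth}_{i,1,d+1}$ for $0\le d<n$. The soft clauses are all $\neg p_i$ and all $\neg\mathrm{refC}_{i',\ell',i,\ell}$. A solution is *optimal* if it satisfies all hard clauses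 and, subject to that, as many soft clauses as possible. **Theorem.** There is an absolute constant $C$ such that for every nonempty string $T$ of length $n$, over any alphabet, this MAX-SAT formulation has the following properties. (a) Its size (number of clauses plus number of literal occurrences) is at most $Cn^4$. (b) Every assignment satisfying the hard clauses describes (through the variables $f,p,\mathrm{refA},\mathrm{refB},\mathrm{refC},\mathrm{dref},q$) a categorized factorization of $T$ satisfying conditions 1–3, and every such categorized factorization is described by an assignment satisfying the hard clauses. (c) A categorized factorization satisfies conditions 1–3 for $T$ if and only if it is the categorized ICS-factorization of some ICS for $T$, and every ICS for $T$ has a categorized ICS-factorization. (d) If an assignment satisfying the hard clauses describes a categorized factorization satisfying conditions 1–3 that has $h$ factors, $c$ of them of type C, then it violates exactly $h+1+c$ soft clauses. (e) Optimal solutions exist. Every optimal solution describes a categorized ICS-factorization of some smallest ICS for $T$, and for every smallest ICS for $T$ some categorized ICS-factorization is described by an optimal solution. The size of the smallest ICSs for $T$ is $N+\sigma-2$, where $N$ is the number of soft clauses violated by an optimal solution. -/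

import Mathlib

/-! ### Collage systems

Strings are lists.  Positions in strings, factors and nonterminals are numbered from `0`, and all
intervals are half-open. -/

/-- The substring `w[i..i+l)`. -/
def substr {α : Type*} (w : List α) (i l : ℕ) : List α := (w.drop i).take l

/-- The `r`-fold repeat `w ^ r` of a string. -/
def strPow {α : Type*} (w : List α) (r : ℕ) : List α := (List.replicate r w).flatten

/-- Right-hand sides of rules: `a`, `YZ`, `Y^r`, `Y[b..e)`. -/
inductive CollageRule (α : Type*) (N : Type*) where
  | atom (a : α)
  | concat (Y Z : N)
  | rep (Y : N) (r : ℕ)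
  | trunc (Y : N) (b e : ℕ)

/-- `Y` occurs on the right-hand side of the rule. -/
def CollageRule.Refers {α N : Type*} : CollageRule α N → N → Prop
  | .atom _, _ => False
  | .concat Y Z, W => W = Y ∨ W = Z
  | .rep Y _, W => W = Y
  | .trunc Y _ _, W => W = Y

/-- `Y` occurs on the right-hand side of the rule, and the rule is not a truncation rule. -/
def CollageRule.RefersPlain {α N : Type*} : CollageRule α N → N → Prop
  | .atom _, _ => False
  | .concat Y Z, W => W = Y ∨ W = Z
  | .rep Y _, W => W = Y
  | .trunc _ _ _, _ => False

/-- A system of `size` rules, one for each nonterminal, with a starting nonterminal; the nonterminals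
are sorted such that each refers to smaller ones only. -/
structure RuleSystem (α : Type*) where
  size : ℕ
  start : Fin size
  rule : Fin size → CollageRule α (Fin size)
  sorted : ∀ X Y, (rule X).Refers Y → Y < X

namespace RuleSystem

variable {α : Type*} (G : RuleSystem α)

/-- The string derived from the nonterminal `X`. -/
def expand (X : Fin G.size) : List α :=
  match h : G.rule X with
  | .atom a => [a]
  | .concat Y Z => expand Y ++ expand Z
  | .rep Y r => strPow (expand Y) r
  | .trunc Y b e => substr (expand Y) b (e - b)
termination_by X.val
decreasing_by
  all_goals
    first
    | exact G.sorted X Y (by rw [h]; simp [CollageRule.Refers])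
    | exact G.sorted X Z (by rw [h]; simp [CollageRule.Refers])

/-- The side conditions on repetition rules (`r > 2`) and on truncation rules. -/
def RuleOK (X : Fin G.size) : Prop :=
  match G.rule X with
  | .atom _ => True
  | .concat _ _ => True
  | .rep _ r => 2 < r
  | .trunc Y b e => b < e ∧ e ≤ (G.expand Y).length

/-- Collage systems: the rules are as required, and no nonterminal is useless. -/
def IsCollageSystem : Prop :=
  (∀ X, G.RuleOK X) ∧
    ∀ X, Relation.ReflTransGen (fun X Y => (G.rule X).Refers Y) G.start X

/-- Every nonterminal occurs in some sequence obtained from the starting nonterminal without using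
truncation rules. -/
def IsInternal : Prop :=
  ∀ X, Relation.ReflTransGen (fun X Y => (G.rule X).RefersPlain Y) G.start X

/-- `G` is an internal collage system for the string `T`. -/
def IsICSFor (T : List α) : Prop :=
  G.IsCollageSystem ∧ G.IsInternal ∧ G.expand G.start = T

/-- `G` is a smallest internal collage system for the string `T`. -/
def IsSmallestICSFor (T : List α) : Prop :=
  G.IsICSFor T ∧ ∀ H : RuleSystem α, H.IsICSFor T → G.size ≤ H.size

end RuleSystem

/-! ### Parse trees and grammar trees -/

/-- Node labels: a nonterminal `X`, a terminal `a`, the label `Y^k`, the label `Y[b..e)`. -/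
inductive NodeLabel (α : Type*) (N : Type*) where
  | nt (X : N)
  | term (a : α)
  | pow (Y : N) (k : ℕ)
  | sub (Y : N) (b e : ℕ)

/-- Ordered labelled trees whose nodes have at most two children. -/
inductive LTree (L : Type*) where
  | leaf (l : L)
  | one (l : L) (t : LTree L)
  | two (l : L) (t₁ t₂ : LTree L)

namespace LTree

variable {L : Type*}

/-- The labels of the leaves, from left to right. -/
def leaves : LTree L → List L
  | .leaf l => [l]
  | .one _ t => t.leaves
  | .two _ t₁ t₂ => t₁.leaves ++ t₂.leaves

/-- All nodes of a tree whose leaves are numbered from left to right starting with `s`: the node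
`(l, i, j)` has label `l`, and the leaves below it (or the leaf itself) are those numbered
`i, …, j - 1`. -/
def nodesFrom : LTree L → ℕ → List (L × ℕ × ℕ)
  | .leaf l, s => [(l, s, s + 1)]
  | .one l t, s => (l, s, s + t.leaves.length) :: t.nodesFrom s
  | .two l t₁ t₂, s =>
      (l, s, s + t₁.leaves.length + t₂.leaves.length) ::
        (t₁.nodesFrom s ++ t₂.nodesFrom (s + t₁.leaves.length))

def nodes (t : LTree L) : List (L × ℕ × ℕ) := t.nodesFrom 0

open Classical in
/-- Visit the nodes in preorder and delete everything below each node whose label was seen before;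
the second component collects the labels seen.  (In a parse tree no node has the label of one of its
ancestors, and the nodes visited before another node are its ancestors and nodes to its left.) -/
noncomputable def prune : LTree L → Set L → LTree L × Set L
  | .leaf l, seen => (.leaf l, seen)
  | .one l t, seen =>
      if l ∈ seen then (.leaf l, seen) else
        let r := t.prune (insert l seen)
        (.one l r.1, r.2)
  | .two l t₁ t₂, seen =>
      if l ∈ seen then (.leaf l, seen) else
        let r₁ := t₁.prune (insert l seen)
        let r₂ := t₂.prune r₁.2
        (.two l r₁.1 r₂.1, r₂.2)

end LTree

namespace RuleSystem

variable {α : Type*} (G : RuleSystem α)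

/-- The part of the binary parse tree below a node with label `X`. -/
def parseTreeFrom (X : Fin G.size) : LTree (NodeLabel α (Fin G.size)) :=
  match h : G.rule X with
  | .atom a => .one (.nt X) (.leaf (.term a))
  | .concat Y Z => .two (.nt X) (parseTreeFrom Y) (parseTreeFrom Z)
  | .rep Y r => .two (.nt X) (parseTreeFrom Y) (.leaf (.pow Y (r - 1)))
  | .trunc Y b e => .one (.nt X) (.leaf (.sub Y b e))
termination_by X.val
decreasing_by
  all_goals
    first
    | exact G.sorted X Y (by rw [h]; simp [CollageRule.Refers])
    | exact G.sorted X Z (by rw [h]; simp [CollageRule.Refers])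

/-- The binary parse tree. -/
def parseTree : LTree (NodeLabel α (Fin G.size)) := G.parseTreeFrom G.start

/-- The grammar tree: all descendants of nodes that are not the leftmost node with their label are
deleted. -/
noncomputable def grammarTree : LTree (NodeLabel α (Fin G.size)) := (G.parseTree.prune ∅).1

/-- The string derived from a node with the given label. -/
def labelString : NodeLabel α (Fin G.size) → List α
  | .nt X => G.expand X
  | .term a => [a]
  | .pow Y k => strPow (G.expand Y) k
  | .sub Y b e => substr (G.expand Y) b (e - b)

end RuleSystem

/-! ### Factorizations with reference structure -/

/-- The type of a factor, with the numbers of the first and the last factor of the substring that it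
refers to; `single` is for factors of length `1`. -/
inductive FactorKind where
  | single
  | typeA (i j : ℕ)
  | typeB (i j : ℕ)
  | typeC (i j : ℕ)

/-- A factorization into `count` factors, each of them categorized: the `k`-th factor occupies the
positions `pos k, …, pos (k + 1) - 1`. -/
structure CatFactorization where
  count : ℕ
  pos : ℕ → ℕ
  kind : ℕ → FactorKind

namespace CatFactorization

variable (F : CatFactorization)

/-- The string `F_i F_{i+1} ⋯ F_j`. -/
def seg {α : Type*} (T : List α) (i j : ℕ) : List α :=
  substr T (F.pos i) (F.pos (j + 1) - F.pos i)

/-- `[pos a..pos b)` is the interval that the `k`-th factor refers to. -/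
def RefInterval (k a b : ℕ) : Prop :=
  ∃ i j, (F.kind k = .typeA i j ∨ F.kind k = .typeB i j ∨ F.kind k = .typeC i j) ∧
    a = i ∧ b = j + 1

/-- The pair `(a, b)` stands for the interval `[pos a..pos b)`.  The set consists of the intervals
that factors refer to, and, for each type-B factor, that interval extended by the factor. -/
def intervals : Set (ℕ × ℕ) :=
  {x | ∃ k < F.count, F.RefInterval k x.1 x.2 ∨ ∃ i j, F.kind k = .typeB i j ∧ x = (i, k + 1)}

/-- The number of type-C factors. -/
noncomputable def numC : ℕ := {k | k < F.count ∧ ∃ i j, F.kind k = .typeC i j}.ncard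

/-- `F` is a factorization of `T`. -/
def IsFactorizationOf {α : Type*} (T : List α) : Prop :=
  F.pos 0 = 0 ∧ F.pos F.count = T.length ∧ ∀ k < F.count, F.pos k < F.pos (k + 1)

/-- Condition on the individual factors. -/
def KindOK {α : Type*} (T : List α) (k : ℕ) : Prop :=
  match F.kind k with
  | .single => F.pos (k + 1) = F.pos k + 1
  | .typeA i j => F.pos k + 1 < F.pos (k + 1) ∧ i ≤ j ∧ j < k ∧ F.seg T k k = F.seg T i j
  | .typeB i j => F.pos k + 1 < F.pos (k + 1) ∧ i ≤ j ∧ j + 1 = k ∧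
      ∃ r, 3 ≤ r ∧ F.seg T k k = strPow (F.seg T i j) (r - 1)
  | .typeC i j => F.pos k + 1 < F.pos (k + 1) ∧ i ≤ j ∧ j < F.count ∧ (k < i ∨ j < k) ∧
      F.seg T k k <:+: F.seg T i j

/-- The intervals are compatible with tree structures: no two of them cross, and none of them
is just a type-B factor (such a factor is not derived from a nonterminal node of the tree). -/
def TreeCompatible : Prop :=
  (∀ x ∈ F.intervals, ∀ y ∈ F.intervals, ¬ (x.1 < y.1 ∧ y.1 < x.2 ∧ x.2 < y.2)) ∧
    ∀ k < F.count, ∀ i j, F.kind k = .typeB i j → (k, k + 1) ∉ F.intervals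

/-- Reference depths exist. -/
def HasDepths : Prop :=
  ∃ D : ℕ → ℕ, ∀ k < F.count,
    (F.kind k = .single → D k = 0) ∧
      ∀ a b, F.RefInterval k a b → ∀ t, a ≤ t → t < b → D t < D k

/-- `F` is a categorized factorization of `T` that satisfies all three conditions. -/
def IsValidFor {α : Type*} (T : List α) : Prop :=
  F.IsFactorizationOf T ∧ (∀ k < F.count, F.KindOK T k) ∧ F.TreeCompatible ∧ F.HasDepths

/-- The `k`-th leaf of the grammar tree of `G` has the type and the reference given by `F`. -/
def LeafKind {α : Type*} (G : RuleSystem α) (k : ℕ) : Prop :=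
  match F.kind k with
  | .single => F.pos (k + 1) = F.pos k + 1
  | .typeA i j => F.pos k + 1 < F.pos (k + 1) ∧ j < k ∧
      ∃ X, G.grammarTree.leaves[k]? = some (.nt X) ∧ (.nt X, i, j + 1) ∈ G.grammarTree.nodes
  | .typeB i j => j + 1 = k ∧
      ∃ X Y r, G.rule X = .rep Y r ∧ G.grammarTree.leaves[k]? = some (.pow Y (r - 1)) ∧
        (.nt X, i, k + 1) ∈ G.grammarTree.nodes
  | .typeC i j => F.pos k + 1 < F.pos (k + 1) ∧
      ∃ Y b e, G.grammarTree.leaves[k]? = some (.sub Y b e) ∧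
        (.nt Y, i, j + 1) ∈ G.grammarTree.nodes

/-- `F` is the factorization given by the leaves of the grammar tree of `G`, and the factors longer
than `1` are categorized by the labels of the leaves: a type-A factor comes from a leaf with a
nonterminal label `X` and refers to a node with label `X` to its left; a type-B factor comes from
the right child of a node with a repetition rule and refers to the left child; a type-C factor
comes from a leaf with label `Y[b..e)` and refers to a node with label `Y`. -/
def IsICSFactorizationOf {α : Type*} (G : RuleSystem α) : Prop :=
  F.count = G.grammarTree.leaves.length ∧ F.pos 0 = 0 ∧
    (∀ k l, G.grammarTree.leaves[k]? = some l →
      F.pos (k + 1) = F.pos k + (G.labelString l).length) ∧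
    ∀ k < F.count, F.LeafKind G k

end CatFactorization

/-! ### MAX-SAT -/

/-- A literal is a variable with its sign. -/
abbrev SatLit (V : Type*) := V × Bool

abbrev SatClause (V : Type*) := List (SatLit V)

/-- An instance of MAX-SAT. -/
structure MaxSat (V : Type*) where
  hard : List (SatClause V)
  soft : List (SatClause V)

/-- The assignment `v` satisfies the clause. -/
def SatClause.holds {V : Type*} (v : V → Bool) (c : SatClause V) : Bool :=
  c.any fun l => v l.1 == l.2

namespace MaxSat

variable {V : Type*} (M : MaxSat V)

/-- The number of clauses plus the number of occurrences of literals. -/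
def size : ℕ := ((M.hard ++ M.soft).map fun c => c.length + 1).sum

def SatHard (v : V → Bool) : Prop := ∀ c ∈ M.hard, SatClause.holds v c = true

/-- The number of satisfied soft clauses. -/
def numSat (v : V → Bool) : ℕ := M.soft.countP fun c => SatClause.holds v c

/-- The number of violated soft clauses. -/
def numViolated (v : V → Bool) : ℕ := M.soft.countP fun c => !SatClause.holds v c

/-- An optimal solution. -/
def IsOptimal (v : V → Bool) : Prop :=
  M.SatHard v ∧ ∀ w, M.SatHard w → M.numSat w ≤ M.numSat v

end MaxSat

/-! ### The formulation -/

/-- The Boolean variables; primed indices are written `i'`, `l'`.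
* `f i l`: `T[i..i+l)` is a factor;
* `p i`: `i` is the starting position of a factor, or `i = |T|`;
* `refA i' i l`: `T[i..i+l)` is a type-A factor that refers to `T[i'..i'+l)`;
* `refB i' i l`: `T[i..i+l)` is a type-B factor that refers to `T[i'..i)`;
* `refC i' l' i l`: `T[i..i+l)` is a type-C factor that refers to `T[i'..i'+l')`;
* `dref i' l' i`: the factor that starts at `i` refers to `T[i'..i'+l')`;
* `q i' l'`: `[i'..i'+l')` is one of the intervals that must form a tree structure;
* `depth i l d`: the maximum reference depth in `T[i..i+l)` is at least `d`;
* `aux i l t`: auxiliary variables for the at-most-one constraint of `T[i..i+l)`. -/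
inductive ICSVar where
  | f (i l : ℕ)
  | p (i : ℕ)
  | refA (i' i l : ℕ)
  | refB (i' i l : ℕ)
  | refC (i' l' i l : ℕ)
  | dref (i' l' i : ℕ)
  | q (i' l' : ℕ)
  | depth (i l d : ℕ)
  | aux (i l t : ℕ)

namespace ICSVar

/-- The positive literal of a variable. -/
def pos (x : ICSVar) : SatLit ICSVar := (x, true)

/-- The negative literal of a variable. -/
def neg (x : ICSVar) : SatLit ICSVar := (x, false)

end ICSVar

namespace ICSFormula

open ICSVar

variable {α : Type*} [DecidableEq α] (T : List α)

/-- Feasible subscripts of `f`. -/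
def FeasF (i l : ℕ) : Prop := 1 ≤ l ∧ i + l ≤ T.length

instance (i l : ℕ) : Decidable (FeasF T i l) := by unfold FeasF; infer_instance

/-- Feasible subscripts of `refA`. -/
def FeasA (i' i l : ℕ) : Prop :=
  2 ≤ l ∧ i + l ≤ T.length ∧ i' + l ≤ i ∧ substr T i' l = substr T i l

instance (i' i l : ℕ) : Decidable (FeasA T i' i l) := by unfold FeasA; infer_instance

/-- Feasible subscripts of `refB`. -/
def FeasB (i' i l : ℕ) : Prop :=
  2 ≤ l ∧ i + l ≤ T.length ∧ i' < i ∧ i < i' + l ∧ substr T i' l = substr T i l ∧ (i - i') ∣ l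

instance (i' i l : ℕ) : Decidable (FeasB T i' i l) := by unfold FeasB; infer_instance

/-- Feasible subscripts of `refC`. -/
def FeasC (i' l' i l : ℕ) : Prop :=
  2 ≤ l ∧ 2 ≤ l' ∧ i + l ≤ T.length ∧ i' + l' ≤ T.length ∧ (i + l ≤ i' ∨ i' + l' ≤ i) ∧
    substr T i l <:+: substr T i' l'

instance (i' l' i l : ℕ) : Decidable (FeasC T i' l' i l) := by unfold FeasC; infer_instance

/-- Positions `0, …, |T|`; also used as the range of lengths and of depths. -/
def rng : List ℕ := List.range (T.length + 1)

/-- Feasible subscripts of `dref`. -/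
def FeasDref (i' l' i : ℕ) : Prop :=
  FeasA T i' i l' ∨ (i' + l' = i ∧ ∃ l ∈ rng T, FeasB T i' i l) ∨ ∃ l ∈ rng T, FeasC T i' l' i l

instance (i' l' i : ℕ) : Decidable (FeasDref T i' l' i) := by unfold FeasDref; infer_instance

/-- Feasible subscripts of `q`. -/
def FeasQ (i' l' : ℕ) : Prop :=
  (∃ i ∈ rng T, FeasDref T i' l' i) ∨
    ∃ i ∈ rng T, ∃ l ∈ rng T, FeasB T i' i l ∧ i' + l' = i + l

instance (i' l' : ℕ) : Decidable (FeasQ T i' l') := by unfold FeasQ; infer_instance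

/-- The elements `x` of `0, …, |T|` with `P x`. -/
def sel (P : ℕ → Prop) [DecidablePred P] : List ℕ := (rng T).filter fun x => decide (P x)

/-- The pairs of numbers in `0, …, |T|` with `P`. -/
def sel2 (P : ℕ → ℕ → Prop) [∀ x y, Decidable (P x y)] : List (ℕ × ℕ) :=
  (rng T).flatMap fun x => (sel T (P x)).map fun y => (x, y)

/-- The triples of numbers in `0, …, |T|` with `P`. -/
def sel3 (P : ℕ → ℕ → ℕ → Prop) [∀ x y z, Decidable (P x y z)] : List (ℕ × ℕ × ℕ) :=
  (rng T).flatMap fun x => (sel2 T (P x)).map fun y => (x, y)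

/-- The clauses for `x ↔ y₁ ∨ ⋯ ∨ y_m`. -/
def iffOr (x : ICSVar) (ys : List ICSVar) : List (SatClause ICSVar) :=
  (x.neg :: ys.map pos) :: ys.map fun y => [y.neg, x.pos]

/-- The clauses for `x ↔ l₁ ∧ ⋯ ∧ l_m` with literals `l₁, …, l_m`. -/
def iffAnd (x : ICSVar) (ls : List (SatLit ICSVar)) : List (SatClause ICSVar) :=
  (x.pos :: ls.map fun l => (l.1, !l.2)) :: ls.map fun l => [x.neg, l]

/-- Sequential-counter clauses that allow at most one of the variables `x₀, x₁, …` to be true; the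
auxiliary variable `s t` is true if one of `x₀, …, x_{t-1}` is. -/
def atMostOne (s : ℕ → ICSVar) (xs : List ICSVar) : List (SatClause ICSVar) :=
  xs.zipIdx.flatMap fun (x, t) =>
    [[x.neg, (s (t + 1)).pos], [(s t).neg, (s (t + 1)).pos], [x.neg, (s t).neg]]

/-- All variables saying that `T[i..i+l)` is a factor of a certain type with a certain reference. -/
def refs (i l : ℕ) : List ICSVar :=
  (sel T fun i' => FeasA T i' i l).map (fun i' => refA i' i l) ++
    (sel T fun i' => FeasB T i' i l).map (fun i' => refB i' i l) ++
    (sel2 T fun i' l' => FeasC T i' l' i l).map fun x => refC x.1 x.2 i l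

/-- The first and the last position are boundaries of factors. -/
def cEnds : List (SatClause ICSVar) := [[(p 0).pos], [(p T.length).pos]]

/-- Factors and their starting positions are consistent. -/
def cFactor : List (SatClause ICSVar) :=
  (sel2 T fun i l => FeasF T i l).flatMap fun (i, l) =>
    iffAnd (f i l)
      ((p i).pos :: (p (i + l)).pos :: (List.range (l - 1)).map fun t => (p (i + t + 1)).neg)

/-- A substring longer than `1` is a factor if and only if it has a type and a reference (in
particular it is not a factor if there is no candidate for them). -/
def cFactorRef : List (SatClause ICSVar) :=
  (sel2 T fun i l => 2 ≤ l ∧ FeasF T i l).flatMap fun (i, l) => iffOr (f i l) (refs T i l)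

/-- The type and the reference of a factor are unique. -/
def cUnique : List (SatClause ICSVar) :=
  (sel2 T fun i l => 2 ≤ l ∧ FeasF T i l).flatMap fun (i, l) => atMostOne (aux i l) (refs T i l)

/-- Definition of `dref`. -/
def cDref : List (SatClause ICSVar) :=
  (sel3 T fun i' l' i => FeasDref T i' l' i).flatMap fun (i', l', i) =>
    iffOr (dref i' l' i)
      ((if FeasA T i' i l' then [refA i' i l'] else []) ++
        (sel T fun l => i' + l' = i ∧ FeasB T i' i l).map (fun l => refB i' i l) ++
        (sel T fun l => FeasC T i' l' i l).map fun l => refC i' l' i l)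

/-- Definition of `q`. -/
def cInterval : List (SatClause ICSVar) :=
  (sel2 T fun i' l' => FeasQ T i' l').flatMap fun (i', l') =>
    iffOr (q i' l')
      ((sel T fun i => FeasDref T i' l' i).map (fun i => dref i' l' i) ++
        (sel2 T fun i l => FeasB T i' i l ∧ i' + l' = i + l).map fun x => refB i' x.1 x.2)

/-- The intervals begin and end at boundaries of factors. -/
def cBoundary : List (SatClause ICSVar) :=
  (sel2 T fun i' l' => FeasQ T i' l').flatMap fun (i', l') =>
    [[(q i' l').neg, (p i').pos], [(q i' l').neg, (p (i' + l')).pos]]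

/-- No two of the intervals cross. -/
def cNested : List (SatClause ICSVar) :=
  (sel2 T fun i₁ l₁ => FeasQ T i₁ l₁).flatMap fun (i₁, l₁) =>
    (sel2 T fun i₂ l₂ => FeasQ T i₂ l₂ ∧ i₁ < i₂ ∧ i₂ < i₁ + l₁ ∧ i₁ + l₁ < i₂ + l₂).map
      fun (i₂, l₂) => [(q i₁ l₁).neg, (q i₂ l₂).neg]

/-- None of the intervals is just a type-B factor. -/
def cNotB : List (SatClause ICSVar) :=
  (sel2 T fun i l => FeasQ T i l).flatMap fun (i, l) =>
    (sel T fun i' => FeasB T i' i l).map fun i' => [(q i l).neg, (refB i' i l).neg]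

/-- Reference depths are at least `0` and less than `|T|`. -/
def cDepthRange : List (SatClause ICSVar) :=
  (List.range T.length).flatMap fun i => [[(depth i 1 0).pos], [(depth i 1 T.length).neg]]

/-- A reference depth that is at least `d + 1` is at least `d`. -/
def cDepthMono : List (SatClause ICSVar) :=
  (List.range T.length).flatMap fun i => (List.range T.length).map fun d =>
    [(depth i 1 (d + 1)).neg, (depth i 1 d).pos]

/-- The reference depths of the positions `i` and `i + 1` agree if they are in the same factor. -/
def cDepthFactor : List (SatClause ICSVar) :=
  (List.range (T.length - 1)).flatMap fun i => (rng T).flatMap fun d =>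
    [[(p (i + 1)).pos, (depth (i + 1) 1 d).neg, (depth i 1 d).pos],
      [(p (i + 1)).pos, (depth i 1 d).neg, (depth (i + 1) 1 d).pos]]

/-- The reference depth of a substring is the maximum over its positions. -/
def cDepthMax : List (SatClause ICSVar) :=
  (sel2 T fun i l => FeasF T i l).flatMap fun (i, l) => (rng T).flatMap fun d =>
    iffOr (depth i l d) ((List.range l).map fun t => depth (i + t) 1 d)

/-- A factor that starts at `i` and refers to `T[i'..i'+l')` has a larger reference depth. -/
def cDepthRef : List (SatClause ICSVar) :=
  (sel3 T fun i' l' i => FeasDref T i' l' i).flatMap fun (i', l', i) =>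
    (List.range T.length).map fun d =>
      [(dref i' l' i).neg, (depth i 1 (d + 1)).pos, (depth i' l' d).neg]

/-- The soft clauses: few factors, and few type-C factors. -/
def softClauses : List (SatClause ICSVar) :=
  (rng T).map (fun i => [(p i).neg]) ++
    (sel2 T fun i' l' => i' + l' ≤ T.length).flatMap fun (i', l') =>
      (sel2 T fun i l => FeasC T i' l' i l).map fun (i, l) => [(refC i' l' i l).neg]

end ICSFormula

open ICSFormula in
/-- The MAX-SAT formulation for the string `T`. -/
def icsMaxSat {α : Type*} [DecidableEq α] (T : List α) : MaxSat ICSVar where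
  hard := cEnds T ++ cFactor T ++ cFactorRef T ++ cUnique T ++ cDref T ++ cInterval T ++
    cBoundary T ++ cNested T ++ cNotB T ++ cDepthRange T ++ cDepthMono T ++ cDepthFactor T ++
    cDepthMax T ++ cDepthRef T
  soft := softClauses T

open ICSFormula in
/-- The assignment `v` describes the categorized factorization `F` of `T`: the variables have their
intended meaning. -/
def Describes {α : Type*} [DecidableEq α] (T : List α) (v : ICSVar → Bool)
    (F : CatFactorization) : Prop :=
  (∀ i ≤ T.length, v (.p i) = true ↔ ∃ k ≤ F.count, F.pos k = i) ∧
  (∀ i l, FeasF T i l →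
    (v (.f i l) = true ↔ ∃ k < F.count, F.pos k = i ∧ F.pos (k + 1) = i + l)) ∧
  (∀ i' i l, FeasA T i' i l →
    (v (.refA i' i l) = true ↔ ∃ k < F.count, ∃ a b, F.kind k = .typeA a b ∧
      F.pos k = i ∧ F.pos (k + 1) = i + l ∧ F.pos a = i' ∧ F.pos (b + 1) = i' + l)) ∧
  (∀ i' i l, FeasB T i' i l →
    (v (.refB i' i l) = true ↔ ∃ k < F.count, ∃ a b, F.kind k = .typeB a b ∧
      F.pos k = i ∧ F.pos (k + 1) = i + l ∧ F.pos a = i' ∧ F.pos (b + 1) = i)) ∧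
  (∀ i' l' i l, FeasC T i' l' i l →
    (v (.refC i' l' i l) = true ↔ ∃ k < F.count, ∃ a b, F.kind k = .typeC a b ∧
      F.pos k = i ∧ F.pos (k + 1) = i + l ∧ F.pos a = i' ∧ F.pos (b + 1) = i' + l')) ∧
  (∀ i' l' i, FeasDref T i' l' i →
    (v (.dref i' l' i) = true ↔ ∃ k < F.count, ∃ a b, F.RefInterval k a b ∧
      F.pos k = i ∧ F.pos a = i' ∧ F.pos b = i' + l')) ∧
  (∀ i' l', FeasQ T i' l' →
    (v (.q i' l') = true ↔ ∃ x ∈ F.intervals, F.pos x.1 = i' ∧ F.pos x.2 = i' + l'))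

/-! ### Substrings and repeats -/

section Strings

variable {α : Type*}

/-! Conditions 1–3 describe grammar trees without mentioning trees. In the grammar tree of an ICS,
the leaves below a node form an interval, and two such intervals never cross. Every interval of I
belongs to a node with a nonterminal label, and no such node covers just a leaf `Y^(r-1)`. Labels
decrease from the root downwards, so the number of a nonterminal, refined by the position of the
leaf, yields reference depths. This is `IsICSFactorizationOf.isValidFor`.

Conversely, the non-crossing family I is completed to a binary tree over the factors: `splitAt` cuts
each node behind the longest proper interval that shares its left end, and by
`IsValidFor.not_across_split` no interval is cut apart. The inner nodes, the type-C factors and one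
factor for each symbol become nonterminals. A type-A factor reuses the nonterminal of its reference,
and a node whose right child is a type-B factor gets a repetition rule. The rules are acyclic
because the weight of a set of factors, the sum of `(h + 1) ^ D k`, decreases along each reference.
`IsSystemOf.exists_tree` follows the pruning in preorder and shows that the grammar tree of this
system is the chosen binary tree, so that the given factorization is recovered.

The sizes match. While a parse tree is pruned, each binary rule is expanded once and adds one leaf,
each truncation rule yields one leaf `Y[b..e)`, and each symbol needs a rule of its own. Hence an
ICS whose factorization has `h` factors, `c` of them of type C, has at least `h - 1 + c + σ`
nonterminals (`IsICSFactorizationOf.count_add_le`), and the constructed system has at most that many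
(`IsValidFor.exists_ics`). An assignment violates one soft clause for each of the `h + 1` boundaries
and one for each type-C factor (`Describes.numViolated_eq`), so fewest violations means fewest
nonterminals.

Hard clauses are read through `ICSFormula.Sem`, and `IsValidFor.exists_assignment` and
`Sem.exists_factorization` translate in the two directions. Repeats become self-overlaps by
`substr_eq_iff_strPow`, and depths are replaced by their ranks, so that unary counters up to `n`
suffice. The size is of order `n ^ 4` because no constraint group needs more than four free indices.
-/

theorem length_substr (w : List α) {i l : ℕ} (h : i + l ≤ w.length) :
    (substr w i l).length = l := by
  simp only [substr, List.length_take, List.length_drop]; omega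

theorem substr_add (w : List α) (i l₁ l₂ : ℕ) :
    substr w i (l₁ + l₂) = substr w i l₁ ++ substr w (i + l₁) l₂ := by
  simp only [substr, List.take_add, List.drop_drop]

theorem substr_zero_length (w : List α) : substr w 0 w.length = w := by simp [substr]

theorem substr_one (w : List α) {i : ℕ} (h : i < w.length) : substr w i 1 = [w[i]] := by
  simp [substr, List.take_one, List.getElem?_eq_getElem h]

theorem substr_infix (w : List α) (i l : ℕ) : substr w i l <:+: w :=
  (List.take_prefix _ _).isInfix.trans (List.drop_suffix _ _).isInfix

theorem exists_substr_of_infix {u w : List α} (h : u <:+: w) :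
    ∃ b, b + u.length ≤ w.length ∧ substr w b u.length = u := by
  obtain ⟨s, t, rfl⟩ := h
  refine ⟨s.length, by simp, ?_⟩
  simp [substr, List.append_assoc]

theorem strPow_zero (w : List α) : strPow w 0 = [] := rfl

theorem strPow_succ (w : List α) (r : ℕ) : strPow w (r + 1) = w ++ strPow w r := by
  simp [strPow, List.replicate_succ]

theorem strPow_succ' (w : List α) (r : ℕ) : strPow w (r + 1) = strPow w r ++ w := by
  simp [strPow, List.replicate_succ']

theorem length_strPow (w : List α) (r : ℕ) : (strPow w r).length = r * w.length := by
  simp [strPow]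

theorem mem_strPow {w : List α} {r : ℕ} {x : α} (h : x ∈ strPow w r) : x ∈ w := by
  simp only [strPow, List.mem_flatten, List.mem_replicate] at h
  obtain ⟨l, ⟨_, rfl⟩, hx⟩ := h
  exact hx

/-- The hypothesis makes `w` a prefix of `u ++ w`, so `w = u ++ w'` where `w'` is a prefix of `w`,
that is, of `u ++ w'`. Thus `w'` satisfies the same hypothesis with one copy of `u` less. -/
theorem eq_strPow_of_take_append {u : List α} (m : ℕ) : ∀ w : List α, w.length = m * u.length →
    (u ++ w).take w.length = w → w = strPow u m := by
  induction m with
  | zero => intro w hw _; simpa [strPow_zero] using hw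
  | succ m ih =>
    intro w hw h
    have hlen : u.length ≤ w.length := by rw [hw]; nlinarith
    rw [List.take_append, List.take_of_length_le hlen] at h
    set w' := w.take (w.length - u.length) with hw'
    have hl' : w'.length = m * u.length := by
      rw [hw', List.length_take, hw]
      have : (m + 1) * u.length - u.length = m * u.length := by
        rw [Nat.add_mul, one_mul, Nat.add_sub_cancel]
      rw [this, min_eq_left]; nlinarith
    have hkey : (u ++ w').take w'.length = w' := by
      have e : w'.length = w.length - u.length := by
        rw [hl', hw, Nat.add_mul, one_mul, Nat.add_sub_cancel]
      rw [h, e]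
    rw [← h, strPow_succ, ← ih w' hl' hkey]

theorem take_append_strPow (u : List α) (m : ℕ) :
    (u ++ strPow u m).take (strPow u m).length = strPow u m := by
  rw [← strPow_succ, strPow_succ', List.take_left]

/-- A substring repeats the substring of length `d` before it if and only if it equals the substring
of the same length that starts `d` positions earlier. -/
theorem substr_eq_iff_strPow (w : List α) {i d m : ℕ} (h : i + d + m * d ≤ w.length) :
    substr w i (m * d) = substr w (i + d) (m * d) ↔
      substr w (i + d) (m * d) = strPow (substr w i d) m := by
  set u := substr w i d with hu
  set v := substr w (i + d) (m * d) with hv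
  have hul : u.length = d := length_substr w (by nlinarith)
  have hvl : v.length = m * d := length_substr w h
  have huv : u ++ v = substr w i (d + m * d) := (substr_add w i d (m * d)).symm
  have htake : substr w i (m * d) = (u ++ v).take v.length := by
    rw [huv, hvl, substr, substr, List.take_take, min_eq_left]; omega
  rw [htake]
  constructor
  · intro e
    exact eq_strPow_of_take_append m v (by rw [hvl, hul]) e
  · intro e
    rw [e]; exact take_append_strPow u m

end Strings

/-! ### Factorizations -/

namespace CatFactorization

variable {α : Type*} {F : CatFactorization} {T : List α}

theorem pos_lt_pos (h : ∀ k < F.count, F.pos k < F.pos (k + 1)) {a b : ℕ} (hab : a < b)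
    (hb : b ≤ F.count) : F.pos a < F.pos b := by
  induction b, hab using Nat.le_induction with
  | base => exact h a (by omega)
  | succ b hab ih => exact (ih (by omega)).trans (h b (by omega))

theorem pos_lt_iff (h : ∀ k < F.count, F.pos k < F.pos (k + 1)) {a b : ℕ} (ha : a ≤ F.count)
    (hb : b ≤ F.count) : F.pos a < F.pos b ↔ a < b := by
  refine ⟨fun hlt => ?_, fun hlt => pos_lt_pos h hlt hb⟩
  by_contra hcon
  rcases (not_lt.1 hcon).lt_or_eq with h1 | h1
  · exact absurd (pos_lt_pos h h1 ha) (by omega)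
  · subst h1; omega

theorem pos_le_iff (h : ∀ k < F.count, F.pos k < F.pos (k + 1)) {a b : ℕ} (ha : a ≤ F.count)
    (hb : b ≤ F.count) : F.pos a ≤ F.pos b ↔ a ≤ b := by
  rw [← not_lt, ← not_lt, pos_lt_iff h hb ha]

theorem pos_inj (h : ∀ k < F.count, F.pos k < F.pos (k + 1)) {a b : ℕ} (ha : a ≤ F.count)
    (hb : b ≤ F.count) (e : F.pos a = F.pos b) : a = b :=
  le_antisymm ((pos_le_iff h ha hb).1 e.le) ((pos_le_iff h hb ha).1 e.ge)

theorem IsFactorizationOf.pos_le (h : F.IsFactorizationOf T) {k : ℕ} (hk : k ≤ F.count) :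
    F.pos k ≤ T.length := by
  rw [← h.2.1]; exact (pos_le_iff h.2.2 hk le_rfl).2 hk

theorem IsFactorizationOf.length_seg (h : F.IsFactorizationOf T) {i j : ℕ} (hij : i ≤ j + 1)
    (hj : j < F.count) : (F.seg T i j).length = F.pos (j + 1) - F.pos i := by
  have h1 := h.pos_le (k := j + 1) (by omega)
  have h2 := (pos_le_iff h.2.2 (a := i) (b := j + 1) (by omega) (by omega)).2 hij
  exact length_substr T (by omega)

theorem IsFactorizationOf.count_le (h : F.IsFactorizationOf T) : F.count ≤ T.length := by
  have key : ∀ k ≤ F.count, k ≤ F.pos k := by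
    intro k
    induction k with
    | zero => intro _; omega
    | succ k ih =>
      intro hk
      have := ih (by omega)
      have := h.2.2 k (by omega)
      omega
  rw [← h.2.1]; exact key _ le_rfl

end CatFactorization

/-! ### Semantics of the clauses -/

theorem SatClause.holds_iff {V : Type*} (v : V → Bool) (c : SatClause V) :
    SatClause.holds v c = true ↔ ∃ l ∈ c, v l.1 = l.2 := by
  simp [SatClause.holds]

namespace ICSFormula

open ICSVar

variable {α : Type*} (T : List α)

theorem mem_rng {x : ℕ} : x ∈ rng T ↔ x ≤ T.length := by
  simp [rng]

theorem mem_sel {P : ℕ → Prop} [DecidablePred P] {x : ℕ} :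
    x ∈ sel T P ↔ x ≤ T.length ∧ P x := by
  simp [sel, mem_rng]

theorem mem_sel2 {P : ℕ → ℕ → Prop} [∀ x y, Decidable (P x y)] {z : ℕ × ℕ} :
    z ∈ sel2 T P ↔ z.1 ≤ T.length ∧ z.2 ≤ T.length ∧ P z.1 z.2 := by
  obtain ⟨a, b⟩ := z
  simp [sel2, mem_rng, mem_sel]

theorem mem_sel3 {P : ℕ → ℕ → ℕ → Prop} [∀ x y z, Decidable (P x y z)] {z : ℕ × ℕ × ℕ} :
    z ∈ sel3 T P ↔ z.1 ≤ T.length ∧ z.2.1 ≤ T.length ∧ z.2.2 ≤ T.length ∧ P z.1 z.2.1 z.2.2 := by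
  obtain ⟨a, b, c⟩ := z
  simp [sel3, mem_rng, mem_sel2]

theorem nodup_rng : (rng T).Nodup := List.nodup_range

theorem nodup_sel (P : ℕ → Prop) [DecidablePred P] : (sel T P).Nodup :=
  (nodup_rng T).filter _

theorem nodup_sel2 (P : ℕ → ℕ → Prop) [∀ x y, Decidable (P x y)] : (sel2 T P).Nodup := by
  rw [sel2, List.nodup_flatMap]
  refine ⟨fun x _ => (nodup_sel T _).map fun a b h => by simpa using h, ?_⟩
  refine (nodup_rng T).imp ?_
  intro a b hab z hz hz'
  simp only [List.mem_map] at hz hz'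
  obtain ⟨_, _, rfl⟩ := hz
  obtain ⟨_, _, h⟩ := hz'
  simp only [Prod.mk.injEq] at h
  exact hab h.1.symm

theorem holds_iffOr (v : ICSVar → Bool) (x : ICSVar) (ys : List ICSVar) :
    (∀ c ∈ iffOr x ys, SatClause.holds v c = true) ↔ (v x = true ↔ ∃ y ∈ ys, v y = true) := by
  have key : (∃ l ∈ ys.map ICSVar.pos, v l.1 = l.2) ↔ ∃ y ∈ ys, v y = true := by
    simp [ICSVar.pos]
  simp only [iffOr, List.forall_mem_cons, List.forall_mem_map, SatClause.holds_iff,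
    List.exists_mem_cons_iff, key, ICSVar.neg]
  cases hx : v x <;> simp [ICSVar.pos, hx]

theorem holds_iffAnd (v : ICSVar → Bool) (x : ICSVar) (ls : List (SatLit ICSVar)) :
    (∀ c ∈ iffAnd x ls, SatClause.holds v c = true) ↔ (v x = true ↔ ∀ l ∈ ls, v l.1 = l.2) := by
  have key : (∃ l ∈ ls.map (fun l => (l.1, !l.2)), v l.1 = l.2) ↔ ¬ ∀ l ∈ ls, v l.1 = l.2 := by
    have h : ∀ a b : Bool, a = !b ↔ ¬ (a = b) := by decide
    constructor
    · rintro ⟨_, hl, e⟩ hall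
      obtain ⟨l, hl', rfl⟩ := List.mem_map.1 hl
      exact (h _ _).1 e (hall l hl')
    · intro hn
      by_contra hcon
      refine hn fun l hl => ?_
      by_contra hne
      exact hcon ⟨_, List.mem_map.2 ⟨l, hl, rfl⟩, (h _ _).2 hne⟩
  simp only [iffAnd, List.forall_mem_cons, List.forall_mem_map, SatClause.holds_iff,
    List.exists_mem_cons_iff, key, ICSVar.neg]
  cases hx : v x <;> simp [ICSVar.pos, hx]

variable {T} in
-- With this and the analogous bounds below, restricting subscripts to `rng` in the clause lists
-- loses nothing: feasible subscripts are automatically in range.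
theorem FeasDref.bounds {i' l' i : ℕ} (h : FeasDref T i' l' i) :
    i' ≤ T.length ∧ l' ≤ T.length ∧ i ≤ T.length ∧ 1 ≤ l' ∧ i' + l' ≤ T.length := by
  rcases h with h | ⟨h1, l, _, h⟩ | ⟨l, _, h⟩
  · have := h.1; have := h.2.1; have := h.2.2.1; omega
  · have := h.1; have := h.2.1; have := h.2.2.1; omega
  · have := h.1; have := h.2.1; have := h.2.2.1; have := h.2.2.2.1; omega

variable {T} in
theorem FeasQ.bounds {i' l' : ℕ} (h : FeasQ T i' l') :
    i' ≤ T.length ∧ l' ≤ T.length ∧ 1 ≤ l' ∧ i' + l' ≤ T.length := by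
  rcases h with ⟨i, _, h⟩ | ⟨i, _, l, _, h, h1⟩
  · have := h.bounds; omega
  · have := h.1; have := h.2.1; have := h.2.2.1; omega

variable {T} in
theorem FeasB.bounds {i' i l : ℕ} (h : FeasB T i' i l) :
    i' ≤ T.length ∧ i ≤ T.length ∧ l ≤ T.length := by
  have := h.1; have := h.2.1; have := h.2.2.1; omega

variable {T} in
theorem FeasA.bounds {i' i l : ℕ} (h : FeasA T i' i l) :
    i' ≤ T.length ∧ i ≤ T.length ∧ l ≤ T.length := by
  have := h.1; have := h.2.1; have := h.2.2.1; omega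

variable {T} in
theorem FeasC.bounds {i' l' i l : ℕ} (h : FeasC T i' l' i l) :
    i' ≤ T.length ∧ l' ≤ T.length ∧ i ≤ T.length ∧ l ≤ T.length := by
  have := h.1; have := h.2.1; have := h.2.2.1; have := h.2.2.2.1; omega

variable {T} in
theorem FeasF.bounds {i l : ℕ} (h : FeasF T i l) : i ≤ T.length ∧ l ≤ T.length := by
  have := h.1; have := h.2; omega

/-- The meaning of the hard clauses. -/
structure Sem [DecidableEq α] (v : ICSVar → Bool) : Prop where
  ends : v (p 0) = true ∧ v (p T.length) = true
  factor : ∀ i l, FeasF T i l → (v (f i l) = true ↔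
    v (p i) = true ∧ v (p (i + l)) = true ∧ ∀ t < l - 1, v (p (i + t + 1)) = false)
  factorRef : ∀ i l, 2 ≤ l → FeasF T i l → (v (f i l) = true ↔ ∃ y ∈ refs T i l, v y = true)
  unique : ∀ i l, 2 ≤ l → FeasF T i l → ∀ x t, (refs T i l)[t]? = some x →
    (v x = true → v (aux i l (t + 1)) = true) ∧
    (v (aux i l t) = true → v (aux i l (t + 1)) = true) ∧ ¬ (v x = true ∧ v (aux i l t) = true)
  drefIff : ∀ i' l' i, FeasDref T i' l' i → (v (dref i' l' i) = true ↔
    (FeasA T i' i l' ∧ v (refA i' i l') = true) ∨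
    (∃ l, i' + l' = i ∧ FeasB T i' i l ∧ v (refB i' i l) = true) ∨
    ∃ l, FeasC T i' l' i l ∧ v (refC i' l' i l) = true)
  interval : ∀ i' l', FeasQ T i' l' → (v (q i' l') = true ↔
    (∃ i, FeasDref T i' l' i ∧ v (dref i' l' i) = true) ∨
    ∃ i l, FeasB T i' i l ∧ i' + l' = i + l ∧ v (refB i' i l) = true)
  boundary : ∀ i' l', FeasQ T i' l' → v (q i' l') = true →
    v (p i') = true ∧ v (p (i' + l')) = true
  nested : ∀ i₁ l₁ i₂ l₂, FeasQ T i₁ l₁ → FeasQ T i₂ l₂ → i₁ < i₂ → i₂ < i₁ + l₁ →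
    i₁ + l₁ < i₂ + l₂ → ¬ (v (q i₁ l₁) = true ∧ v (q i₂ l₂) = true)
  notB : ∀ i' i l, FeasQ T i l → FeasB T i' i l →
    ¬ (v (q i l) = true ∧ v (refB i' i l) = true)
  depthRange : ∀ i < T.length, v (depth i 1 0) = true ∧ v (depth i 1 T.length) = false
  depthMono : ∀ i < T.length, ∀ d < T.length, v (depth i 1 (d + 1)) = true →
    v (depth i 1 d) = true
  depthFactor : ∀ i, i + 1 < T.length → ∀ d ≤ T.length, v (p (i + 1)) = false →
    (v (depth (i + 1) 1 d) = true ↔ v (depth i 1 d) = true)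
  depthMax : ∀ i l, FeasF T i l → ∀ d ≤ T.length,
    (v (depth i l d) = true ↔ ∃ t < l, v (depth (i + t) 1 d) = true)
  depthRef : ∀ i' l' i, FeasDref T i' l' i → ∀ d < T.length, v (dref i' l' i) = true →
    v (depth i' l' d) = true → v (depth i 1 (d + 1)) = true

variable {T}

theorem mem_refs [DecidableEq α] {i l : ℕ} {y : ICSVar} : y ∈ refs T i l ↔
    (∃ i', FeasA T i' i l ∧ y = refA i' i l) ∨ (∃ i', FeasB T i' i l ∧ y = refB i' i l) ∨
      ∃ i' l', FeasC T i' l' i l ∧ y = refC i' l' i l := by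
  simp only [refs, List.mem_append, List.mem_map, mem_sel, mem_sel2, Prod.exists, or_assoc]
  refine or_congr ?_ (or_congr ?_ ?_)
  · exact ⟨fun ⟨a, h, e⟩ => ⟨a, h.2, e.symm⟩, fun ⟨a, h, e⟩ => ⟨a, ⟨h.bounds.1, h⟩, e.symm⟩⟩
  · exact ⟨fun ⟨a, h, e⟩ => ⟨a, h.2, e.symm⟩, fun ⟨a, h, e⟩ => ⟨a, ⟨h.bounds.1, h⟩, e.symm⟩⟩
  · exact ⟨fun ⟨a, b, h, e⟩ => ⟨a, b, h.2.2, e.symm⟩,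
      fun ⟨a, b, h, e⟩ => ⟨a, b, ⟨h.bounds.1, h.bounds.2.1, h⟩, e.symm⟩⟩

theorem nodup_refs [DecidableEq α] (i l : ℕ) : (refs T i l).Nodup := by
  unfold refs
  refine List.Nodup.append (List.Nodup.append ?_ ?_ ?_) ?_ ?_
  · exact (nodup_sel T _).map fun a b h => by simpa using h
  · exact (nodup_sel T _).map fun a b h => by simpa using h
  · intro x hx hy
    simp only [List.mem_map] at hx hy
    obtain ⟨_, _, rfl⟩ := hx
    obtain ⟨_, _, h⟩ := hy
    cases h
  · exact (nodup_sel2 T _).map fun a b h => by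
      simp only [refC.injEq] at h
      exact Prod.ext h.1 h.2.1
  · intro x hx hy
    simp only [List.mem_map, List.mem_append] at hx hy
    obtain ⟨_, _, rfl⟩ := hy
    rcases hx with ⟨_, _, h⟩ | ⟨_, _, h⟩ <;> cases h

/-! ### Semantics of the individual clause groups -/

theorem holds_pos_cons (v : ICSVar → Bool) (x : ICSVar) (c : SatClause ICSVar) :
    SatClause.holds v (x.pos :: c) = true ↔ v x = true ∨ SatClause.holds v c = true := by
  simp [SatClause.holds_iff, ICSVar.pos]

theorem holds_neg_cons (v : ICSVar → Bool) (x : ICSVar) (c : SatClause ICSVar) :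
    SatClause.holds v (x.neg :: c) = true ↔ (v x = true → SatClause.holds v c = true) := by
  simp only [SatClause.holds_iff, ICSVar.neg, List.exists_mem_cons_iff]
  cases v x <;> simp

theorem holds_nil (v : ICSVar → Bool) : SatClause.holds v [] = true ↔ False := by
  simp [SatClause.holds_iff]

theorem holds_cEnds (v : ICSVar → Bool) :
    (∀ c ∈ cEnds T, SatClause.holds v c = true) ↔
    v (p 0) = true ∧ v (p T.length) = true := by
  simp [cEnds, holds_pos_cons, holds_nil]

theorem holds_cFactor (v : ICSVar → Bool) :
    (∀ c ∈ cFactor T, SatClause.holds v c = true) ↔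
    ∀ i l, FeasF T i l → (v (f i l) = true ↔
      v (p i) = true ∧ v (p (i + l)) = true ∧ ∀ t < l - 1, v (p (i + t + 1)) = false) := by
  simp only [cFactor, List.forall_mem_flatMap, mem_sel2, Prod.forall, holds_iffAnd,
    List.forall_mem_cons, List.forall_mem_map, List.mem_range, ICSVar.pos, ICSVar.neg]
  exact ⟨fun h i l hf => h i l ⟨hf.bounds.1, hf.bounds.2, hf⟩, fun h i l hf => h i l hf.2.2⟩

theorem holds_cFactorRef [DecidableEq α] (v : ICSVar → Bool) :
    (∀ c ∈ cFactorRef T, SatClause.holds v c = true) ↔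
    ∀ i l, 2 ≤ l → FeasF T i l → (v (f i l) = true ↔ ∃ y ∈ refs T i l, v y = true) := by
  simp only [cFactorRef, List.forall_mem_flatMap, mem_sel2, Prod.forall, holds_iffOr]
  exact ⟨fun h i l h2 hf => h i l ⟨hf.bounds.1, hf.bounds.2, h2, hf⟩,
    fun h i l hf => h i l hf.2.2.1 hf.2.2.2⟩

theorem holds_cUnique [DecidableEq α] (v : ICSVar → Bool) :
    (∀ c ∈ cUnique T, SatClause.holds v c = true) ↔
    ∀ i l, 2 ≤ l → FeasF T i l → ∀ x t, (refs T i l)[t]? = some x →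
      (v x = true → v (aux i l (t + 1)) = true) ∧
      (v (aux i l t) = true → v (aux i l (t + 1)) = true) ∧
      ¬ (v x = true ∧ v (aux i l t) = true) := by
  simp only [cUnique, atMostOne, List.forall_mem_flatMap, mem_sel2, Prod.forall,
    List.forall_mem_cons, holds_neg_cons, holds_pos_cons, holds_nil, List.mk_mem_zipIdx_iff_getElem?]
  constructor
  · intro h i l h2 hf x t hx
    have := h i l ⟨hf.bounds.1, hf.bounds.2, h2, hf⟩ x t hx
    tauto
  · intro h i l hf x t hx
    have := h i l hf.2.2.1 hf.2.2.2 x t hx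
    refine ⟨fun hv => Or.inl (this.1 hv), fun hv => Or.inl (this.2.1 hv), fun hv ha => ?_, by simp⟩
    exact this.2.2 ⟨hv, ha⟩

theorem holds_cDref [DecidableEq α] (v : ICSVar → Bool) :
    (∀ c ∈ cDref T, SatClause.holds v c = true) ↔
    ∀ i' l' i, FeasDref T i' l' i → (v (dref i' l' i) = true ↔
      (FeasA T i' i l' ∧ v (refA i' i l') = true) ∨
      (∃ l, i' + l' = i ∧ FeasB T i' i l ∧ v (refB i' i l) = true) ∨
      ∃ l, FeasC T i' l' i l ∧ v (refC i' l' i l) = true) := by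
  have aux : ∀ i' l' i, (∃ y ∈ ((if FeasA T i' i l' then [refA i' i l'] else []) ++
      (sel T fun l => i' + l' = i ∧ FeasB T i' i l).map (fun l => refB i' i l) ++
      (sel T fun l => FeasC T i' l' i l).map fun l => refC i' l' i l), v y = true) ↔
      (FeasA T i' i l' ∧ v (refA i' i l') = true) ∨
      (∃ l, i' + l' = i ∧ FeasB T i' i l ∧ v (refB i' i l) = true) ∨
      ∃ l, FeasC T i' l' i l ∧ v (refC i' l' i l) = true := by
    intro i' l' i
    simp only [List.mem_append, List.mem_map, mem_sel, or_and_right, exists_or, or_assoc]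
    refine or_congr ?_ (or_congr ?_ ?_)
    · split_ifs with hA <;> simp [hA]
    · constructor
      · rintro ⟨_, ⟨l, ⟨_, h1, h2⟩, rfl⟩, h3⟩
        exact ⟨l, h1, h2, h3⟩
      · rintro ⟨l, h1, h2, h3⟩
        exact ⟨_, ⟨l, ⟨h2.bounds.2.2, h1, h2⟩, rfl⟩, h3⟩
    · constructor
      · rintro ⟨_, ⟨l, ⟨_, h2⟩, rfl⟩, h3⟩
        exact ⟨l, h2, h3⟩
      · rintro ⟨l, h2, h3⟩
        exact ⟨_, ⟨l, ⟨h2.bounds.2.2.2, h2⟩, rfl⟩, h3⟩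
  simp only [cDref, List.forall_mem_flatMap, mem_sel3, Prod.forall, holds_iffOr, aux]
  exact ⟨fun h i' l' i hf => h i' l' i ⟨hf.bounds.1, hf.bounds.2.1, hf.bounds.2.2.1, hf⟩,
    fun h i' l' i hf => h i' l' i hf.2.2.2⟩

theorem holds_cInterval [DecidableEq α] (v : ICSVar → Bool) :
    (∀ c ∈ cInterval T, SatClause.holds v c = true) ↔
    ∀ i' l', FeasQ T i' l' → (v (q i' l') = true ↔
      (∃ i, FeasDref T i' l' i ∧ v (ICSVar.dref i' l' i) = true) ∨
      ∃ i l, FeasB T i' i l ∧ i' + l' = i + l ∧ v (refB i' i l) = true) := by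
  have aux : ∀ i' l', (∃ y ∈ ((sel T fun i => FeasDref T i' l' i).map
        (fun i => ICSVar.dref i' l' i) ++
      (sel2 T fun i l => FeasB T i' i l ∧ i' + l' = i + l).map fun x => refB i' x.1 x.2),
      v y = true) ↔
      (∃ i, FeasDref T i' l' i ∧ v (ICSVar.dref i' l' i) = true) ∨
      ∃ i l, FeasB T i' i l ∧ i' + l' = i + l ∧ v (refB i' i l) = true := by
    intro i' l'
    simp only [List.mem_append, List.mem_map, mem_sel, mem_sel2, or_and_right, exists_or,
      Prod.exists]
    refine or_congr ?_ ?_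
    · constructor
      · rintro ⟨_, ⟨i, ⟨_, h1⟩, rfl⟩, h3⟩
        exact ⟨i, h1, h3⟩
      · rintro ⟨i, h1, h3⟩
        exact ⟨_, ⟨i, ⟨h1.bounds.2.2.1, h1⟩, rfl⟩, h3⟩
    · constructor
      · rintro ⟨_, ⟨i, l, ⟨_, _, h1, h2⟩, rfl⟩, h3⟩
        exact ⟨i, l, h1, h2, h3⟩
      · rintro ⟨i, l, h1, h2, h3⟩
        exact ⟨_, ⟨i, l, ⟨h1.bounds.2.1, h1.bounds.2.2, h1, h2⟩, rfl⟩, h3⟩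
  simp only [cInterval, List.forall_mem_flatMap, mem_sel2, Prod.forall, holds_iffOr, aux]
  exact ⟨fun h i' l' hf => h i' l' ⟨hf.bounds.1, hf.bounds.2.1, hf⟩,
    fun h i' l' hf => h i' l' hf.2.2⟩

theorem holds_cBoundary [DecidableEq α] (v : ICSVar → Bool) :
    (∀ c ∈ cBoundary T, SatClause.holds v c = true) ↔
    ∀ i' l', FeasQ T i' l' → v (q i' l') = true →
      v (p i') = true ∧ v (p (i' + l')) = true := by
  simp only [cBoundary, List.forall_mem_flatMap, mem_sel2, Prod.forall, List.forall_mem_cons,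
    holds_neg_cons, holds_pos_cons, holds_nil, or_false]
  constructor
  · intro h i' l' hf hq
    have := h i' l' ⟨hf.bounds.1, hf.bounds.2.1, hf⟩
    exact ⟨this.1 hq, this.2.1 hq⟩
  · intro h i' l' hf
    exact ⟨fun hq => (h i' l' hf.2.2 hq).1, fun hq => (h i' l' hf.2.2 hq).2, by simp⟩

theorem holds_cNested [DecidableEq α] (v : ICSVar → Bool) :
    (∀ c ∈ cNested T, SatClause.holds v c = true) ↔
    ∀ i₁ l₁ i₂ l₂, FeasQ T i₁ l₁ → FeasQ T i₂ l₂ → i₁ < i₂ → i₂ < i₁ + l₁ →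
      i₁ + l₁ < i₂ + l₂ → ¬ (v (q i₁ l₁) = true ∧ v (q i₂ l₂) = true) := by
  simp only [cNested, List.forall_mem_flatMap, mem_sel2, Prod.forall, List.forall_mem_map,
    holds_neg_cons, holds_nil]
  constructor
  · intro h i₁ l₁ i₂ l₂ h1 h2 a b c hq
    exact h i₁ l₁ ⟨h1.bounds.1, h1.bounds.2.1, h1⟩ i₂ l₂
      ⟨h2.bounds.1, h2.bounds.2.1, h2, a, b, c⟩ hq.1 hq.2
  · intro h i₁ l₁ h1 i₂ l₂ h2 hq1 hq2
    exact h i₁ l₁ i₂ l₂ h1.2.2 h2.2.2.1 h2.2.2.2.1 h2.2.2.2.2.1 h2.2.2.2.2.2 ⟨hq1, hq2⟩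

theorem holds_cNotB [DecidableEq α] (v : ICSVar → Bool) :
    (∀ c ∈ cNotB T, SatClause.holds v c = true) ↔
    ∀ i' i l, FeasQ T i l → FeasB T i' i l →
      ¬ (v (q i l) = true ∧ v (refB i' i l) = true) := by
  simp only [cNotB, List.forall_mem_flatMap, mem_sel2, mem_sel, Prod.forall, List.forall_mem_map,
    holds_neg_cons, holds_nil]
  constructor
  · intro h i' i l h1 h2 hq
    exact h i l ⟨h1.bounds.1, h1.bounds.2.1, h1⟩ i' ⟨h2.bounds.1, h2⟩ hq.1 hq.2
  · intro h i l h1 i' h2 hq1 hq2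
    exact h i' i l h1.2.2 h2.2 ⟨hq1, hq2⟩

theorem holds_cDepthRange (v : ICSVar → Bool) :
    (∀ c ∈ cDepthRange T, SatClause.holds v c = true) ↔
    ∀ i < T.length, v (depth i 1 0) = true ∧ v (depth i 1 T.length) = false := by
  simp only [cDepthRange, List.forall_mem_flatMap, List.mem_range, List.forall_mem_cons,
    holds_neg_cons, holds_pos_cons, holds_nil, or_false]
  simp

theorem holds_cDepthMono (v : ICSVar → Bool) :
    (∀ c ∈ cDepthMono T, SatClause.holds v c = true) ↔
    ∀ i < T.length, ∀ d < T.length, v (depth i 1 (d + 1)) = true →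
      v (depth i 1 d) = true := by
  simp only [cDepthMono, List.forall_mem_flatMap, List.forall_mem_map, List.mem_range,
    holds_neg_cons, holds_pos_cons, holds_nil, or_false]

theorem holds_cDepthFactor (v : ICSVar → Bool) :
    (∀ c ∈ cDepthFactor T, SatClause.holds v c = true) ↔
    ∀ i, i + 1 < T.length → ∀ d ≤ T.length, v (p (i + 1)) = false →
      (v (depth (i + 1) 1 d) = true ↔ v (depth i 1 d) = true) := by
  simp only [cDepthFactor, List.forall_mem_flatMap, List.mem_range, mem_rng,
    List.forall_mem_cons, holds_neg_cons, holds_pos_cons, holds_nil, or_false]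
  constructor
  · intro h i hi d hd hp
    have := h i (by omega) d hd
    simp only [hp] at this
    simp at this
    exact ⟨this.1, this.2⟩
  · intro h i hi d hd
    have := h i (by omega) d hd
    cases hp : v (p (i + 1)) <;> simp [hp] at this ⊢
    simp [this]

theorem holds_cDepthMax (v : ICSVar → Bool) :
    (∀ c ∈ cDepthMax T, SatClause.holds v c = true) ↔
    ∀ i l, FeasF T i l → ∀ d ≤ T.length,
      (v (depth i l d) = true ↔ ∃ t < l, v (depth (i + t) 1 d) = true) := by
  simp only [cDepthMax, List.forall_mem_flatMap, mem_sel2, Prod.forall, mem_rng, holds_iffOr,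
    List.mem_map, List.mem_range]
  constructor
  · intro h i l hf d hd
    rw [h i l ⟨hf.bounds.1, hf.bounds.2, hf⟩ d hd]
    exact ⟨fun ⟨_, ⟨t, h1, rfl⟩, h2⟩ => ⟨t, h1, h2⟩, fun ⟨t, h1, h2⟩ => ⟨_, ⟨t, h1, rfl⟩, h2⟩⟩
  · intro h i l hf d hd
    rw [h i l hf.2.2 d hd]
    exact ⟨fun ⟨t, h1, h2⟩ => ⟨_, ⟨t, h1, rfl⟩, h2⟩, fun ⟨_, ⟨t, h1, rfl⟩, h2⟩ => ⟨t, h1, h2⟩⟩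

theorem holds_cDepthRef [DecidableEq α] (v : ICSVar → Bool) :
    (∀ c ∈ cDepthRef T, SatClause.holds v c = true) ↔
    ∀ i' l' i, FeasDref T i' l' i → ∀ d < T.length, v (ICSVar.dref i' l' i) = true →
      v (depth i' l' d) = true → v (depth i 1 (d + 1)) = true := by
  simp only [cDepthRef, List.forall_mem_flatMap, mem_sel3, Prod.forall, List.forall_mem_map,
    List.mem_range, holds_neg_cons, holds_pos_cons, holds_nil]
  constructor
  · intro h i' l' i hf d hd h1 h2
    have := h i' l' i ⟨hf.bounds.1, hf.bounds.2.1, hf.bounds.2.2.1, hf⟩ d hd h1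
    tauto
  · intro h i' l' i hf d hd h1
    have := h i' l' i hf.2.2.2 d hd h1
    tauto

theorem satHard_iff_sem [DecidableEq α] (v : ICSVar → Bool) : (icsMaxSat T).SatHard v ↔ Sem T v := by
  have hsplit : (icsMaxSat T).SatHard v ↔
      (∀ c ∈ cEnds T, SatClause.holds v c = true) ∧ (∀ c ∈ cFactor T, SatClause.holds v c = true) ∧
      (∀ c ∈ cFactorRef T, SatClause.holds v c = true) ∧
      (∀ c ∈ cUnique T, SatClause.holds v c = true) ∧
      (∀ c ∈ cDref T, SatClause.holds v c = true) ∧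
      (∀ c ∈ cInterval T, SatClause.holds v c = true) ∧
      (∀ c ∈ cBoundary T, SatClause.holds v c = true) ∧
      (∀ c ∈ cNested T, SatClause.holds v c = true) ∧
      (∀ c ∈ cNotB T, SatClause.holds v c = true) ∧
      (∀ c ∈ cDepthRange T, SatClause.holds v c = true) ∧
      (∀ c ∈ cDepthMono T, SatClause.holds v c = true) ∧
      (∀ c ∈ cDepthFactor T, SatClause.holds v c = true) ∧
      (∀ c ∈ cDepthMax T, SatClause.holds v c = true) ∧
      (∀ c ∈ cDepthRef T, SatClause.holds v c = true) := by
    simp only [MaxSat.SatHard, icsMaxSat, List.forall_mem_append, and_assoc]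
  rw [hsplit, holds_cEnds, holds_cFactor, holds_cFactorRef, holds_cUnique, holds_cDref, holds_cInterval, holds_cBoundary, holds_cNested, holds_cNotB,
    holds_cDepthRange, holds_cDepthMono, holds_cDepthFactor, holds_cDepthMax, holds_cDepthRef]
  exact ⟨fun ⟨a, b, c, d, e, h, g, h', i, j, k, l, m, n⟩ =>
    ⟨a, b, c, d, e, h, g, h', i, j, k, l, m, n⟩,
    fun ⟨a, b, c, d, e, h, g, h', i, j, k, l, m, n⟩ =>
      ⟨a, b, c, d, e, h, g, h', i, j, k, l, m, n⟩⟩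

end ICSFormula

/-! ### The meaning of the variables -/

namespace CatFactorization

open ICSFormula

variable {α : Type*} (F : CatFactorization) (T : List α)

/-- `i` is a boundary of a factor. -/
def BoundaryAt (i : ℕ) : Prop := ∃ k ≤ F.count, F.pos k = i

/-- `[i..i+l)` is a factor. -/
def FactorAt (i l : ℕ) : Prop := ∃ k < F.count, F.pos k = i ∧ F.pos (k + 1) = i + l

/-- `[i..i+l)` is a type-A factor with reference `[i'..i'+l)`. -/
def TypeAAt (i' i l : ℕ) : Prop := ∃ k < F.count, ∃ a b, F.kind k = .typeA a b ∧
  F.pos k = i ∧ F.pos (k + 1) = i + l ∧ F.pos a = i' ∧ F.pos (b + 1) = i' + l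

/-- `[i..i+l)` is a type-B factor with reference `[i'..i)`. -/
def TypeBAt (i' i l : ℕ) : Prop := ∃ k < F.count, ∃ a b, F.kind k = .typeB a b ∧
  F.pos k = i ∧ F.pos (k + 1) = i + l ∧ F.pos a = i' ∧ F.pos (b + 1) = i

/-- `[i..i+l)` is a type-C factor with reference `[i'..i'+l')`. -/
def TypeCAt (i' l' i l : ℕ) : Prop := ∃ k < F.count, ∃ a b, F.kind k = .typeC a b ∧
  F.pos k = i ∧ F.pos (k + 1) = i + l ∧ F.pos a = i' ∧ F.pos (b + 1) = i' + l'

/-- The factor that starts at `i` refers to `[i'..i'+l')`. -/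
def RefAt (i' l' i : ℕ) : Prop := ∃ k < F.count, ∃ a b, F.RefInterval k a b ∧
  F.pos k = i ∧ F.pos a = i' ∧ F.pos b = i' + l'

/-- `[i'..i'+l')` is one of the intervals of the tree structure. -/
def IntervalAt (i' l' : ℕ) : Prop := ∃ x ∈ F.intervals, F.pos x.1 = i' ∧ F.pos x.2 = i' + l'

/-- The conditions on a factor, in terms of positions. -/
def FeasKind (k : ℕ) : Prop :=
  match F.kind k with
  | .single => F.pos (k + 1) = F.pos k + 1
  | .typeA a b => a ≤ b ∧ b < F.count ∧ F.pos (b + 1) = F.pos a + (F.pos (k + 1) - F.pos k) ∧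
      FeasA T (F.pos a) (F.pos k) (F.pos (k + 1) - F.pos k)
  | .typeB a b => a ≤ b ∧ b + 1 = k ∧ FeasB T (F.pos a) (F.pos k) (F.pos (k + 1) - F.pos k)
  | .typeC a b => a ≤ b ∧ b < F.count ∧
      FeasC T (F.pos a) (F.pos (b + 1) - F.pos a) (F.pos k) (F.pos (k + 1) - F.pos k)

variable {F T}

/-- Indices of factors and positions in the text are ordered alike, so only the string conditions
need work. For type A, equal strings have equal lengths, which fixes the end of the reference. For
type B, `substr_eq_iff_strPow` turns a repeat into an equality of overlapping substrings. For type
C, the reference is at least as long as the factor. -/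
theorem IsFactorizationOf.kindOK_iff (h : F.IsFactorizationOf T) {k : ℕ} (hk : k < F.count) :
    F.KindOK T k ↔ F.FeasKind T k := by
  have hk1 := h.2.2 k hk
  have hkn := h.pos_le (k := k + 1) hk
  have hkk : F.seg T k k = substr T (F.pos k) (F.pos (k + 1) - F.pos k) := rfl
  have hkl := h.length_seg (i := k) (j := k) (by omega) hk
  unfold KindOK FeasKind
  cases hkind : F.kind k with
  | single => rfl
  | typeA a b =>
    simp only
    constructor
    · rintro ⟨h1, h2, h3, h4⟩
      have hab := h.length_seg (i := a) (j := b) (by omega) (by omega)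
      rw [← h4, hkl] at hab
      have hlt := pos_lt_pos h.2.2 (a := a) (b := b + 1) (by omega) (by omega)
      have hle := (pos_le_iff h.2.2 (a := b + 1) (b := k) (by omega) (by omega)).2 (by omega)
      refine ⟨h2, by omega, by omega, by omega, by omega, by omega, ?_⟩
      rw [hkk, seg, ← hab] at h4
      exact h4.symm
    · rintro ⟨h1, h2, h3, h4, h5, h6, h7⟩
      refine ⟨by omega, h1, ?_, ?_⟩
      · have := (pos_le_iff h.2.2 (a := b + 1) (b := k) (by omega) (by omega)).1 (by omega)
        omega
      · rw [hkk, ← h7, seg, h3, Nat.add_sub_cancel_left]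
  | typeB a b =>
    simp only
    constructor
    · rintro ⟨h1, h2, h3, r, hr, h4⟩
      subst h3
      have hab := h.length_seg (i := a) (j := b) (by omega) (by omega)
      have hlt := pos_lt_pos h.2.2 (a := a) (b := b + 1) (by omega) (by omega)
      obtain ⟨d, hd⟩ : ∃ d, F.pos (b + 1) = F.pos a + d := ⟨_, (Nat.add_sub_of_le hlt.le).symm⟩
      obtain ⟨m, rfl⟩ : ∃ m, r = m + 1 := ⟨r - 1, by omega⟩
      have hlen : F.pos (b + 1 + 1) - F.pos (b + 1) = m * d := by
        rw [← hkl, h4, length_strPow, hab, hd]; simp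
      refine ⟨h2, rfl, by omega, by omega, hlt, ?_, ?_, ?_⟩
      · rw [hlen, hd]
        -- At least two copies of the base make the factor longer than the base.
        have : 2 ≤ m := by omega
        nlinarith
      · rw [hlen, hd, substr_eq_iff_strPow]
        · rw [← hlen, ← hd, ← hkk, h4, seg, hd]; simp
        · omega
      · rw [hlen, hd]; simp
    · rintro ⟨h1, h2, h3, h4, h5, h6, h7, m, hm⟩
      subst h2
      obtain ⟨d, hd⟩ : ∃ d, F.pos (b + 1) = F.pos a + d := ⟨_, (Nat.add_sub_of_le h5.le).symm⟩
      have hdm : F.pos (b + 1) - F.pos a = d := by omega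
      rw [hdm, mul_comm] at hm
      rw [hm, hd, substr_eq_iff_strPow] at h7
      · refine ⟨by omega, h1, rfl, m + 1, ?_, ?_⟩
        · rw [hm] at h6
          -- The requirement `i < i' + l` says `d < m * d`, which excludes `m ≤ 1`.
          by_contra hcon
          have : m ≤ 1 := by omega
          have : m * d ≤ 1 * d := Nat.mul_le_mul_right _ this
          omega
        · rw [hkk, hm, hd, h7, seg, hd]; simp
      · omega
  | typeC a b =>
    simp only
    have key : ∀ {a b : ℕ}, a ≤ b → b < F.count → F.pos a < F.pos (b + 1) :=
      fun h1 h2 => pos_lt_pos h.2.2 (by omega) (by omega)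
    constructor
    · rintro ⟨h1, h2, h3, h4, h5⟩
      have hab := h.length_seg (i := a) (j := b) (by omega) (by omega)
      have hlen := h5.length_le
      have hbn := h.pos_le (k := b + 1) (by omega)
      have := key h2 h3
      rw [hkl, hab] at hlen
      refine ⟨h2, h3, by omega, by omega, by omega, by omega, ?_, h5⟩
      rcases h4 with h4 | h4
      · have := (pos_le_iff h.2.2 (a := k + 1) (b := a) (by omega) (by omega)).2 (by omega)
        omega
      · have := (pos_le_iff h.2.2 (a := b + 1) (b := k) (by omega) (by omega)).2 (by omega)
        omega
    · rintro ⟨h2, h3, h4, h5, h6, h7, h8, h9⟩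
      have := key h2 h3
      refine ⟨by omega, h2, h3, ?_, h9⟩
      rcases h8 with h8 | h8
      · have := (pos_le_iff h.2.2 (a := k + 1) (b := a) (by omega) (by omega)).1 (by omega)
        omega
      · have := (pos_le_iff h.2.2 (a := b + 1) (b := k) (by omega) (by omega)).1 (by omega)
        omega

theorem IsFactorizationOf.factorAt_iff (h : F.IsFactorizationOf T) {i l : ℕ} (hl : 1 ≤ l) :
    F.FactorAt i l ↔ F.BoundaryAt i ∧ F.BoundaryAt (i + l) ∧
      ∀ t < l - 1, ¬ F.BoundaryAt (i + t + 1) := by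
  constructor
  · rintro ⟨k, hk, h1, h2⟩
    refine ⟨⟨k, hk.le, h1⟩, ⟨k + 1, hk, h2⟩, ?_⟩
    rintro t ht ⟨k', hk', h3⟩
    have a1 := (pos_lt_iff h.2.2 hk.le hk').1 (by omega)
    have a2 := (pos_lt_iff h.2.2 hk' (b := k + 1) (by omega)).1 (by omega)
    omega
  · rintro ⟨⟨k, hk, h1⟩, ⟨k', hk', h2⟩, h3⟩
    have a1 := (pos_lt_iff h.2.2 hk hk').1 (by omega)
    refine ⟨k, by omega, h1, ?_⟩
    have a2 := (pos_le_iff h.2.2 (a := k + 1) (by omega) hk').2 (by omega)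
    have a3 := h.2.2 k (by omega)
    by_contra hne
    -- If the factor ended earlier, its end would be a boundary strictly inside the substring.
    exact h3 (F.pos (k + 1) - i - 1) (by omega) ⟨k + 1, by omega, by omega⟩

theorem TypeAAt.factorAt {i' i l : ℕ} : F.TypeAAt i' i l → F.FactorAt i l :=
  fun ⟨k, hk, _, _, _, h1, h2, _⟩ => ⟨k, hk, h1, h2⟩

theorem TypeBAt.factorAt {i' i l : ℕ} : F.TypeBAt i' i l → F.FactorAt i l :=
  fun ⟨k, hk, _, _, _, h1, h2, _⟩ => ⟨k, hk, h1, h2⟩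

theorem TypeCAt.factorAt {i' l' i l : ℕ} : F.TypeCAt i' l' i l → F.FactorAt i l :=
  fun ⟨k, hk, _, _, _, h1, h2, _⟩ => ⟨k, hk, h1, h2⟩

theorem factorAt_iff_type (hK : ∀ k < F.count, F.FeasKind T k)
    {i l : ℕ} (hl : 2 ≤ l) : F.FactorAt i l ↔
      (∃ i', FeasA T i' i l ∧ F.TypeAAt i' i l) ∨ (∃ i', FeasB T i' i l ∧ F.TypeBAt i' i l) ∨
        ∃ i' l', FeasC T i' l' i l ∧ F.TypeCAt i' l' i l := by
  constructor
  · rintro ⟨k, hk, h1, h2⟩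
    have hk' := hK k hk
    have hlen : F.pos (k + 1) - i = l := by omega
    unfold FeasKind at hk'
    cases hkind : F.kind k with
    | single => simp only [hkind] at hk'; omega
    | typeA a b =>
      simp only [hkind, h1, hlen] at hk'
      exact Or.inl ⟨_, hk'.2.2.2, k, hk, a, b, hkind, h1, h2, rfl, hk'.2.2.1⟩
    | typeB a b =>
      simp only [hkind, h1, hlen] at hk'
      exact Or.inr (Or.inl ⟨_, hk'.2.2, k, hk, a, b, hkind, h1, h2, rfl, by rw [hk'.2.1, h1]⟩)
    | typeC a b =>
      simp only [hkind, h1, hlen] at hk'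
      refine Or.inr (Or.inr ⟨_, _, hk'.2.2, k, hk, a, b, hkind, h1, h2, rfl, ?_⟩)
      have := hk'.2.2.2.1
      omega
  · rintro (⟨_, _, h⟩ | ⟨_, _, h⟩ | ⟨_, _, _, h⟩) <;> exact h.factorAt

theorem refAt_iff (hK : ∀ k < F.count, F.FeasKind T k) {i' l' i : ℕ} : F.RefAt i' l' i ↔
    (FeasA T i' i l' ∧ F.TypeAAt i' i l') ∨
    (∃ l, i' + l' = i ∧ FeasB T i' i l ∧ F.TypeBAt i' i l) ∨
    ∃ l, FeasC T i' l' i l ∧ F.TypeCAt i' l' i l := by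
  constructor
  · rintro ⟨k, hk, a, b, ⟨i₀, j₀, hkind, rfl, rfl⟩, h1, h2, h3⟩
    have hk' := hK k hk
    unfold FeasKind at hk'
    rcases hkind with hkind | hkind | hkind
    · simp only [hkind, h1, h2] at hk'
      have hl : F.pos (k + 1) - i = l' := by omega
      rw [hl] at hk'
      have := hk'.2.2.2.1
      exact Or.inl ⟨hk'.2.2.2, k, hk, _, _, hkind, h1, by omega, h2, h3⟩
    · simp only [hkind, h1, h2] at hk'
      have := hk'.2.2.1
      have e : F.pos (j₀ + 1) = i := by rw [hk'.2.1, h1]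
      refine Or.inr (Or.inl ⟨_, ?_, hk'.2.2, k, hk, _, _, hkind, h1, by omega, h2, e⟩)
      rw [← h3, e]
    · simp only [hkind, h1, h2] at hk'
      have := hk'.2.2.1
      have e : F.pos (j₀ + 1) - i' = l' := by omega
      rw [e] at hk'
      exact Or.inr (Or.inr ⟨_, hk'.2.2, k, hk, _, _, hkind, h1, by omega, h2, h3⟩)
  · rintro (⟨_, k, hk, a, b, hkind, h1, h2, h3, h4⟩ |
      ⟨_, hl, _, k, hk, a, b, hkind, h1, h2, h3, h4⟩ |
      ⟨_, _, k, hk, a, b, hkind, h1, h2, h3, h4⟩)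
    · exact ⟨k, hk, a, b + 1, ⟨a, b, Or.inl hkind, rfl, rfl⟩, h1, h3, h4⟩
    · exact ⟨k, hk, a, b + 1, ⟨a, b, Or.inr (Or.inl hkind), rfl, rfl⟩, h1, h3, by rw [h4, hl]⟩
    · exact ⟨k, hk, a, b + 1, ⟨a, b, Or.inr (Or.inr hkind), rfl, rfl⟩, h1, h3, h4⟩

theorem RefAt.feasDref (hK : ∀ k < F.count, F.FeasKind T k) {i' l' i : ℕ} (h : F.RefAt i' l' i) :
    FeasDref T i' l' i := by
  rcases (refAt_iff hK).1 h with h | ⟨l, e, h, _⟩ | ⟨l, h, _⟩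
  · exact Or.inl h.1
  · exact Or.inr (Or.inl ⟨e, l, (mem_rng T).2 h.bounds.2.2, h⟩)
  · exact Or.inr (Or.inr ⟨l, (mem_rng T).2 h.bounds.2.2.2, h⟩)

theorem IsFactorizationOf.ref_bounds (h : F.IsFactorizationOf T)
    (hK : ∀ k < F.count, F.FeasKind T k) {k a b : ℕ} (hk : k < F.count)
    (hab : F.RefInterval k a b) : a < b ∧ b ≤ F.count ∧ (b ≤ k ∨ k < a) := by
  obtain ⟨i, j, hkind, rfl, rfl⟩ := hab
  have hk' := (h.kindOK_iff hk).2 (hK k hk)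
  unfold KindOK at hk'
  rcases hkind with hkind | hkind | hkind <;> simp only [hkind] at hk' <;> omega

theorem IsFactorizationOf.interval_bounds (h : F.IsFactorizationOf T)
    (hK : ∀ k < F.count, F.FeasKind T k) {x : ℕ × ℕ} (hx : x ∈ F.intervals) :
    x.1 < x.2 ∧ x.2 ≤ F.count := by
  obtain ⟨k, hk, hx | ⟨i, j, hkind, rfl⟩⟩ := hx
  · have := h.ref_bounds hK hk hx; omega
  · have := h.ref_bounds hK hk ⟨i, j, Or.inr (Or.inl hkind), rfl, rfl⟩
    have hk' := hK k hk
    simp only [FeasKind, hkind] at hk'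
    simp only; omega

theorem IsFactorizationOf.intervalAt_iff (h : F.IsFactorizationOf T)
    (hK : ∀ k < F.count, F.FeasKind T k) {i' l' : ℕ} : F.IntervalAt i' l' ↔
    (∃ i, FeasDref T i' l' i ∧ F.RefAt i' l' i) ∨
    ∃ i l, FeasB T i' i l ∧ i' + l' = i + l ∧ F.TypeBAt i' i l := by
  constructor
  · rintro ⟨⟨a, b⟩, ⟨k, hk, hx | ⟨a', b', hkind, e⟩⟩, h1, h2⟩
    · have hr : F.RefAt i' l' (F.pos k) := ⟨k, hk, a, b, hx, rfl, h1, h2⟩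
      exact Or.inl ⟨_, hr.feasDref hK, hr⟩
    · simp only [Prod.mk.injEq] at e
      obtain ⟨rfl, rfl⟩ := e
      have hk' := hK k hk
      simp only [FeasKind, hkind] at hk'
      simp only at h1 h2
      have := h.2.2 k hk
      rw [h1] at hk'
      exact Or.inr ⟨_, _, hk'.2.2, by omega, k, hk, _, _, hkind, rfl, by omega, h1,
        by rw [hk'.2.1]⟩
  · rintro (⟨_, _, k, hk, a, b, hx, _, h2, h3⟩ | ⟨_, _, _, e, k, hk, a, b, hkind, h1, h2, h3, _⟩)
    · exact ⟨(a, b), ⟨k, hk, Or.inl hx⟩, h2, h3⟩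
    · exact ⟨(a, k + 1), ⟨k, hk, Or.inr ⟨a, b, hkind, rfl⟩⟩, h3, by simp only; omega⟩

theorem IsFactorizationOf.feasQ_of_intervalAt (h : F.IsFactorizationOf T)
    (hK : ∀ k < F.count, F.FeasKind T k) {i' l' : ℕ} (hI : F.IntervalAt i' l') :
    FeasQ T i' l' := by
  rcases (h.intervalAt_iff hK).1 hI with ⟨i, h1, _⟩ | ⟨i, l, h1, h2, _⟩
  · exact Or.inl ⟨i, (mem_rng T).2 h1.bounds.2.2.1, h1⟩
  · exact Or.inr ⟨i, (mem_rng T).2 h1.bounds.2.1, l, (mem_rng T).2 h1.bounds.2.2, h1, h2⟩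

end CatFactorization

/-! ### Assignments and factorizations -/

/-- Strictly increasing enumeration of the numbers up to `n` with `P`. -/
theorem exists_enumeration (P : ℕ → Prop) (n : ℕ) (h0 : P 0) (hn : P n) :
    ∃ (h : ℕ) (pos : ℕ → ℕ), pos 0 = 0 ∧ pos h = n ∧ (∀ k < h, pos k < pos (k + 1)) ∧
      ∀ i ≤ n, P i ↔ ∃ k ≤ h, pos k = i := by
  classical
  -- Adding all numbers beyond `n` makes the set infinite, so that `Nat.nth` is strictly monotone
  -- everywhere; the numbers up to `n` are unaffected.
  let Q : ℕ → Prop := fun i => P i ∨ n < i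
  have hinf : {i | Q i}.Infinite :=
    Set.infinite_of_not_bddAbove fun ⟨b, hb⟩ => by
      have := hb (show b + n + 1 ∈ {i | Q i} from Or.inr (by omega))
      omega
  have hmono := Nat.nth_strictMono hinf
  refine ⟨Nat.count Q n, Nat.nth Q, ?_, Nat.nth_count (Or.inl hn),
    fun k _ => hmono (Nat.lt_succ_self k), fun i hi => ⟨fun hP => ?_, ?_⟩⟩
  · have := Nat.nth_count (p := Q) (n := 0) (Or.inl h0)
    simpa using this
  · exact ⟨Nat.count Q i, Nat.count_monotone Q hi, Nat.nth_count (Or.inl hP)⟩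
  · rintro ⟨k, _, rfl⟩
    rcases Nat.nth_mem_of_infinite hinf k with h | h
    · exact h
    · exact absurd (show n < Nat.nth Q k from h) (by omega)

section Assignments

open ICSFormula CatFactorization

variable {α : Type*} [DecidableEq α] {T : List α}

theorem describes_iff {v : ICSVar → Bool} {F : CatFactorization} : Describes T v F ↔
    (∀ i ≤ T.length, v (.p i) = true ↔ F.BoundaryAt i) ∧
    (∀ i l, FeasF T i l → (v (.f i l) = true ↔ F.FactorAt i l)) ∧
    (∀ i' i l, FeasA T i' i l → (v (.refA i' i l) = true ↔ F.TypeAAt i' i l)) ∧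
    (∀ i' i l, FeasB T i' i l → (v (.refB i' i l) = true ↔ F.TypeBAt i' i l)) ∧
    (∀ i' l' i l, FeasC T i' l' i l → (v (.refC i' l' i l) = true ↔ F.TypeCAt i' l' i l)) ∧
    (∀ i' l' i, FeasDref T i' l' i → (v (.dref i' l' i) = true ↔ F.RefAt i' l' i)) ∧
    (∀ i' l', FeasQ T i' l' → (v (.q i' l') = true ↔ F.IntervalAt i' l')) :=
  Iff.rfl

namespace CatFactorization

variable {F : CatFactorization}

/-- Reference depths can be chosen smaller than the number of factors. -/
theorem HasDepths.exists_lt_count (h : F.HasDepths) : ∃ D : ℕ → ℕ,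
    (∀ k < F.count, D k < F.count) ∧ ∀ k < F.count, (F.kind k = .single → D k = 0) ∧
      ∀ a b, F.RefInterval k a b → ∀ t, a ≤ t → t < b → t < F.count → D t < D k := by
  classical
  obtain ⟨D, hD⟩ := h
  let S := (Finset.range F.count).image D
  have hS : S.card ≤ F.count := Finset.card_image_le.trans (by simp)
  -- Each depth is replaced by its rank among the depths that occur. Strict inequalities survive, 0
  -- stays 0, and there are at most as many ranks as factors.
  refine ⟨fun k => (S.filter (· < D k)).card, fun k hk => ?_, fun k hk => ⟨fun hs => ?_, ?_⟩⟩
  · refine lt_of_lt_of_le (Finset.card_lt_card ?_) hS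
    refine Finset.filter_ssubset.2 ⟨D k, Finset.mem_image_of_mem _ (by simpa using hk), by simp⟩
  · simp [(hD k hk).1 hs]
  · intro a b hab t h1 h2 ht
    have hlt := (hD k hk).2 a b hab t h1 h2
    refine Finset.card_lt_card ?_
    refine (Finset.ssubset_iff_of_subset ?_).2 ⟨D t, ?_, by simp⟩
    · intro x hx
      simp only [Finset.mem_filter] at hx ⊢
      exact ⟨hx.1, hx.2.trans hlt⟩
    · simp only [Finset.mem_filter]
      exact ⟨Finset.mem_image_of_mem _ (by simpa using ht), hlt⟩

variable (F T)

/-- The intended meaning of the variables that are not auxiliary variables. -/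
def Meaning (D : ℕ → ℕ) : ICSVar → Prop
  | .f i l => F.FactorAt i l
  | .p i => F.BoundaryAt i
  | .refA i' i l => F.TypeAAt i' i l
  | .refB i' i l => F.TypeBAt i' i l
  | .refC i' l' i l => F.TypeCAt i' l' i l
  | .dref i' l' i => F.RefAt i' l' i
  | .q i' l' => F.IntervalAt i' l'
  | .depth i l d => ∃ k < F.count, d ≤ D k ∧ ∃ j, i ≤ j ∧ j < i + l ∧ F.pos k ≤ j ∧
      j < F.pos (k + 1)
  | .aux _ _ _ => False

open Classical in
/-- The assignment that describes a categorized factorization with given reference depths. -/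
noncomputable def assignment (D : ℕ → ℕ) : ICSVar → Bool
  | .aux i l t => decide (∃ u < t, ∃ x, (refs T i l)[u]? = some x ∧ F.Meaning D x)
  | x => decide (F.Meaning D x)

variable {F T}

theorem assignment_eq {D : ℕ → ℕ} {x : ICSVar} (hx : ∀ i l t, x ≠ .aux i l t) :
    F.assignment T D x = true ↔ F.Meaning D x := by
  cases x with
  | aux i l t => exact absurd rfl (hx i l t)
  | _ => simp [assignment]

theorem describes_assignment (D : ℕ → ℕ) : Describes T (F.assignment T D) F := by
  rw [describes_iff]
  refine ⟨?_, ?_, ?_, ?_, ?_, ?_, ?_⟩ <;> intros <;> rw [assignment_eq (by simp)] <;> rfl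

omit [DecidableEq α] in
theorem IsFactorizationOf.exists_factor (h : F.IsFactorizationOf T) {j : ℕ} (hj : j < T.length) :
    ∃ k < F.count, F.pos k ≤ j ∧ j < F.pos (k + 1) := by
  classical
  -- The factor that contains `j` ends at the first boundary beyond `j`.
  have hex : ∃ k, j < F.pos k := ⟨F.count, by rw [h.2.1]; exact hj⟩
  have hspec := Nat.find_spec hex
  have hne : Nat.find hex ≠ 0 := fun h0 => by rw [h0, h.1] at hspec; omega
  obtain ⟨k, hk⟩ := Nat.exists_eq_succ_of_ne_zero hne
  have hmin : F.pos k ≤ j := not_lt.1 (Nat.find_min hex (by omega))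
  have hle : Nat.find hex ≤ F.count := Nat.find_min' hex (by rw [h.2.1]; exact hj)
  rw [hk] at hspec hle
  exact ⟨k, hle, hmin, hspec⟩

/-- Every categorized factorization with the required properties comes from an assignment that
satisfies the hard clauses. -/
theorem IsValidFor.exists_assignment (h : F.IsValidFor T) :
    ∃ v, (icsMaxSat T).SatHard v ∧ Describes T v F := by
  obtain ⟨hF, hKO, ⟨hnc, hnB⟩, hdep⟩ := h
  have hK : ∀ k < F.count, F.FeasKind T k := fun k hk => (hF.kindOK_iff hk).1 (hKO k hk)
  obtain ⟨D, hDlt, hD⟩ := hdep.exists_lt_count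
  have hcn := hF.count_le
  refine ⟨F.assignment T D, ?_, describes_assignment D⟩
  set v := F.assignment T D with hv
  have vf : ∀ i l, v (.f i l) = true ↔ F.FactorAt i l := fun _ _ => assignment_eq (by simp)
  have vp : ∀ i, v (.p i) = true ↔ F.BoundaryAt i := fun _ => assignment_eq (by simp)
  have vpf : ∀ i, v (.p i) = false ↔ ¬ F.BoundaryAt i := fun i => by rw [← vp]; simp
  have vA : ∀ i' i l, v (.refA i' i l) = true ↔ F.TypeAAt i' i l :=
    fun _ _ _ => assignment_eq (by simp)
  have vB : ∀ i' i l, v (.refB i' i l) = true ↔ F.TypeBAt i' i l :=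
    fun _ _ _ => assignment_eq (by simp)
  have vC : ∀ i' l' i l, v (.refC i' l' i l) = true ↔ F.TypeCAt i' l' i l :=
    fun _ _ _ _ => assignment_eq (by simp)
  have vr : ∀ i' l' i, v (.dref i' l' i) = true ↔ F.RefAt i' l' i :=
    fun _ _ _ => assignment_eq (by simp)
  have vq : ∀ i' l', v (.q i' l') = true ↔ F.IntervalAt i' l' := fun _ _ => assignment_eq (by simp)
  have vd : ∀ i l d, v (.depth i l d) = true ↔ ∃ k < F.count, d ≤ D k ∧ ∃ j, i ≤ j ∧ j < i + l ∧
      F.pos k ≤ j ∧ j < F.pos (k + 1) := fun _ _ _ => assignment_eq (by simp)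
  have vaux : ∀ i l t, v (.aux i l t) = true ↔
      ∃ u < t, ∃ x, (refs T i l)[u]? = some x ∧ v x = true := by
    intro i l t
    classical
    rw [hv, assignment, decide_eq_true_iff]
    refine exists_congr fun u => and_congr_right fun _ => exists_congr fun x =>
      and_congr_right fun hx => (assignment_eq ?_).symm
    rintro _ _ _ rfl
    have := mem_refs.1 (List.mem_of_getElem? hx)
    simp at this
  have vd1 : ∀ i d, v (.depth i 1 d) = true ↔ ∃ k < F.count, d ≤ D k ∧
      F.pos k ≤ i ∧ i < F.pos (k + 1) := by
    intro i d
    rw [vd]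
    refine exists_congr fun k => and_congr_right fun _ => and_congr_right fun _ => ?_
    exact ⟨fun ⟨j, h1, h2, h3, h4⟩ => ⟨by omega, by omega⟩,
      fun ⟨h1, h2⟩ => ⟨i, le_rfl, by omega, h1, h2⟩⟩
  have vrefs : ∀ i l, (∃ y ∈ refs T i l, v y = true) ↔
      (∃ i', FeasA T i' i l ∧ F.TypeAAt i' i l) ∨ (∃ i', FeasB T i' i l ∧ F.TypeBAt i' i l) ∨
        ∃ i' l', FeasC T i' l' i l ∧ F.TypeCAt i' l' i l := by
    intro i l
    simp only [mem_refs]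
    constructor
    · rintro ⟨y, ⟨i', h, rfl⟩ | ⟨i', h, rfl⟩ | ⟨i', l', h, rfl⟩, hy⟩
      · exact Or.inl ⟨i', h, (vA _ _ _).1 hy⟩
      · exact Or.inr (Or.inl ⟨i', h, (vB _ _ _).1 hy⟩)
      · exact Or.inr (Or.inr ⟨i', l', h, (vC _ _ _ _).1 hy⟩)
    · rintro (⟨i', h, hy⟩ | ⟨i', h, hy⟩ | ⟨i', l', h, hy⟩)
      · exact ⟨_, Or.inl ⟨i', h, rfl⟩, (vA _ _ _).2 hy⟩
      · exact ⟨_, Or.inr (Or.inl ⟨i', h, rfl⟩), (vB _ _ _).2 hy⟩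
      · exact ⟨_, Or.inr (Or.inr ⟨i', l', h, rfl⟩), (vC _ _ _ _).2 hy⟩
  -- Both variables come from the factor at `[i..i+l)`, whose index is determined by its starting
  -- position and whose kind is unique.
  have vuniq : ∀ i l x y, x ∈ refs T i l → y ∈ refs T i l → v x = true → v y = true → x = y := by
    intro i l x y hx hy
    rcases mem_refs.1 hx with ⟨i', h, rfl⟩ | ⟨i', h, rfl⟩ | ⟨i', l', h, rfl⟩ <;>
    rcases mem_refs.1 hy with ⟨i'', h', rfl⟩ | ⟨i'', h', rfl⟩ | ⟨i'', l'', h', rfl⟩ <;>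
    simp only [vA, vB, vC] <;>
    rintro ⟨k, hk, a, b, h1, h2, h3, h4, h5⟩ ⟨k', hk', a', b', h1', h2', h3', h4', h5'⟩ <;>
    have e := pos_inj hF.2.2 hk.le hk'.le (h2.trans h2'.symm) <;> subst e <;>
    rw [h1] at h1' <;> cases h1' <;> simp <;> omega
  rw [satHard_iff_sem]
  constructor
  · exact ⟨(vp _).2 ⟨0, by omega, hF.1⟩, (vp _).2 ⟨F.count, le_rfl, hF.2.1⟩⟩
  · intro i l hf
    simp only [vf, vp, vpf]
    exact hF.factorAt_iff hf.1
  · intro i l hl hf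
    rw [vf, vrefs]
    exact factorAt_iff_type hK hl
  · intro i l hl hf x t hx
    refine ⟨fun hvx => (vaux _ _ _).2 ⟨t, by omega, x, hx, hvx⟩, ?_, ?_⟩
    · rw [vaux, vaux]
      rintro ⟨u, hu, hx⟩
      exact ⟨u, by omega, hx⟩
    · rw [vaux]
      rintro ⟨hvx, u, hu, y, hy, hvy⟩
      have hxy := vuniq i l x y (List.mem_of_getElem? hx) (List.mem_of_getElem? hy) hvx hvy
      subst hxy
      have htlt : u < (refs T i l).length := by
        by_contra hcon
        rw [List.getElem?_eq_none (by omega)] at hy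
        cases hy
      have := (List.nodup_iff_getElem?_ne_getElem?.1 (nodup_refs (T := T) i l)) u t hu (by
        by_contra hcon
        rw [List.getElem?_eq_none (by omega)] at hx
        cases hx)
      exact this (hy.trans hx.symm)
  · intro i' l' i _
    simp only [vr, vA, vB, vC]
    exact refAt_iff hK
  · intro i' l' _
    simp only [vr, vq, vB]
    exact hF.intervalAt_iff hK
  · intro i' l' _
    simp only [vq, vp]
    rintro ⟨x, hx, h1, h2⟩
    have := hF.interval_bounds hK hx
    exact ⟨⟨x.1, by omega, h1⟩, ⟨x.2, by omega, h2⟩⟩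
  · intro i₁ l₁ i₂ l₂ _ _ h1 h2 h3
    simp only [vq]
    rintro ⟨⟨x, hx, hx1, hx2⟩, ⟨y, hy, hy1, hy2⟩⟩
    have bx := hF.interval_bounds hK hx
    have bY := hF.interval_bounds hK hy
    refine hnc x hx y hy ⟨?_, ?_, ?_⟩
    · exact (pos_lt_iff hF.2.2 (by omega) (by omega)).1 (by omega)
    · exact (pos_lt_iff hF.2.2 (by omega) (by omega)).1 (by omega)
    · exact (pos_lt_iff hF.2.2 (by omega) (by omega)).1 (by omega)
  · intro i' i l _ _
    simp only [vq, vB]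
    rintro ⟨⟨⟨x, y⟩, hx, hx1, hx2⟩, ⟨k, hk, a, b, hkind, h1, h2, h3, h4⟩⟩
    have bx := hF.interval_bounds hK hx
    simp only at hx1 hx2 bx
    have e1 := pos_inj hF.2.2 (a := x) (b := k) (by omega) (by omega) (by omega)
    have e2 := pos_inj hF.2.2 (a := y) (b := k + 1) (by omega) (by omega) (by omega)
    subst e1 e2
    exact hnB _ hk _ _ hkind hx
  · intro i hi
    obtain ⟨k, hk, h1, h2⟩ := hF.exists_factor hi
    refine ⟨(vd1 _ _).2 ⟨k, hk, by omega, h1, h2⟩, ?_⟩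
    rw [← Bool.not_eq_true, vd1]
    rintro ⟨k, hk, h1, _⟩
    -- Depths stay below the number of factors, hence below `|T|`, as the upper end of the unary
    -- counter requires.
    have := hDlt k hk
    omega
  · intro i _ d _
    rw [vd1, vd1]
    rintro ⟨k, hk, h1, h2⟩
    exact ⟨k, hk, by omega, h2⟩
  · intro i _ d _
    rw [vpf, vd1, vd1]
    intro hp
    refine exists_congr fun k => and_congr_right fun hk => and_congr_right fun _ => ?_
    -- Since `i + 1` is not a boundary, a factor contains `i` if and only if it contains `i + 1`.
    have a1 : F.pos k ≠ i + 1 := fun e => hp ⟨k, hk.le, e⟩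
    have a2 : F.pos (k + 1) ≠ i + 1 := fun e => hp ⟨k + 1, hk, e⟩
    omega
  · intro i l _ d _
    simp only [vd1, vd]
    constructor
    · rintro ⟨k, hk, h1, j, h2, h3, h4, h5⟩
      exact ⟨j - i, by omega, k, hk, h1, by omega, by omega⟩
    · rintro ⟨t, ht, k, hk, h1, h2, h3⟩
      exact ⟨k, hk, h1, i + t, by omega, by omega, h2, h3⟩
  · intro i' l' i _ d _
    rw [vr, vd, vd1]
    rintro ⟨k, hk, a, b, hab, h1, h2, h3⟩ ⟨k', hk', h4, j, h5, h6, h7, h8⟩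
    have hb := hF.ref_bounds hK hk hab
    -- The factor `k'` shares the position `j` with the reference, whose ends are boundaries; so it
    -- is one of the factors referred to.
    have hlt : D k' < D k := by
      refine (hD k hk).2 a b hab k' ?_ ?_ hk'
      · have := (pos_lt_iff hF.2.2 (a := a) (b := k' + 1) (by omega) (by omega)).1 (by omega)
        omega
      · exact (pos_lt_iff hF.2.2 (by omega) (by omega)).1 (by omega)
    have := hF.2.2 k hk
    exact ⟨k, hk, by omega, by omega, by omega⟩

end CatFactorization

/-! ### From assignments to factorizations -/

namespace ICSFormula

variable {v : ICSVar → Bool}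

/-- A true variable switches the counter on, the counter stays on, and it forbids every later
variable of the list. -/
theorem Sem.ref_unique (h : Sem T v) {i l : ℕ} (hl : 2 ≤ l) (hf : FeasF T i l) {x y : ICSVar}
    (hx : x ∈ refs T i l) (hy : y ∈ refs T i l) (hvx : v x = true) (hvy : v y = true) : x = y := by
  have hmono : ∀ t u, t ≤ u → u ≤ (refs T i l).length → v (.aux i l t) = true →
      v (.aux i l u) = true := by
    intro t u htu
    induction u, htu using Nat.le_induction with
    | base => intro _ h; exact h
    | succ u htu ih =>
      intro hu ht
      exact (h.unique i l hl hf _ u (List.getElem?_eq_getElem (by omega))).2.1 (ih (by omega) ht)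
  have key : ∀ {t u : ℕ} {x y : ICSVar}, (refs T i l)[t]? = some x → (refs T i l)[u]? = some y →
      v x = true → v y = true → ¬ t < u := by
    intro t u x y hx hy hvx hvy htu
    have hu : u < (refs T i l).length := by
      by_contra hcon
      rw [List.getElem?_eq_none (by omega)] at hy
      cases hy
    exact (h.unique i l hl hf y u hy).2.2
      ⟨hvy, hmono (t + 1) u htu hu.le ((h.unique i l hl hf x t hx).1 hvx)⟩
  obtain ⟨t, ht⟩ := List.getElem?_of_mem hx
  obtain ⟨u, hu⟩ := List.getElem?_of_mem hy
  have h1 := key ht hu hvx hvy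
  have h2 := key hu ht hvy hvx
  have e : t = u := by omega
  subst e
  exact Option.some.inj (ht.symm.trans hu)

/-- Every assignment that satisfies the hard clauses describes a categorized factorization with the
required properties. -/
theorem Sem.exists_factorization (h : Sem T v) :
    ∃ F : CatFactorization, F.IsValidFor T ∧ Describes T v F := by
  classical
  obtain ⟨cnt, pos, h0, hn, hlt, hP⟩ :=
    exists_enumeration (fun i => v (.p i) = true) T.length h.ends.1 h.ends.2
  -- Being a factorization does not depend on the kinds, so all facts about positions are available
  -- before the kinds are chosen.
  have hfac : ∀ κ, (CatFactorization.mk cnt pos κ).IsFactorizationOf T := fun κ => ⟨h0, hn, hlt⟩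
  have hple : ∀ k ≤ cnt, pos k ≤ T.length := fun k hk => (hfac fun _ => .single).pos_le hk
  have hvf : ∀ i l, FeasF T i l → (v (.f i l) = true ↔
      ∃ k < cnt, pos k = i ∧ pos (k + 1) = i + l) := by
    intro i l hf
    have := (hfac fun _ => .single).factorAt_iff (i := i) hf.1
    simp only [FactorAt, BoundaryAt] at this
    rw [h.factor i l hf, this, hP i hf.bounds.1, hP (i + l) hf.2]
    refine and_congr_right fun _ => and_congr_right fun _ => forall₂_congr fun t ht => ?_
    rw [← hP (i + t + 1) (by have := hf.2; omega)]
    simp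
  -- A true `dref` forces `q` for its interval, and `q` forces factor boundaries at both ends. This
  -- converts references by position into references by index.
  have hbd : ∀ i' l' i, FeasDref T i' l' i → v (.dref i' l' i) = true →
      (∃ a ≤ cnt, pos a = i') ∧ ∃ b ≤ cnt, pos b = i' + l' := by
    intro i' l' i hf hd
    have hb := hf.bounds
    have hQ : FeasQ T i' l' := Or.inl ⟨i, (mem_rng T).2 hb.2.2.1, hf⟩
    have := h.boundary i' l' hQ ((h.interval i' l' hQ).2 (Or.inl ⟨i, hf, hd⟩))
    exact ⟨(hP _ hb.1).1 this.1, (hP _ hb.2.2.2.2).1 this.2⟩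
  -- The kind of a long factor is read off from a true reference variable; `Spec` keeps that
  -- variable on record so that uniqueness can be applied to it later.
  let Spec : ℕ → FactorKind → Prop := fun k κ =>
    match κ with
    | .single => pos (k + 1) = pos k + 1
    | .typeA a b => a ≤ b ∧ b < cnt ∧ pos (b + 1) = pos a + (pos (k + 1) - pos k) ∧
        FeasA T (pos a) (pos k) (pos (k + 1) - pos k) ∧
        v (.refA (pos a) (pos k) (pos (k + 1) - pos k)) = true
    | .typeB a b => a ≤ b ∧ b + 1 = k ∧ FeasB T (pos a) (pos k) (pos (k + 1) - pos k) ∧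
        v (.refB (pos a) (pos k) (pos (k + 1) - pos k)) = true
    | .typeC a b => a ≤ b ∧ b < cnt ∧
        FeasC T (pos a) (pos (b + 1) - pos a) (pos k) (pos (k + 1) - pos k) ∧
        v (.refC (pos a) (pos (b + 1) - pos a) (pos k) (pos (k + 1) - pos k)) = true
  have hlt2 : ∀ {a b : ℕ}, a ≤ cnt → b ≤ cnt → pos a < pos b → a < b := fun ha hb hab =>
    (pos_lt_iff (F := ⟨cnt, pos, fun _ => .single⟩) hlt ha hb).1 hab
  have hinj : ∀ {a b : ℕ}, a ≤ cnt → b ≤ cnt → pos a = pos b → a = b := fun ha hb hab =>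
    pos_inj (F := ⟨cnt, pos, fun _ => .single⟩) hlt ha hb hab
  have hex : ∀ k, ∃ κ, k < cnt → Spec k κ := by
    intro k
    by_cases hk : k < cnt
    swap
    · exact ⟨.single, fun h => absurd h hk⟩
    have hk1 := hlt k hk
    have hkn := hple (k + 1) hk
    by_cases h1 : pos (k + 1) = pos k + 1
    · exact ⟨.single, fun _ => h1⟩
    have hf : FeasF T (pos k) (pos (k + 1) - pos k) := ⟨by omega, by omega⟩
    have hvk : v (.f (pos k) (pos (k + 1) - pos k)) = true :=
      (hvf _ _ hf).2 ⟨k, hk, rfl, by omega⟩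
    obtain ⟨y, hy, hvy⟩ := (h.factorRef _ _ (by omega) hf).1 hvk
    rcases mem_refs.1 hy with ⟨i', hA, rfl⟩ | ⟨i', hB, rfl⟩ | ⟨i', l', hC, rfl⟩
    · have hD : FeasDref T i' (pos (k + 1) - pos k) (pos k) := Or.inl hA
      obtain ⟨⟨a, ha, rfl⟩, b, hb, hb'⟩ :=
        hbd _ _ _ hD ((h.drefIff _ _ _ hD).2 (Or.inl ⟨hA, hvy⟩))
      have hab := hlt2 ha hb (by omega)
      obtain ⟨b, rfl⟩ := Nat.exists_eq_succ_of_ne_zero (n := b) (by omega)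
      exact ⟨.typeA a b, fun _ => ⟨by omega, by omega, hb', hA, hvy⟩⟩
    · have hlt' := hB.2.2.1
      have hD : FeasDref T i' (pos k - i') (pos k) :=
        Or.inr (Or.inl ⟨by omega, _, (mem_rng T).2 hB.bounds.2.2, hB⟩)
      obtain ⟨⟨a, ha, rfl⟩, _⟩ :=
        hbd _ _ _ hD ((h.drefIff _ _ _ hD).2 (Or.inr (Or.inl ⟨_, by omega, hB, hvy⟩)))
      have hak := hlt2 ha hk.le hlt'
      obtain ⟨k, rfl⟩ := Nat.exists_eq_succ_of_ne_zero (n := k) (by omega)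
      exact ⟨.typeB a k, fun _ => ⟨by omega, rfl, hB, hvy⟩⟩
    · have hD : FeasDref T i' l' (pos k) :=
        Or.inr (Or.inr ⟨_, (mem_rng T).2 hC.bounds.2.2.2, hC⟩)
      obtain ⟨⟨a, ha, rfl⟩, b, hb, hb'⟩ :=
        hbd _ _ _ hD ((h.drefIff _ _ _ hD).2 (Or.inr (Or.inr ⟨_, hC, hvy⟩)))
      have := hC.2.1
      have hab := hlt2 ha hb (by omega)
      obtain ⟨b, rfl⟩ := Nat.exists_eq_succ_of_ne_zero (n := b) (by omega)
      have e : pos (b + 1) - pos a = l' := by simp only [Nat.succ_eq_add_one] at hb'; omega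
      subst e
      exact ⟨.typeC a b, fun _ => ⟨by omega, by omega, hC, hvy⟩⟩
  choose kind hkind using hex
  set F : CatFactorization := ⟨cnt, pos, kind⟩ with hFdef
  have hF : F.IsFactorizationOf T := ⟨h0, hn, hlt⟩
  have hK : ∀ k < F.count, F.FeasKind T k := by
    intro k hk
    have hs := hkind k hk
    unfold FeasKind
    cases hkk : F.kind k with
    | single => simp only [show kind k = _ from hkk, Spec] at hs; exact hs
    | typeA a b =>
      simp only [show kind k = _ from hkk, Spec] at hs
      exact ⟨hs.1, hs.2.1, hs.2.2.1, hs.2.2.2.1⟩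
    | typeB a b =>
      simp only [show kind k = _ from hkk, Spec] at hs
      exact ⟨hs.1, hs.2.1, hs.2.2.1⟩
    | typeC a b =>
      simp only [show kind k = _ from hkk, Spec] at hs
      exact ⟨hs.1, hs.2.1, hs.2.2.1⟩
  -- the variable chosen for a long factor is the only true one
  have hchoice : ∀ i l x, 2 ≤ l → FeasF T i l → x ∈ refs T i l → v x = true → ∃ k < cnt,
      pos k = i ∧ pos (k + 1) = i + l ∧ ∃ y ∈ refs T i l, v y = true ∧ y = x ∧
        ((∃ a b, kind k = .typeA a b ∧ pos (b + 1) = pos a + l ∧ y = .refA (pos a) i l) ∨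
        (∃ a b, kind k = .typeB a b ∧ b + 1 = k ∧ y = .refB (pos a) i l) ∨
        ∃ a b, kind k = .typeC a b ∧ pos a ≤ pos (b + 1) ∧
          y = .refC (pos a) (pos (b + 1) - pos a) i l) := by
    intro i l x hl hf hx hvx
    obtain ⟨k, hk, h1, h2⟩ := (hvf i l hf).1 ((h.factorRef i l hl hf).2 ⟨x, hx, hvx⟩)
    refine ⟨k, hk, h1, h2, ?_⟩
    have hs := hkind k hk
    have hlen : pos (k + 1) - i = l := by omega
    cases hkk : kind k with
    | single => simp only [hkk, Spec] at hs; omega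
    | typeA a b =>
      simp only [hkk, Spec, h1, hlen] at hs
      have hy : ICSVar.refA (pos a) i l ∈ refs T i l := mem_refs.2 (Or.inl ⟨_, hs.2.2.2.1, rfl⟩)
      exact ⟨_, hy, hs.2.2.2.2, h.ref_unique hl hf hy hx hs.2.2.2.2 hvx,
        Or.inl ⟨a, b, rfl, hs.2.2.1, rfl⟩⟩
    | typeB a b =>
      simp only [hkk, Spec, h1, hlen] at hs
      have hy : ICSVar.refB (pos a) i l ∈ refs T i l :=
        mem_refs.2 (Or.inr (Or.inl ⟨_, hs.2.2.1, rfl⟩))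
      exact ⟨_, hy, hs.2.2.2, h.ref_unique hl hf hy hx hs.2.2.2 hvx,
        Or.inr (Or.inl ⟨a, b, rfl, hs.2.1, rfl⟩)⟩
    | typeC a b =>
      simp only [hkk, Spec, h1, hlen] at hs
      have hy : ICSVar.refC (pos a) (pos (b + 1) - pos a) i l ∈ refs T i l :=
        mem_refs.2 (Or.inr (Or.inr ⟨_, _, hs.2.2.1, rfl⟩))
      have := hs.2.2.1.2.1
      exact ⟨_, hy, hs.2.2.2, h.ref_unique hl hf hy hx hs.2.2.2 hvx,
        Or.inr (Or.inr ⟨a, b, rfl, by omega, rfl⟩)⟩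
  have dP : ∀ i ≤ T.length, v (.p i) = true ↔ F.BoundaryAt i := hP
  have dF : ∀ i l, FeasF T i l → (v (.f i l) = true ↔ F.FactorAt i l) := hvf
  have dA : ∀ i' i l, FeasA T i' i l → (v (.refA i' i l) = true ↔ F.TypeAAt i' i l) := by
    intro i' i l hA
    have hf : FeasF T i l := ⟨by have := hA.1; omega, hA.2.1⟩
    constructor
    · intro hv
      obtain ⟨k, hk, h1, h2, y, -, -, e, hy⟩ :=
        hchoice i l _ hA.1 hf (mem_refs.2 (Or.inl ⟨i', hA, rfl⟩)) hv
      subst e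
      rcases hy with ⟨a, b, hab, h3, e⟩ | ⟨a, b, _, _, e⟩ | ⟨a, b, _, _, e⟩
      · simp only [ICSVar.refA.injEq, and_true] at e
        subst e
        exact ⟨k, hk, a, b, hab, h1, h2, rfl, h3⟩
      · cases e
      · cases e
    · rintro ⟨k, hk, a, b, hab, h1, h2, h3, h4⟩
      have hs := hkind k hk
      have h1' : pos k = i := h1
      have hlen : pos (k + 1) - i = l := by have : pos (k + 1) = i + l := h2; omega
      simp only [show kind k = _ from hab, Spec, h1', hlen, show pos a = i' from h3] at hs
      exact hs.2.2.2.2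
  have dB : ∀ i' i l, FeasB T i' i l → (v (.refB i' i l) = true ↔ F.TypeBAt i' i l) := by
    intro i' i l hB
    have hf : FeasF T i l := ⟨by have := hB.1; omega, hB.2.1⟩
    constructor
    · intro hv
      obtain ⟨k, hk, h1, h2, y, -, -, e, hy⟩ :=
        hchoice i l _ hB.1 hf (mem_refs.2 (Or.inr (Or.inl ⟨i', hB, rfl⟩))) hv
      subst e
      rcases hy with ⟨a, b, _, _, e⟩ | ⟨a, b, hab, h3, e⟩ | ⟨a, b, _, _, e⟩
      · cases e
      · simp only [ICSVar.refB.injEq, and_true] at e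
        subst e
        exact ⟨k, hk, a, b, hab, h1, h2, rfl, by rw [h3]; exact h1⟩
      · cases e
    · rintro ⟨k, hk, a, b, hab, h1, h2, h3, h4⟩
      have hs := hkind k hk
      have h1' : pos k = i := h1
      have hlen : pos (k + 1) - i = l := by have : pos (k + 1) = i + l := h2; omega
      simp only [show kind k = _ from hab, Spec, h1', hlen, show pos a = i' from h3] at hs
      exact hs.2.2.2
  have dC : ∀ i' l' i l, FeasC T i' l' i l →
      (v (.refC i' l' i l) = true ↔ F.TypeCAt i' l' i l) := by
    intro i' l' i l hC
    have hf : FeasF T i l := ⟨by have := hC.1; omega, hC.2.2.1⟩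
    constructor
    · intro hv
      obtain ⟨k, hk, h1, h2, y, -, -, e, hy⟩ :=
        hchoice i l _ hC.1 hf (mem_refs.2 (Or.inr (Or.inr ⟨i', l', hC, rfl⟩))) hv
      subst e
      rcases hy with ⟨a, b, _, _, e⟩ | ⟨a, b, _, _, e⟩ | ⟨a, b, hab, h3, e⟩
      · cases e
      · cases e
      · simp only [ICSVar.refC.injEq, and_true] at e
        obtain ⟨rfl, rfl⟩ := e
        exact ⟨k, hk, a, b, hab, h1, h2, rfl, (Nat.add_sub_of_le h3).symm⟩
    · rintro ⟨k, hk, a, b, hab, h1, h2, h3, h4⟩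
      have hs := hkind k hk
      have h1' : pos k = i := h1
      have hlen : pos (k + 1) - i = l := by have : pos (k + 1) = i + l := h2; omega
      have hlen' : pos (b + 1) - i' = l' := by have : pos (b + 1) = i' + l' := h4; omega
      simp only [show kind k = _ from hab, Spec, h1', hlen, show pos a = i' from h3, hlen'] at hs
      exact hs.2.2.2
  have dR : ∀ i' l' i, FeasDref T i' l' i → (v (.dref i' l' i) = true ↔ F.RefAt i' l' i) := by
    intro i' l' i hf
    rw [h.drefIff _ _ _ hf, refAt_iff hK]
    refine or_congr (and_congr_right fun hA => dA _ _ _ hA) (or_congr ?_ ?_)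
    · exact exists_congr fun l => and_congr_right fun _ => and_congr_right fun hB => dB _ _ _ hB
    · exact exists_congr fun l => and_congr_right fun hC => dC _ _ _ _ hC
  have dQ : ∀ i' l', FeasQ T i' l' → (v (.q i' l') = true ↔ F.IntervalAt i' l') := by
    intro i' l' hf
    rw [h.interval _ _ hf, hF.intervalAt_iff hK]
    refine or_congr ?_ ?_
    · exact exists_congr fun i => and_congr_right fun hR => dR _ _ _ hR
    · exact exists_congr fun i => exists_congr fun l => and_congr_right fun hB =>
        and_congr_right fun _ => dB _ _ _ hB
  refine ⟨F, ⟨hF, fun k hk => (hF.kindOK_iff hk).2 (hK k hk), ⟨?_, ?_⟩, ?_⟩,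
    dP, dF, dA, dB, dC, dR, dQ⟩
  · have hq : ∀ x ∈ F.intervals, ∃ l, FeasQ T (F.pos x.1) l ∧ F.pos x.2 = F.pos x.1 + l ∧
        v (.q (F.pos x.1) l) = true := by
      intro x hx
      have hb := hF.interval_bounds hK hx
      have hl := pos_lt_pos hF.2.2 hb.1 hb.2
      have hI : F.IntervalAt (F.pos x.1) (F.pos x.2 - F.pos x.1) := ⟨x, hx, rfl, by omega⟩
      have hQ := hF.feasQ_of_intervalAt hK hI
      exact ⟨_, hQ, by omega, (dQ _ _ hQ).2 hI⟩
    rintro x hx y hy ⟨h1, h2, h3⟩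
    obtain ⟨l, hl, e, hvl⟩ := hq x hx
    obtain ⟨m, hm, e', hvm⟩ := hq y hy
    have bx := hF.interval_bounds hK hx
    have bY := hF.interval_bounds hK hy
    have a1 := pos_lt_pos hF.2.2 h1 (by omega)
    have a2 := pos_lt_pos hF.2.2 h2 (by omega)
    have a3 := pos_lt_pos hF.2.2 h3 (by omega)
    exact h.nested _ _ _ _ hl hm a1 (by omega) (by omega) ⟨hvl, hvm⟩
  · intro k hk i j hkk hI
    have hk' := hK k hk
    simp only [FeasKind, hkk] at hk'
    have hl := hF.2.2 k hk
    have hIA : F.IntervalAt (F.pos k) (F.pos (k + 1) - F.pos k) :=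
      ⟨_, hI, rfl, by simp only; omega⟩
    have hQ := hF.feasQ_of_intervalAt hK hIA
    exact h.notB _ _ _ hQ hk'.2.2 ⟨(dQ _ _ hQ).2 hIA, (dB _ _ _ hk'.2.2).2
      ⟨k, hk, i, j, hkk, rfl, by omega, rfl, by rw [hk'.2.1]⟩⟩
  -- The unary counters are decoded by taking the largest `d` whose depth variable is true.
  · let D : ℕ → ℕ := fun k =>
      Nat.findGreatest (fun d => v (.depth (pos k) 1 d) = true) T.length
    -- The clauses do not force depth 0 for single symbols. Resetting it is harmless: these factors
    -- have no references of their own, and lowering their depth only helps the factors that refer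
    -- to them.
    refine ⟨fun k => if F.kind k = .single then 0 else D k, fun k hk => ⟨fun hs => if_pos hs, ?_⟩⟩
    intro a b hab t h1 h2
    have hns : F.kind k ≠ .single := by
      obtain ⟨i, j, hkk | hkk | hkk, _⟩ := hab <;> rw [hkk] <;> simp
    simp only [if_neg hns]
    refine lt_of_le_of_lt (b := D t) (by split_ifs <;> omega) ?_
    have hb := hF.ref_bounds hK hk hab
    have hb1 := pos_lt_pos hF.2.2 hb.1 hb.2.1
    have hR : F.RefAt (F.pos a) (F.pos b - F.pos a) (F.pos k) :=
      ⟨k, hk, a, b, hab, rfl, rfl, by omega⟩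
    have hD := hR.feasDref hK
    have hDb := hD.bounds
    have hDv := (dR _ _ _ hD).2 hR
    have htb := pos_lt_pos hF.2.2 h2 hb.2.1
    have hta := (pos_le_iff hF.2.2 (a := a) (b := t) (by omega) (by omega)).2 h1
    have htn : pos t < T.length := lt_of_lt_of_le htb (hple b hb.2.1)
    have hspec : v (.depth (pos t) 1 (D t)) = true :=
      Nat.findGreatest_spec (P := fun d => v (.depth (pos t) 1 d) = true) (m := 0) (by omega)
        (h.depthRange _ htn).1
    -- The clause that forbids depth `|T|` keeps `D t` in the range in which the increment along a
    -- reference is enforced.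
    have hDt : D t < T.length := by
      have hle : D t ≤ T.length := Nat.findGreatest_le _
      rcases hle.lt_or_eq with h' | h'
      · exact h'
      · rw [h', (h.depthRange _ htn).2] at hspec; cases hspec
    have hmax := (h.depthMax (F.pos a) (F.pos b - F.pos a) ⟨hDb.2.2.2.1, hDb.2.2.2.2⟩ (D t)
      hDt.le).2 ⟨F.pos t - F.pos a, by omega, by rw [Nat.add_sub_of_le hta]; exact hspec⟩
    have hfin := h.depthRef _ _ _ hD (D t) hDt hDv hmax
    exact Nat.le_findGreatest (P := fun d => v (.depth (pos k) 1 d) = true) hDt hfin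

end ICSFormula

end Assignments

/-! ### The size of the formulation -/

namespace ICSFormula

/-- The number of clauses plus the number of literals in a list of clauses. -/
def clausesSize (L : List (SatClause ICSVar)) : ℕ := (L.map fun c => c.length + 1).sum

theorem clausesSize_append (L M : List (SatClause ICSVar)) :
    clausesSize (L ++ M) = clausesSize L + clausesSize M := by
  simp [clausesSize]

theorem clausesSize_nil : clausesSize [] = 0 := rfl

theorem clausesSize_flatMap_le {β : Type*} {L : List β} {f : β → List (SatClause ICSVar)} {a b : ℕ}
    (ha : L.length ≤ a) (hb : ∀ x ∈ L, clausesSize (f x) ≤ b) :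
    clausesSize (L.flatMap f) ≤ a * b := by
  refine le_trans ?_ (Nat.mul_le_mul_right b ha)
  clear ha
  induction L with
  | nil => simp [clausesSize_nil]
  | cons x L ih =>
    rw [List.flatMap_cons, clausesSize_append, List.length_cons]
    have h1 := hb x (by simp)
    have h2 := ih fun y hy => hb y (by simp [hy])
    linarith

theorem clausesSize_map_le {β : Type*} {L : List β} {f : β → SatClause ICSVar} {a b : ℕ}
    (ha : L.length ≤ a) (hb : ∀ x ∈ L, (f x).length + 1 ≤ b) :
    clausesSize (L.map f) ≤ a * b := by
  have := clausesSize_flatMap_le (f := fun x => [f x]) ha (b := b) fun x hx => by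
    simpa [clausesSize] using hb x hx
  rwa [← List.map_eq_flatMap] at this

theorem clausesSize_iffOr (x : ICSVar) (ys : List ICSVar) :
    clausesSize (iffOr x ys) = 4 * ys.length + 2 := by
  simp [iffOr, clausesSize, Function.comp_def]; ring

theorem clausesSize_iffAnd (x : ICSVar) (ls : List (SatLit ICSVar)) :
    clausesSize (iffAnd x ls) = 4 * ls.length + 2 := by
  simp [iffAnd, clausesSize, Function.comp_def]; ring

theorem clausesSize_atMostOne_le (s : ℕ → ICSVar) (xs : List ICSVar) :
    clausesSize (atMostOne s xs) ≤ xs.length * 9 := by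
  refine clausesSize_flatMap_le (by simp) ?_
  rintro ⟨x, t⟩ _
  simp [clausesSize]

variable {α : Type*} (T : List α)

theorem length_sel_le (P : ℕ → Prop) [DecidablePred P] : (sel T P).length ≤ T.length + 1 :=
  (List.length_filter_le _ _).trans (by simp [rng])

theorem length_sel2_le (P : ℕ → ℕ → Prop) [∀ x y, Decidable (P x y)] :
    (sel2 T P).length ≤ (T.length + 1) ^ 2 := by
  rw [sel2, List.length_flatMap]
  refine (List.sum_le_card_nsmul _ (T.length + 1) ?_).trans ?_
  · simp only [List.forall_mem_map, List.length_map]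
    exact fun x _ => length_sel_le T _
  · simp [rng, sq]

theorem length_sel3_le (P : ℕ → ℕ → ℕ → Prop) [∀ x y z, Decidable (P x y z)] :
    (sel3 T P).length ≤ (T.length + 1) ^ 3 := by
  rw [sel3, List.length_flatMap]
  refine (List.sum_le_card_nsmul _ ((T.length + 1) ^ 2) ?_).trans ?_
  · simp only [List.forall_mem_map, List.length_map]
    exact fun x _ => length_sel2_le T _
  · simp only [rng, List.length_map, List.length_range, smul_eq_mul]
    exact le_of_eq (by ring)

variable [DecidableEq α]

theorem length_refs_le (i l : ℕ) :
    (refs T i l).length ≤ 2 * (T.length + 1) + (T.length + 1) ^ 2 := by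
  simp only [refs, List.length_append, List.length_map]
  have h1 := length_sel_le T fun i' => FeasA T i' i l
  have h2 := length_sel_le T fun i' => FeasB T i' i l
  have h3 := length_sel2_le T fun i' l' => FeasC T i' l' i l
  omega

/-- With `N = |T| + 1`, each group has size at most a constant times `N ^ 4`, and the constants add
up to 124. As `T` is nonempty, `N ≤ 2 * |T|`, which contributes a factor of 16, and `124 * 16 =
1984`. -/
theorem size_icsMaxSat_le (hT : T ≠ []) : (icsMaxSat T).size ≤ 2000 * T.length ^ 4 := by
  have hn : 1 ≤ T.length := List.length_pos_iff.2 hT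
  obtain ⟨N, hN⟩ : ∃ N, N = T.length + 1 := ⟨_, rfl⟩
  have hN1 : 1 ≤ N := by omega
  have p1 : 1 ≤ N ^ 4 := Nat.one_le_pow _ _ hN1
  have p2 : N ≤ N ^ 4 := Nat.le_self_pow (by omega) N
  have p3 : N ^ 2 ≤ N ^ 4 := Nat.pow_le_pow_right hN1 (by omega)
  have p4 : N ^ 3 ≤ N ^ 4 := Nat.pow_le_pow_right hN1 (by omega)
  have hr : (rng T).length ≤ N := by simp [rng, hN]
  have hs1 : ∀ (P : ℕ → Prop) [DecidablePred P], (sel T P).length ≤ N :=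
    fun P _ => hN ▸ length_sel_le T P
  have hs2 : ∀ (P : ℕ → ℕ → Prop) [∀ x y, Decidable (P x y)], (sel2 T P).length ≤ N ^ 2 :=
    fun P _ => hN ▸ length_sel2_le T P
  have hs3 : ∀ (P : ℕ → ℕ → ℕ → Prop) [∀ x y z, Decidable (P x y z)],
    (sel3 T P).length ≤ N ^ 3 := fun P _ => hN ▸ length_sel3_le T P
  have hrefs : ∀ i l, (refs T i l).length ≤ 2 * N + N ^ 2 := fun i l => hN ▸ length_refs_le T i l
  have b1 : clausesSize (cEnds T) ≤ 4 * N ^ 4 := by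
    simp [cEnds, clausesSize]; omega
  have b2 : clausesSize (cFactor T) ≤ 14 * N ^ 4 := by
    refine (clausesSize_flatMap_le (hs2 _) (b := 4 * N + 10) ?_).trans (by ring_nf; linarith)
    rintro ⟨i, l⟩ hx
    have := (mem_sel2 T).1 hx
    simp only [clausesSize_iffAnd, List.length_cons, List.length_map, List.length_range]
    simp only at this
    omega
  have b3 : clausesSize (cFactorRef T) ≤ 14 * N ^ 4 := by
    refine (clausesSize_flatMap_le (hs2 _) (b := 4 * (2 * N + N ^ 2) + 2) ?_).trans
      (by ring_nf; linarith)
    rintro ⟨i, l⟩ _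
    have := hrefs i l
    simp only [clausesSize_iffOr]
    omega
  have b4 : clausesSize (cUnique T) ≤ 27 * N ^ 4 := by
    refine (clausesSize_flatMap_le (hs2 _) (b := (2 * N + N ^ 2) * 9) ?_).trans
      (by ring_nf; linarith)
    rintro ⟨i, l⟩ _
    exact (clausesSize_atMostOne_le _ _).trans (Nat.mul_le_mul_right 9 (hrefs i l))
  have b5 : clausesSize (cDref T) ≤ 14 * N ^ 4 := by
    refine (clausesSize_flatMap_le (hs3 _) (b := 4 * (1 + 2 * N) + 2) ?_).trans
      (by ring_nf; linarith)
    rintro ⟨i', l', i⟩ _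
    have h1 := hs1 fun l => i' + l' = i ∧ FeasB T i' i l
    have h2 := hs1 fun l => FeasC T i' l' i l
    have h3 : (if FeasA T i' i l' then [ICSVar.refA i' i l'] else []).length ≤ 1 := by
      split_ifs <;> simp
    simp only [clausesSize_iffOr, List.length_append, List.length_map]
    omega
  have b6 : clausesSize (cInterval T) ≤ 10 * N ^ 4 := by
    refine (clausesSize_flatMap_le (hs2 _) (b := 4 * (N + N ^ 2) + 2) ?_).trans
      (by ring_nf; linarith)
    rintro ⟨i', l'⟩ _
    have h1 := hs1 fun i => FeasDref T i' l' i
    have h2 := hs2 fun i l => FeasB T i' i l ∧ i' + l' = i + l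
    simp only [clausesSize_iffOr, List.length_append, List.length_map]
    omega
  have b7 : clausesSize (cBoundary T) ≤ 6 * N ^ 4 := by
    refine (clausesSize_flatMap_le (hs2 _) (b := 6) ?_).trans (by ring_nf; linarith)
    rintro ⟨i', l'⟩ _
    simp [clausesSize]
  have b8 : clausesSize (cNested T) ≤ 3 * N ^ 4 := by
    refine (clausesSize_flatMap_le (hs2 _) (b := N ^ 2 * 3) ?_).trans (by ring_nf; linarith)
    rintro ⟨i', l'⟩ _
    exact clausesSize_map_le (hs2 _) fun x _ => by simp
  have b9 : clausesSize (cNotB T) ≤ 3 * N ^ 4 := by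
    refine (clausesSize_flatMap_le (hs2 _) (b := N * 3) ?_).trans (by ring_nf; linarith)
    rintro ⟨i', l'⟩ _
    exact clausesSize_map_le (hs1 _) fun x _ => by simp
  have b10 : clausesSize (cDepthRange T) ≤ 4 * N ^ 4 := by
    refine (clausesSize_flatMap_le (a := N) (by simp [hN]) (b := 4) ?_).trans
      (by ring_nf; linarith)
    intro i _
    simp [clausesSize]
  have b11 : clausesSize (cDepthMono T) ≤ 3 * N ^ 4 := by
    refine (clausesSize_flatMap_le (a := N) (by simp [hN]) (b := N * 3) ?_).trans
      (by ring_nf; linarith)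
    intro i _
    exact clausesSize_map_le (by simp [hN]) fun x _ => by simp
  have b12 : clausesSize (cDepthFactor T) ≤ 8 * N ^ 4 := by
    refine (clausesSize_flatMap_le (a := N) (by simp [hN]; omega) (b := N * 8) ?_).trans
      (by ring_nf; linarith)
    intro i _
    exact clausesSize_flatMap_le hr fun x _ => by simp [clausesSize]
  have b13 : clausesSize (cDepthMax T) ≤ 6 * N ^ 4 := by
    refine (clausesSize_flatMap_le (hs2 _) (b := N * (4 * N + 2)) ?_).trans
      (by ring_nf; linarith)
    rintro ⟨i, l⟩ hx
    refine clausesSize_flatMap_le hr fun d _ => ?_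
    have := (mem_sel2 T).1 hx
    simp only [clausesSize_iffOr, List.length_map, List.length_range]
    simp only at this
    omega
  have b14 : clausesSize (cDepthRef T) ≤ 4 * N ^ 4 := by
    refine (clausesSize_flatMap_le (hs3 _) (b := N * 4) ?_).trans (by ring_nf; linarith)
    rintro ⟨i', l', i⟩ _
    exact clausesSize_map_le (by simp [hN]) fun x _ => by simp
  have b15 : clausesSize (softClauses T) ≤ 4 * N ^ 4 := by
    rw [softClauses, clausesSize_append]
    have h1 : clausesSize ((rng T).map fun i => [(ICSVar.p i).neg]) ≤ N * 2 :=
      clausesSize_map_le hr fun x _ => by simp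
    have h2 : clausesSize ((sel2 T fun i' l' => i' + l' ≤ T.length).flatMap fun (i', l') =>
        (sel2 T fun i l => FeasC T i' l' i l).map fun (i, l) => [(ICSVar.refC i' l' i l).neg]) ≤
        N ^ 2 * (N ^ 2 * 2) := by
      refine clausesSize_flatMap_le (hs2 _) ?_
      rintro ⟨i', l'⟩ _
      exact clausesSize_map_le (hs2 _) fun x _ => by simp
    exact (Nat.add_le_add h1 h2).trans (by ring_nf; linarith)
  have htotal : (icsMaxSat T).size ≤ 124 * N ^ 4 := by
    have : (icsMaxSat T).size = clausesSize ((icsMaxSat T).hard ++ (icsMaxSat T).soft) := rfl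
    rw [this]
    simp only [icsMaxSat, clausesSize_append]
    omega
  have hfin : N ^ 4 ≤ 16 * T.length ^ 4 := by
    calc N ^ 4 ≤ (2 * T.length) ^ 4 := Nat.pow_le_pow_left (by omega) 4
      _ = 16 * T.length ^ 4 := by ring
  omega

/-! ### The number of violated soft clauses -/

variable {T}

theorem countP_eq_card_filter {β : Type*} [DecidableEq β] {L : List β} (hL : L.Nodup)
    (P : β → Bool) : L.countP P = (L.toFinset.filter fun x => P x = true).card := by
  rw [List.countP_eq_length_filter, ← List.toFinset_card_of_nodup (hL.filter _),
    List.toFinset_filter]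

end ICSFormula

open ICSFormula CatFactorization in
/-- An assignment violates one soft clause for each boundary of a factor and for each type-C
factor. -/
theorem Describes.numViolated_eq {α : Type*} [DecidableEq α] {T : List α} {v : ICSVar → Bool}
    {F : CatFactorization} (hF : F.IsFactorizationOf T) (hKO : ∀ k < F.count, F.KindOK T k)
    (hD : Describes T v F) : (icsMaxSat T).numViolated v = F.count + 1 + F.numC := by
  classical
  have hK : ∀ k < F.count, F.FeasKind T k := fun k hk => (hF.kindOK_iff hk).1 (hKO k hk)
  obtain ⟨dP, -, -, -, dC, -, -⟩ := describes_iff.1 hD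
  have h1 : ((rng T).map fun i => [(ICSVar.p i).neg]).countP
      (fun c => !SatClause.holds v c) = F.count + 1 := by
    rw [List.countP_map, countP_eq_card_filter (nodup_rng T), ← Finset.card_range (F.count + 1)]
    symm
    -- The true variables `p` belong to `pos 0, …, pos h`. The end of the text is among them, whence
    -- `h + 1` rather than `h`.
    refine Finset.card_bij (fun k _ => F.pos k) ?_ ?_ ?_
    · intro k hk
      have hk' : k ≤ F.count := by simpa [Nat.lt_succ_iff] using hk
      have hle := hF.pos_le hk'
      simp only [Finset.mem_filter, List.mem_toFinset, mem_rng]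
      refine ⟨hle, ?_⟩
      simp [SatClause.holds, ICSVar.neg, (dP _ hle).2 ⟨k, hk', rfl⟩]
    · intro a ha b hb e
      simp only [Finset.mem_range] at ha hb
      exact pos_inj hF.2.2 (by omega) (by omega) e
    · intro i hi
      simp only [Finset.mem_filter, List.mem_toFinset, mem_rng] at hi
      have hv : v (.p i) = true := by simpa [SatClause.holds, ICSVar.neg] using hi.2
      obtain ⟨k, hk, e⟩ := (dP i hi.1).1 hv
      exact ⟨k, by simpa [Nat.lt_succ_iff] using hk, e⟩
  -- The nested enumeration of type-C subscripts is flattened into one list without repetitions, so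
  -- that violated clauses can be counted as elements of a finite set.
  let L : List ((ℕ × ℕ) × ℕ × ℕ) := (sel2 T fun i' l' => i' + l' ≤ T.length).flatMap fun x =>
    (sel2 T fun i l => FeasC T x.1 x.2 i l).map fun y => (x, y)
  have hL : L.Nodup := by
    refine List.nodup_flatMap.2 ⟨fun x _ => (nodup_sel2 T _).map fun a b h => by
      simpa using h, (nodup_sel2 T _).imp ?_⟩
    intro a b hab z hz hz'
    simp only [List.mem_map] at hz hz'
    obtain ⟨_, _, rfl⟩ := hz
    obtain ⟨_, _, h⟩ := hz'
    exact hab (congrArg Prod.fst h).symm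
  have hmemL : ∀ i' l' i l, ((i', l'), i, l) ∈ L ↔ FeasC T i' l' i l := by
    intro i' l' i l
    simp only [L, List.mem_flatMap, List.mem_map, mem_sel2, Prod.mk.injEq, Prod.exists]
    constructor
    · rintro ⟨_, _, _, _, _, ⟨_, _, h⟩, ⟨rfl, rfl⟩, rfl, rfl⟩
      exact h
    · intro h
      have hb := h.bounds
      exact ⟨i', l', ⟨hb.1, hb.2.1, h.2.2.2.1⟩, i, l, ⟨hb.2.2.1, hb.2.2.2, h⟩, ⟨rfl, rfl⟩, rfl, rfl⟩
  have h2 : ((sel2 T fun i' l' => i' + l' ≤ T.length).flatMap fun (i', l') =>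
      (sel2 T fun i l => FeasC T i' l' i l).map fun (i, l) =>
        [(ICSVar.refC i' l' i l).neg]).countP (fun c => !SatClause.holds v c) = F.numC := by
    have e : ((sel2 T fun i' l' => i' + l' ≤ T.length).flatMap fun (i', l') =>
        (sel2 T fun i l => FeasC T i' l' i l).map fun (i, l) =>
          [(ICSVar.refC i' l' i l).neg]) =
        L.map fun z => [(ICSVar.refC z.1.1 z.1.2 z.2.1 z.2.2).neg] := by
      simp [L, List.map_flatMap, Function.comp_def]
    rw [e, List.countP_map, countP_eq_card_filter hL]
    have hfin : {k | k < F.count ∧ ∃ i j, F.kind k = .typeC i j} =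
        ((Finset.range F.count).filter fun k => ∃ i j, F.kind k = .typeC i j :
          Finset ℕ) := by
      ext k; simp
    rw [numC, hfin, Set.ncard_coe_finset]
    symm
    let ref : ℕ → ℕ × ℕ := fun k => match F.kind k with
      | .typeC a b => (F.pos a, F.pos (b + 1) - F.pos a)
      | _ => (0, 0)
    refine Finset.card_bij (fun k _ => (ref k, F.pos k, F.pos (k + 1) - F.pos k)) ?_ ?_ ?_
    · intro k hk
      simp only [Finset.mem_filter, Finset.mem_range] at hk
      obtain ⟨hk, a, b, hkind⟩ := hk
      have hk' := hK k hk
      simp only [FeasKind, hkind] at hk'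
      have hpk := hF.2.2 k hk
      simp only [Finset.mem_filter, List.mem_toFinset, ref, hkind, hmemL]
      refine ⟨hk'.2.2, ?_⟩
      have := hk'.2.2.2.1
      simp [SatClause.holds, ICSVar.neg, (dC _ _ _ _ hk'.2.2).2
        ⟨k, hk, a, b, hkind, rfl, by omega, rfl, by omega⟩]
    · intro a ha b hb e
      simp only [Finset.mem_filter, Finset.mem_range] at ha hb
      simp only [Prod.mk.injEq] at e
      exact pos_inj hF.2.2 (by omega) (by omega) e.2.1
    · rintro ⟨⟨i', l'⟩, i, l⟩ hz
      simp only [Finset.mem_filter, List.mem_toFinset, hmemL] at hz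
      obtain ⟨hC, hv⟩ := hz
      have hv : v (.refC i' l' i l) = true := by simpa [SatClause.holds, ICSVar.neg] using hv
      obtain ⟨k, hk, a, b, hkind, h1, h2, h3, h4⟩ := (dC _ _ _ _ hC).1 hv
      refine ⟨k, by simpa using ⟨hk, a, b, hkind⟩, ?_⟩
      simp only [ref, hkind, Prod.mk.injEq]
      omega
  simp only [MaxSat.numViolated, icsMaxSat, softClauses, List.countP_append]
  rw [h1, h2]

/-! ### Trees and their nodes -/

namespace LTree

variable {L : Type*}

theorem leaves_length_pos (t : LTree L) : 0 < t.leaves.length := by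
  induction t with
  | leaf l => simp [leaves]
  | one l t ih => simpa [leaves] using ih
  | two l t₁ t₂ ih₁ ih₂ => simp only [leaves, List.length_append]; omega

theorem nodesFrom_bounds {t : LTree L} {s : ℕ} {x : L × ℕ × ℕ} (hx : x ∈ t.nodesFrom s) :
    s ≤ x.2.1 ∧ x.2.1 < x.2.2 ∧ x.2.2 ≤ s + t.leaves.length := by
  induction t generalizing s with
  | leaf l =>
    simp only [nodesFrom, List.mem_singleton] at hx
    subst hx; simp [leaves]
  | one l t ih =>
    have := leaves_length_pos t
    simp only [nodesFrom, List.mem_cons] at hx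
    rcases hx with rfl | hx
    · simp [leaves, this]
    · have := ih hx
      simpa [leaves] using this
  | two l t₁ t₂ ih₁ ih₂ =>
    have h1 := leaves_length_pos t₁
    have h2 := leaves_length_pos t₂
    simp only [nodesFrom, List.mem_cons, List.mem_append] at hx
    simp only [leaves, List.length_append]
    rcases hx with rfl | hx | hx
    · simp only; omega
    · have := ih₁ hx; omega
    · have := ih₂ hx; omega

/-- The intervals of leaves below two nodes do not cross. -/
theorem nodesFrom_not_cross {t : LTree L} {s : ℕ} {x y : L × ℕ × ℕ} (hx : x ∈ t.nodesFrom s)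
    (hy : y ∈ t.nodesFrom s) : ¬ (x.2.1 < y.2.1 ∧ y.2.1 < x.2.2 ∧ x.2.2 < y.2.2) := by
  have bx := nodesFrom_bounds hx
  have bY := nodesFrom_bounds hy
  induction t generalizing s with
  | leaf l => simp only [leaves, List.length_singleton] at bx bY; omega
  | one l t ih =>
    simp only [nodesFrom, List.mem_cons, leaves] at hx hy bx bY
    rcases hx with rfl | hx
    · simp only at bx ⊢; omega
    rcases hy with rfl | hy
    · simp only at bY ⊢; omega
    exact ih hx hy bx bY
  | two l t₁ t₂ ih₁ ih₂ =>
    simp only [nodesFrom, List.mem_cons, List.mem_append, leaves, List.length_append] at hx hy bx bY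
    rcases hx with rfl | hx
    · simp only at bx ⊢; omega
    rcases hy with rfl | hy
    · simp only at bY ⊢; omega
    rcases hx with hx | hx <;> rcases hy with hy | hy
    · exact ih₁ hx hy (nodesFrom_bounds hx) (nodesFrom_bounds hy)
    · have a := nodesFrom_bounds hx; have b := nodesFrom_bounds hy; omega
    · have a := nodesFrom_bounds hx; have b := nodesFrom_bounds hy; omega
    · exact ih₂ hx hy (nodesFrom_bounds hx) (nodesFrom_bounds hy)

end LTree

/-! ### The structure of grammar trees -/

namespace RuleSystem

variable {α : Type*} (G : RuleSystem α)

variable {G} in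
theorem expand_atom {X : Fin G.size} {a : α} (h : G.rule X = .atom a) : G.expand X = [a] := by
  rw [expand]; split <;> simp_all

variable {G} in
theorem expand_concat {X Y Z : Fin G.size} (h : G.rule X = .concat Y Z) :
    G.expand X = G.expand Y ++ G.expand Z := by
  rw [expand]; split <;> simp_all

variable {G} in
theorem expand_rep {X Y : Fin G.size} {r : ℕ} (h : G.rule X = .rep Y r) :
    G.expand X = strPow (G.expand Y) r := by
  rw [expand]; split <;> simp_all

variable {G} in
theorem expand_trunc {X Y : Fin G.size} {b e : ℕ} (h : G.rule X = .trunc Y b e) :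
    G.expand X = substr (G.expand Y) b (e - b) := by
  rw [expand]; split <;> simp_all

variable {G} in
theorem parseTreeFrom_atom {X : Fin G.size} {a : α} (h : G.rule X = .atom a) :
    G.parseTreeFrom X = .one (.nt X) (.leaf (.term a)) := by
  rw [parseTreeFrom]; split <;> simp_all

variable {G} in
theorem parseTreeFrom_concat {X Y Z : Fin G.size} (h : G.rule X = .concat Y Z) :
    G.parseTreeFrom X = .two (.nt X) (G.parseTreeFrom Y) (G.parseTreeFrom Z) := by
  rw [parseTreeFrom]; split <;> simp_all

variable {G} in
theorem parseTreeFrom_rep {X Y : Fin G.size} {r : ℕ} (h : G.rule X = .rep Y r) :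
    G.parseTreeFrom X = .two (.nt X) (G.parseTreeFrom Y) (.leaf (.pow Y (r - 1))) := by
  rw [parseTreeFrom]; split <;> simp_all

variable {G} in
theorem parseTreeFrom_trunc {X Y : Fin G.size} {b e : ℕ} (h : G.rule X = .trunc Y b e) :
    G.parseTreeFrom X = .one (.nt X) (.leaf (.sub Y b e)) := by
  rw [parseTreeFrom]; split <;> simp_all

/-- `t` is what remains of the parse tree of `X` if the nonterminals in `S` were seen before, and
`S'` is the set of nonterminals seen afterwards. -/
inductive Pruned : Fin G.size → LTree (NodeLabel α (Fin G.size)) → Set (Fin G.size) →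
    Set (Fin G.size) → Prop
  | seen {X S} (hX : X ∈ S) : Pruned X (.leaf (.nt X)) S S
  | atom {X S a} (hX : X ∉ S) (hr : G.rule X = .atom a) :
      Pruned X (.one (.nt X) (.leaf (.term a))) S (insert X S)
  | concat {X Y Z S S₁ S₂ t₁ t₂} (hX : X ∉ S) (hr : G.rule X = .concat Y Z)
      (h₁ : Pruned Y t₁ (insert X S) S₁) (h₂ : Pruned Z t₂ S₁ S₂) :
      Pruned X (.two (.nt X) t₁ t₂) S S₂
  | rep {X Y r S S₁ t₁} (hX : X ∉ S) (hr : G.rule X = .rep Y r)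
      (h₁ : Pruned Y t₁ (insert X S) S₁) :
      Pruned X (.two (.nt X) t₁ (.leaf (.pow Y (r - 1)))) S S₁
  | trunc {X Y b e S} (hX : X ∉ S) (hr : G.rule X = .trunc Y b e) :
      Pruned X (.one (.nt X) (.leaf (.sub Y b e))) S (insert X S)

variable {G}

theorem nt_mem_image {X : Fin G.size} {S : Set (Fin G.size)} :
    (NodeLabel.nt X : NodeLabel α (Fin G.size)) ∈ NodeLabel.nt '' S ↔ X ∈ S := by
  simp

/-- Only nonterminals need to be tracked: the other labels occur only at leaves, and `prune` neither
changes leaves nor records their labels. -/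
theorem Pruned.prune_eq {X : Fin G.size} {t : LTree (NodeLabel α (Fin G.size))}
    {S S' : Set (Fin G.size)} (h : G.Pruned X t S S') :
    (G.parseTreeFrom X).prune (NodeLabel.nt '' S) = (t, NodeLabel.nt '' S') := by
  induction h with
  | @seen X S hX =>
    have hX' := nt_mem_image.2 hX
    rcases hr : G.rule X with a | ⟨Y, Z⟩ | ⟨Y, r⟩ | ⟨Y, b, e⟩
    · rw [parseTreeFrom_atom hr, LTree.prune, if_pos hX']
    · rw [parseTreeFrom_concat hr, LTree.prune, if_pos hX']
    · rw [parseTreeFrom_rep hr, LTree.prune, if_pos hX']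
    · rw [parseTreeFrom_trunc hr, LTree.prune, if_pos hX']
  | atom hX hr =>
    rw [parseTreeFrom_atom hr, LTree.prune, if_neg (fun h => hX (nt_mem_image.1 h))]
    simp only [LTree.prune, Set.image_insert_eq]
  | concat hX hr _ _ ih₁ ih₂ =>
    rw [parseTreeFrom_concat hr, LTree.prune, if_neg (fun h => hX (nt_mem_image.1 h))]
    rw [Set.image_insert_eq] at ih₁
    simp only [ih₁, ih₂]
  | rep hX hr _ ih₁ =>
    rw [parseTreeFrom_rep hr, LTree.prune, if_neg (fun h => hX (nt_mem_image.1 h))]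
    rw [Set.image_insert_eq] at ih₁
    simp only [ih₁, LTree.prune]
  | trunc hX hr =>
    rw [parseTreeFrom_trunc hr, LTree.prune, if_neg (fun h => hX (nt_mem_image.1 h))]
    simp only [LTree.prune, Set.image_insert_eq]

theorem exists_pruned (X : Fin G.size) : ∀ S : Set (Fin G.size), ∃ t S', G.Pruned X t S S' := by
  induction X using WellFoundedLT.induction with
  | ind X ih =>
    intro S
    by_cases hX : X ∈ S
    · exact ⟨_, _, .seen hX⟩
    rcases hr : G.rule X with a | ⟨Y, Z⟩ | ⟨Y, r⟩ | ⟨Y, b, e⟩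
    · exact ⟨_, _, .atom hX hr⟩
    · obtain ⟨t₁, S₁, h₁⟩ := ih Y (G.sorted X Y (by simp [hr, CollageRule.Refers])) (insert X S)
      obtain ⟨t₂, S₂, h₂⟩ := ih Z (G.sorted X Z (by simp [hr, CollageRule.Refers])) S₁
      exact ⟨_, _, .concat hX hr h₁ h₂⟩
    · obtain ⟨t₁, S₁, h₁⟩ := ih Y (G.sorted X Y (by simp [hr, CollageRule.Refers])) (insert X S)
      exact ⟨_, _, .rep hX hr h₁⟩
    · exact ⟨_, _, .trunc hX hr⟩

theorem Pruned.grammarTree_eq {t : LTree (NodeLabel α (Fin G.size))} {S' : Set (Fin G.size)}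
    (h : G.Pruned G.start t ∅ S') : G.grammarTree = t := by
  have := h.prune_eq
  rw [Set.image_empty] at this
  rw [grammarTree, parseTree, this]

variable (G) in
theorem exists_pruned_grammarTree : ∃ S', G.Pruned G.start G.grammarTree ∅ S' := by
  obtain ⟨t, S', h⟩ := exists_pruned G.start ∅
  rw [h.grammarTree_eq]; exact ⟨S', h⟩

namespace Pruned

variable {X : Fin G.size} {t : LTree (NodeLabel α (Fin G.size))} {S S' : Set (Fin G.size)}

theorem subset (h : G.Pruned X t S S') : S ⊆ S' := by
  induction h with
  | seen hX => exact subset_rfl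
  | atom hX hr => exact Set.subset_insert _ _
  | concat hX hr _ _ ih₁ ih₂ => exact (Set.subset_insert _ _).trans (ih₁.trans ih₂)
  | rep hX hr _ ih₁ => exact (Set.subset_insert _ _).trans ih₁
  | trunc hX hr => exact Set.subset_insert _ _

theorem mem (h : G.Pruned X t S S') : X ∈ S' := by
  cases h with
  | seen hX => exact hX
  | atom hX hr => exact Set.mem_insert _ _
  | concat hX hr h₁ h₂ => exact h₂.subset (h₁.subset (Set.mem_insert _ _))
  | rep hX hr h₁ => exact h₁.subset (Set.mem_insert _ _)
  | trunc hX hr => exact Set.mem_insert _ _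

theorem root_mem_nodesFrom (h : G.Pruned X t S S') (s : ℕ) :
    (.nt X, s, s + t.leaves.length) ∈ t.nodesFrom s := by
  cases h <;> simp [LTree.nodesFrom, LTree.leaves, Nat.add_assoc]

/-- The set of nonterminals seen is closed under plain reference. -/
theorem closed (h : G.Pruned X t S S') : ∀ Y ∈ S', Y ∈ S ∨
    ∀ Z, (G.rule Y).RefersPlain Z → Z ∈ S' := by
  induction h with
  | seen hX => exact fun Y hY => Or.inl hY
  | atom hX hr =>
    rintro Y (rfl | hY)
    · exact Or.inr (by simp [hr, CollageRule.RefersPlain])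
    · exact Or.inl hY
  | concat hX hr h₁ h₂ ih₁ ih₂ =>
    intro Y hY
    rcases ih₂ Y hY with hY | hY
    · rcases ih₁ Y hY with (rfl | hY) | hY
      · right
        simp only [hr, CollageRule.RefersPlain]
        rintro Z (rfl | rfl)
        · exact h₂.subset h₁.mem
        · exact h₂.mem
      · exact Or.inl hY
      · exact Or.inr fun Z hZ => h₂.subset (hY Z hZ)
    · exact Or.inr hY
  | rep hX hr h₁ ih₁ =>
    intro Y hY
    rcases ih₁ Y hY with (rfl | hY) | hY
    · right
      simp only [hr, CollageRule.RefersPlain]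
      rintro Z rfl
      exact h₁.mem
    · exact Or.inl hY
    · exact Or.inr hY
  | trunc hX hr =>
    rintro Y (rfl | hY)
    · exact Or.inr (by simp [hr, CollageRule.RefersPlain])
    · exact Or.inl hY

/-- All nonterminals seen can be reached without truncation rules. -/
theorem reach (h : G.Pruned X t S S') : ∀ Y ∈ S', Y ∈ S ∨
    Relation.ReflTransGen (fun X Y => (G.rule X).RefersPlain Y) X Y := by
  induction h with
  | seen hX => exact fun Y hY => Or.inl hY
  | atom hX hr =>
    rintro Y (rfl | hY)
    · exact Or.inr .refl
    · exact Or.inl hY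
  | concat hX hr h₁ h₂ ih₁ ih₂ =>
    intro Y hY
    rcases ih₂ Y hY with hY | hY
    · rcases ih₁ Y hY with (rfl | hY) | hY
      · exact Or.inr .refl
      · exact Or.inl hY
      · exact Or.inr (.head (by simp [hr, CollageRule.RefersPlain]) hY)
    · exact Or.inr (.head (by simp [hr, CollageRule.RefersPlain]) hY)
  | rep hX hr h₁ ih₁ =>
    intro Y hY
    rcases ih₁ Y hY with (rfl | hY) | hY
    · exact Or.inr .refl
    · exact Or.inl hY
    · exact Or.inr (.head (by simp [hr, CollageRule.RefersPlain]) hY)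
  | trunc hX hr =>
    rintro Y (rfl | hY)
    · exact Or.inr .refl
    · exact Or.inl hY

/-- The nonterminals seen include the starting one and are closed under plain reference; internality
says that such a set is everything. -/
theorem eq_univ (h : G.Pruned G.start t ∅ S') (hG : G.IsInternal) : S' = Set.univ := by
  refine Set.eq_univ_of_forall fun X => ?_
  induction hG X with
  | refl => exact h.mem
  | tail _ hYZ ih =>
    rcases h.closed _ ih with h' | h'
    · exact absurd h' (Set.notMem_empty _)
    · exact h' _ hYZ

/-- Each newly seen nonterminal labels a node. -/
theorem exists_node (h : G.Pruned X t S S') : ∀ s, ∀ Y ∈ S', Y ∈ S ∨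
    ∃ i j, (.nt Y, i, j) ∈ t.nodesFrom s := by
  induction h with
  | seen hX => exact fun s Y hY => Or.inl hY
  | atom hX hr =>
    rintro s Y (rfl | hY)
    · exact Or.inr ⟨_, _, List.mem_cons_self ..⟩
    · exact Or.inl hY
  | concat hX hr h₁ h₂ ih₁ ih₂ =>
    intro s Y hY
    rcases ih₂ _ Y hY with hY | ⟨i, j, hY⟩
    · rcases ih₁ s Y hY with (rfl | hY) | ⟨i, j, hY⟩
      · exact Or.inr ⟨_, _, List.mem_cons_self ..⟩
      · exact Or.inl hY
      · exact Or.inr ⟨i, j, List.mem_cons_of_mem _ (List.mem_append_left _ hY)⟩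
    · exact Or.inr ⟨i, j, List.mem_cons_of_mem _ (List.mem_append_right _ hY)⟩
  | rep hX hr h₁ ih₁ =>
    intro s Y hY
    rcases ih₁ s Y hY with (rfl | hY) | ⟨i, j, hY⟩
    · exact Or.inr ⟨_, _, List.mem_cons_self ..⟩
    · exact Or.inl hY
    · exact Or.inr ⟨i, j, List.mem_cons_of_mem _ (List.mem_append_left _ hY)⟩
  | trunc hX hr =>
    rintro s Y (rfl | hY)
    · exact Or.inr ⟨_, _, List.mem_cons_self ..⟩
    · exact Or.inl hY

end Pruned

/-- The nonterminal in a label is smaller than `X`. -/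
def LabelLT (l : NodeLabel α (Fin G.size)) (X : Fin G.size) : Prop :=
  match l with
  | .nt Y => Y < X
  | .term _ => True
  | .pow Y _ => Y < X
  | .sub Y _ _ => Y < X

theorem LabelLT.trans {l : NodeLabel α (Fin G.size)} {X Y : Fin G.size} (h : LabelLT l X)
    (hXY : X < Y) : LabelLT l Y := by
  cases l with
  | term a => trivial
  | _ => exact lt_trans (show _ < X from h) hXY

/-- The string derived from the leaves with the given labels. -/
def yieldOf (ls : List (NodeLabel α (Fin G.size))) : List α := (ls.map G.labelString).flatten

theorem yieldOf_append (ls ms : List (NodeLabel α (Fin G.size))) :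
    yieldOf (ls ++ ms) = yieldOf ls ++ yieldOf ms := by
  simp [yieldOf]

theorem yieldOf_singleton (l : NodeLabel α (Fin G.size)) : yieldOf [l] = G.labelString l := by
  simp [yieldOf]

namespace Pruned

variable {X : Fin G.size} {t : LTree (NodeLabel α (Fin G.size))} {S S' : Set (Fin G.size)}

/-- Each rule refers to smaller nonterminals, so labels decrease downwards. This is why a truncated
leaf cannot lie below the node it refers to, and it is the source of the reference depths. -/
theorem leaf_lt (h : G.Pruned X t S S') : ∀ l ∈ t.leaves,
    (l = .nt X ∧ t = .leaf (.nt X)) ∨ LabelLT l X := by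
  have step : ∀ {Z Y : Fin G.size} {l : NodeLabel α (Fin G.size)} {P : Prop}, Y < Z →
      ((l = .nt Y ∧ P) ∨ LabelLT l Y) → LabelLT l Z := by
    rintro Z Y l P hlt (⟨rfl, _⟩ | h)
    · exact hlt
    · exact h.trans hlt
  induction h with
  | seen hX => intro l hl; simp only [LTree.leaves, List.mem_singleton] at hl; exact Or.inl ⟨hl, rfl⟩
  | atom hX hr =>
    intro l hl
    simp only [LTree.leaves, List.mem_singleton] at hl
    subst hl
    exact Or.inr trivial
  | @concat X Y Z S S₁ S₂ t₁ t₂ hX hr h₁ h₂ ih₁ ih₂ =>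
    intro l hl
    have hY := G.sorted X Y (by simp [hr, CollageRule.Refers])
    have hZ := G.sorted X Z (by simp [hr, CollageRule.Refers])
    simp only [LTree.leaves, List.mem_append] at hl
    rcases hl with hl | hl
    · exact Or.inr (step hY (ih₁ l hl))
    · exact Or.inr (step hZ (ih₂ l hl))
  | @rep X Y r S S₁ t₁ hX hr h₁ ih₁ =>
    intro l hl
    have hY := G.sorted X Y (by simp [hr, CollageRule.Refers])
    simp only [LTree.leaves, List.mem_append, List.mem_singleton] at hl
    rcases hl with hl | rfl
    · exact Or.inr (step hY (ih₁ l hl))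
    · exact Or.inr hY
  | @trunc X Y b e S hX hr =>
    intro l hl
    have hY := G.sorted X Y (by simp [hr, CollageRule.Refers])
    simp only [LTree.leaves, List.mem_singleton] at hl
    subst hl
    exact Or.inr hY

/-- The leaves of the tree derive the string of its root. -/
theorem yieldOf_leaves (h : G.Pruned X t S S') (hOK : ∀ X, G.RuleOK X) :
    yieldOf t.leaves = G.expand X := by
  induction h with
  | seen hX => simp [LTree.leaves, yieldOf, labelString]
  | atom hX hr => simp [LTree.leaves, yieldOf, labelString, expand_atom hr]
  | concat hX hr h₁ h₂ ih₁ ih₂ =>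
    rw [LTree.leaves, yieldOf_append, ih₁, ih₂, expand_concat hr]
  | @rep X Y r S S₁ t₁ hX hr h₁ ih₁ =>
    have h3 := hOK X
    simp only [RuleOK, hr] at h3
    rw [LTree.leaves, yieldOf_append, ih₁, expand_rep hr]
    obtain ⟨r, rfl⟩ : ∃ m, r = m + 1 := ⟨r - 1, by omega⟩
    simp [LTree.leaves, yieldOf, labelString, strPow_succ]
  | trunc hX hr => simp [LTree.leaves, yieldOf, labelString, expand_trunc hr]

/-- The part of the tree below a node with a nonterminal label. -/
theorem exists_subtree (h : G.Pruned X t S S') : ∀ {s : ℕ} {Y : Fin G.size} {i j : ℕ},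
    (.nt Y, i, j) ∈ t.nodesFrom s → ∃ t' S₁ S₁', G.Pruned Y t' S₁ S₁' ∧
      t'.nodesFrom i ⊆ t.nodesFrom s ∧ ∃ A B, t.leaves = A ++ t'.leaves ++ B ∧
        i = s + A.length ∧ j = i + t'.leaves.length := by
  induction h with
  | @seen X S hX =>
    intro s Y i j hn
    simp only [LTree.nodesFrom, List.mem_singleton, Prod.mk.injEq, NodeLabel.nt.injEq] at hn
    obtain ⟨rfl, rfl, rfl⟩ := hn
    exact ⟨_, _, _, .seen hX, List.Subset.refl _, [], [], by simp [LTree.leaves]⟩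
  | @atom X S a hX hr =>
    intro s Y i j hn
    simp only [LTree.nodesFrom, LTree.leaves, List.mem_cons, Prod.mk.injEq, NodeLabel.nt.injEq,
      reduceCtorEq, false_and, List.not_mem_nil, or_false] at hn
    obtain ⟨rfl, rfl, rfl⟩ := hn
    exact ⟨_, _, _, .atom hX hr, List.Subset.refl _, [], [], by simp [LTree.leaves]⟩
  | @concat X Y₁ Y₂ S S₁ S₂ t₁ t₂ hX hr h₁ h₂ ih₁ ih₂ =>
    intro s Y i j hn
    simp only [LTree.nodesFrom, List.mem_cons, List.mem_append, Prod.mk.injEq,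
      NodeLabel.nt.injEq] at hn
    rcases hn with ⟨rfl, rfl, rfl⟩ | hn | hn
    · exact ⟨_, _, _, .concat hX hr h₁ h₂, List.Subset.refl _, [], [], by
        simp [LTree.leaves, Nat.add_assoc]⟩
    · obtain ⟨t', U, U', ht', hsub, A, B, e, e1, e2⟩ := ih₁ hn
      exact ⟨t', U, U', ht', fun x hx => List.mem_cons_of_mem _ (List.mem_append_left _ (hsub hx)),
        A, B ++ t₂.leaves, by simp [LTree.leaves, e], e1, e2⟩
    · obtain ⟨t', U, U', ht', hsub, A, B, e, e1, e2⟩ := ih₂ hn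
      exact ⟨t', U, U', ht', fun x hx => List.mem_cons_of_mem _ (List.mem_append_right _ (hsub hx)),
        t₁.leaves ++ A, B, by simp [LTree.leaves, e], by simp only [List.length_append]; omega, e2⟩
  | @rep X Y₁ r S S₁ t₁ hX hr h₁ ih₁ =>
    intro s Y i j hn
    simp only [LTree.nodesFrom, List.mem_cons, List.mem_append, Prod.mk.injEq,
      NodeLabel.nt.injEq, reduceCtorEq, false_and, List.not_mem_nil, or_false] at hn
    rcases hn with ⟨rfl, rfl, rfl⟩ | hn
    · exact ⟨_, _, _, .rep hX hr h₁, List.Subset.refl _, [], [], by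
        simp [LTree.leaves, Nat.add_assoc]⟩
    · obtain ⟨t', U, U', ht', hsub, A, B, e, e1, e2⟩ := ih₁ hn
      exact ⟨t', U, U', ht', fun x hx => List.mem_cons_of_mem _ (List.mem_append_left _ (hsub hx)),
        A, B ++ [.pow Y₁ (r - 1)], by simp [LTree.leaves, e], e1, e2⟩
  | @trunc X Y₁ b e S hX hr =>
    intro s Y i j hn
    simp only [LTree.nodesFrom, LTree.leaves, List.mem_cons, Prod.mk.injEq, NodeLabel.nt.injEq,
      reduceCtorEq, false_and, List.not_mem_nil, or_false] at hn
    obtain ⟨rfl, rfl, rfl⟩ := hn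
    exact ⟨_, _, _, .trunc hX hr, List.Subset.refl _, [], [], by simp [LTree.leaves]⟩

/-- A leaf with a nonterminal label is to the right of a node with the same label. -/
theorem nt_leaf (h : G.Pruned X t S S') : ∀ {s k : ℕ} {Y : Fin G.size},
    t.leaves[k]? = some (.nt Y) → Y ∈ S ∨ ∃ i j, (.nt Y, i, j) ∈ t.nodesFrom s ∧ j ≤ s + k := by
  induction h with
  | seen hX =>
    intro s k Y hk
    have hm := List.mem_of_getElem? hk
    simp only [LTree.leaves, List.mem_singleton, NodeLabel.nt.injEq] at hm
    subst hm
    exact Or.inl hX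
  | atom hX hr =>
    intro s k Y hk
    have hm := List.mem_of_getElem? hk
    simp [LTree.leaves] at hm
  | @concat X Y₁ Y₂ S S₁ S₂ t₁ t₂ hX hr h₁ h₂ ih₁ ih₂ =>
    intro s k Y hk
    have hltY := G.sorted X Y₁ (by simp [hr, CollageRule.Refers])
    have hltZ := G.sorted X Y₂ (by simp [hr, CollageRule.Refers])
    -- Labels below an expanded root are smaller than the root, so the nonterminal just recorded at
    -- the root cannot be the one sought.
    have hne : Y ≠ X := by
      rintro rfl
      rcases (Pruned.concat hX hr h₁ h₂).leaf_lt _ (List.mem_of_getElem? hk) with ⟨_, h⟩ | h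
      · cases h
      · exact lt_irrefl _ (show Y < Y from h)
    simp only [LTree.leaves, List.getElem?_append] at hk
    split_ifs at hk with hlt
    · rcases ih₁ (s := s) hk with (rfl | hY) | ⟨i, j, hn, hj⟩
      · exact absurd rfl hne
      · exact Or.inl hY
      · exact Or.inr ⟨i, j, List.mem_cons_of_mem _ (List.mem_append_left _ hn), hj⟩
    · rcases ih₂ (s := s + t₁.leaves.length) hk with hY | ⟨i, j, hn, hj⟩
      -- The label was seen before the right subtree was entered. If it was first seen in the left
      -- subtree, its node there ends before the right subtree begins.
      · rcases h₁.exists_node s Y hY with (rfl | hY) | ⟨i, j, hn⟩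
        · exact absurd rfl hne
        · exact Or.inl hY
        · have := (LTree.nodesFrom_bounds hn).2.2
          simp only at this
          exact Or.inr ⟨i, j, List.mem_cons_of_mem _ (List.mem_append_left _ hn), by omega⟩
      · exact Or.inr ⟨i, j, List.mem_cons_of_mem _ (List.mem_append_right _ hn), by omega⟩
  | @rep X Y₁ r S S₁ t₁ hX hr h₁ ih₁ =>
    intro s k Y hk
    have hne : Y ≠ X := by
      rintro rfl
      rcases (Pruned.rep hX hr h₁).leaf_lt _ (List.mem_of_getElem? hk) with ⟨_, h⟩ | h
      · cases h
      · exact lt_irrefl _ (show Y < Y from h)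
    simp only [LTree.leaves, List.getElem?_append] at hk
    split_ifs at hk with hlt
    · rcases ih₁ (s := s) hk with (rfl | hY) | ⟨i, j, hn, hj⟩
      · exact absurd rfl hne
      · exact Or.inl hY
      · exact Or.inr ⟨i, j, List.mem_cons_of_mem _ (List.mem_append_left _ hn), hj⟩
    · have hm := List.mem_of_getElem? hk
      simp at hm
  | trunc hX hr =>
    intro s k Y hk
    have hm := List.mem_of_getElem? hk
    simp [LTree.leaves] at hm

/-- A leaf `Y ^ m` is the right child of a node with a repetition rule. -/
theorem pow_leaf (h : G.Pruned X t S S') : ∀ {s k m : ℕ} {Y : Fin G.size},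
    t.leaves[k]? = some (.pow Y m) → ∃ Z r i, G.rule Z = .rep Y r ∧ m = r - 1 ∧
      (.nt Z, i, s + k + 1) ∈ t.nodesFrom s ∧ i < s + k := by
  induction h with
  | seen hX =>
    intro s k m Y hk
    have hm := List.mem_of_getElem? hk
    simp [LTree.leaves] at hm
  | atom hX hr =>
    intro s k m Y hk
    have hm := List.mem_of_getElem? hk
    simp [LTree.leaves] at hm
  | @concat X Y₁ Y₂ S S₁ S₂ t₁ t₂ hX hr h₁ h₂ ih₁ ih₂ =>
    intro s k m Y hk
    simp only [LTree.leaves, List.getElem?_append] at hk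
    split_ifs at hk with hlt
    · obtain ⟨Z, r, i, h1, h2, h3, h4⟩ := ih₁ (s := s) hk
      exact ⟨Z, r, i, h1, h2, List.mem_cons_of_mem _ (List.mem_append_left _ h3), h4⟩
    · obtain ⟨Z, r, i, h1, h2, h3, h4⟩ := ih₂ (s := s + t₁.leaves.length) hk
      have e : s + t₁.leaves.length + (k - t₁.leaves.length) = s + k := by omega
      rw [e] at h3 h4
      exact ⟨Z, r, i, h1, h2, List.mem_cons_of_mem _ (List.mem_append_right _ h3), h4⟩
  | @rep X Y₁ r S S₁ t₁ hX hr h₁ ih₁ =>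
    intro s k m Y hk
    simp only [LTree.leaves, List.getElem?_append] at hk
    split_ifs at hk with hlt
    · obtain ⟨Z, r, i, h1, h2, h3, h4⟩ := ih₁ (s := s) hk
      exact ⟨Z, r, i, h1, h2, List.mem_cons_of_mem _ (List.mem_append_left _ h3), h4⟩
    · have hm := List.mem_of_getElem? hk
      simp only [List.mem_singleton, NodeLabel.pow.injEq] at hm
      obtain ⟨rfl, rfl⟩ := hm
      have hk0 : k - t₁.leaves.length < 1 := by
        by_contra hcon
        rw [List.getElem?_eq_none (by simp only [List.length_singleton]; omega)] at hk
        cases hk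
      have hpos := t₁.leaves_length_pos
      have e : k = t₁.leaves.length := by omega
      refine ⟨X, r, s, hr, rfl, ?_, by omega⟩
      simp [LTree.nodesFrom, LTree.leaves, e]
  | trunc hX hr =>
    intro s k m Y hk
    have hm := List.mem_of_getElem? hk
    simp [LTree.leaves] at hm

theorem sub_leaf (h : G.Pruned X t S S') : ∀ {Y : Fin G.size} {b e : ℕ},
    .sub Y b e ∈ t.leaves → ∃ Z, G.rule Z = .trunc Y b e := by
  induction h with
  | seen hX => intro Y b e hm; simp [LTree.leaves] at hm
  | atom hX hr => intro Y b e hm; simp [LTree.leaves] at hm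
  | concat hX hr h₁ h₂ ih₁ ih₂ =>
    intro Y b e hm
    simp only [LTree.leaves, List.mem_append] at hm
    exact hm.elim ih₁ ih₂
  | rep hX hr h₁ ih₁ =>
    intro Y b e hm
    simp only [LTree.leaves, List.mem_append, List.mem_singleton, reduceCtorEq, or_false] at hm
    exact ih₁ hm
  | trunc hX hr =>
    intro Y b e hm
    simp only [LTree.leaves, List.mem_singleton, NodeLabel.sub.injEq] at hm
    obtain ⟨rfl, rfl, rfl⟩ := hm
    exact ⟨_, hr⟩

/-- Only binary nodes have a leaf `Y ^ m` as a child. -/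
theorem leaves_ne_pow (h : G.Pruned X t S S') (Y : Fin G.size) (m : ℕ) :
    t.leaves ≠ [.pow Y m] := by
  have key : ∀ t₁ t₂ : LTree (NodeLabel α (Fin G.size)), t₁.leaves ++ t₂.leaves ≠ [.pow Y m] := by
    intro t₁ t₂ e
    have h1 := t₁.leaves_length_pos
    have h2 := t₂.leaves_length_pos
    have := congrArg List.length e
    simp only [List.length_append, List.length_singleton] at this
    omega
  cases h with
  | seen hX => simp [LTree.leaves]
  | atom hX hr => simp [LTree.leaves]
  | concat hX hr h₁ h₂ => exact key _ _
  | rep hX hr h₁ => exact key _ (.leaf _)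
  | trunc hX hr => simp [LTree.leaves]

end Pruned

/-! ### Counting leaves by the rules that are expanded -/

/-- Rules of binary nodes. -/
def IsBinary (X : Fin G.size) : Prop := (∃ Y Z, G.rule X = .concat Y Z) ∨ ∃ Y r, G.rule X = .rep Y r

/-- Truncation rules. -/
def IsTrunc (X : Fin G.size) : Prop := ∃ Y b e, G.rule X = .trunc Y b e

open Classical in
theorem ncard_insert_sep {P : Fin G.size → Prop} {X : Fin G.size} {S : Set (Fin G.size)}
    (hX : X ∉ S) : {Y | Y ∈ insert X S ∧ P Y}.ncard =
      {Y | Y ∈ S ∧ P Y}.ncard + if P X then 1 else 0 := by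
  split_ifs with h
  · have e : {Y | Y ∈ insert X S ∧ P Y} = insert X {Y | Y ∈ S ∧ P Y} := by
      ext Y; simp only [Set.mem_insert_iff, Set.mem_ofPred_eq]
      constructor
      · rintro ⟨rfl | h1, h2⟩
        · exact Or.inl rfl
        · exact Or.inr ⟨h1, h2⟩
      · rintro (rfl | ⟨h1, h2⟩)
        · exact ⟨Or.inl rfl, h⟩
        · exact ⟨Or.inr h1, h2⟩
    rw [e, Set.ncard_insert_of_notMem (fun h => hX h.1) (Set.toFinite _)]
  · congr 1
    ext Y; simp only [Set.mem_insert_iff, Set.mem_ofPred_eq]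
    constructor
    · rintro ⟨rfl | h1, h2⟩
      · exact absurd h2 h
      · exact ⟨h1, h2⟩
    · exact fun h => ⟨Or.inr h.1, h.2⟩

/-- The leaves are counted by the binary nodes. -/
theorem Pruned.length_leaves {X : Fin G.size} {t : LTree (NodeLabel α (Fin G.size))}
    {S S' : Set (Fin G.size)} (h : G.Pruned X t S S') :
    t.leaves.length + {Y | Y ∈ S ∧ G.IsBinary Y}.ncard =
      1 + {Y | Y ∈ S' ∧ G.IsBinary Y}.ncard := by
  -- An expanded binary rule replaces one leaf by two subtrees and is recorded exactly once; in all
  -- other cases there is a single leaf and the set of binary nonterminals seen does not change.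
  induction h with
  | seen hX => simp [LTree.leaves]
  | atom hX hr =>
    rw [ncard_insert_sep hX, if_neg (by simp [IsBinary, hr])]
    simp [LTree.leaves]
  | concat hX hr h₁ h₂ ih₁ ih₂ =>
    rw [ncard_insert_sep hX, if_pos (by simp [IsBinary, hr])] at ih₁
    simp only [LTree.leaves, List.length_append]
    omega
  | rep hX hr h₁ ih₁ =>
    rw [ncard_insert_sep hX, if_pos (by simp [IsBinary, hr])] at ih₁
    simp only [LTree.leaves, List.length_append, List.length_singleton]
    omega
  | trunc hX hr =>
    rw [ncard_insert_sep hX, if_neg (by simp [IsBinary, hr])]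
    simp [LTree.leaves]

/-- Leaves of the form `Y[b..e)`. -/
def isSubLabel : NodeLabel α (Fin G.size) → Bool
  | .sub _ _ _ => true
  | _ => false

/-- The leaves `Y[b..e)` are counted by the truncation rules. -/
theorem Pruned.countP_leaves {X : Fin G.size} {t : LTree (NodeLabel α (Fin G.size))}
    {S S' : Set (Fin G.size)} (h : G.Pruned X t S S') :
    t.leaves.countP isSubLabel + {Y | Y ∈ S ∧ G.IsTrunc Y}.ncard =
      {Y | Y ∈ S' ∧ G.IsTrunc Y}.ncard := by
  induction h with
  | seen hX => simp [LTree.leaves, isSubLabel]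
  | atom hX hr =>
    rw [ncard_insert_sep hX, if_neg (by simp [IsTrunc, hr])]
    simp [LTree.leaves, isSubLabel]
  | concat hX hr h₁ h₂ ih₁ ih₂ =>
    rw [ncard_insert_sep hX, if_neg (by simp [IsTrunc, hr])] at ih₁
    simp only [LTree.leaves, List.countP_append]
    omega
  | rep hX hr h₁ ih₁ =>
    rw [ncard_insert_sep hX, if_neg (by simp [IsTrunc, hr])] at ih₁
    simpa [LTree.leaves, List.countP_append, isSubLabel] using ih₁
  | trunc hX hr =>
    rw [ncard_insert_sep hX, if_pos (by simp [IsTrunc, hr])]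
    simp [LTree.leaves, isSubLabel, Nat.add_comm]

end RuleSystem

/-! ### The factorization of an internal collage system -/

theorem substr_append_append {α : Type*} (u w z : List α) :
    substr (u ++ w ++ z) u.length w.length = w := by
  simp [substr, List.append_assoc]

namespace RuleSystem

variable {α : Type*} {G : RuleSystem α}

theorem expand_ne_nil (hOK : ∀ X, G.RuleOK X) (X : Fin G.size) : G.expand X ≠ [] := by
  induction X using WellFoundedLT.induction with
  | ind X ih =>
    have h := hOK X
    rcases hr : G.rule X with a | ⟨Y, Z⟩ | ⟨Y, r⟩ | ⟨Y, b, e⟩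
    · simp [expand_atom hr]
    · have := ih Y (G.sorted X Y (by simp [hr, CollageRule.Refers]))
      simp [expand_concat hr, this]
    · have := List.length_pos_iff.2 (ih Y (G.sorted X Y (by simp [hr, CollageRule.Refers])))
      simp only [RuleOK, hr] at h
      rw [expand_rep hr, ← List.length_pos_iff, length_strPow]
      positivity
    · simp only [RuleOK, hr] at h
      rw [expand_trunc hr, ← List.length_pos_iff, length_substr _ (by omega)]
      omega

theorem labelString_ne_nil (hOK : ∀ X, G.RuleOK X) {X : Fin G.size}
    {t : LTree (NodeLabel α (Fin G.size))} {S S' : Set (Fin G.size)} (h : G.Pruned X t S S')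
    {l : NodeLabel α (Fin G.size)} (hl : l ∈ t.leaves) : G.labelString l ≠ [] := by
  cases l with
  | nt Y => exact expand_ne_nil hOK Y
  | term a => simp [labelString]
  | pow Y m =>
    obtain ⟨k, hk⟩ := List.getElem?_of_mem hl
    obtain ⟨Z, r, i, hr, rfl, _⟩ := h.pow_leaf (s := 0) hk
    have h3 := hOK Z
    simp only [RuleOK, hr] at h3
    have := List.length_pos_iff.2 (expand_ne_nil hOK Y)
    rw [labelString, ← List.length_pos_iff, length_strPow]
    exact Nat.mul_pos (by omega) this
  | sub Y b e =>
    obtain ⟨Z, hr⟩ := h.sub_leaf hl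
    have h3 := hOK Z
    simp only [RuleOK, hr] at h3
    rw [labelString, ← List.length_pos_iff, length_substr _ (by omega)]
    omega

theorem exists_atom_of_mem_expand {a : α} (X : Fin G.size) :
    a ∈ G.expand X → ∃ Y, G.rule Y = .atom a := by
  induction X using WellFoundedLT.induction with
  | ind X ih =>
    intro ha
    rcases hr : G.rule X with b | ⟨Y, Z⟩ | ⟨Y, r⟩ | ⟨Y, b, e⟩
    · rw [expand_atom hr, List.mem_singleton] at ha
      subst ha
      exact ⟨X, hr⟩
    · rw [expand_concat hr, List.mem_append] at ha
      exact ha.elim (ih Y (G.sorted X Y (by simp [hr, CollageRule.Refers])))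
        (ih Z (G.sorted X Z (by simp [hr, CollageRule.Refers])))
    · rw [expand_rep hr] at ha
      exact ih Y (G.sorted X Y (by simp [hr, CollageRule.Refers])) (mem_strPow ha)
    · rw [expand_trunc hr] at ha
      exact ih Y (G.sorted X Y (by simp [hr, CollageRule.Refers]))
        ((substr_infix _ _ _).subset ha)

/-- Rules of single symbols. -/
def IsAtom (X : Fin G.size) : Prop := ∃ a, G.rule X = .atom a

/-- Concatenation, repetition and truncation create no new symbols, so each symbol of `T` has a rule
of its own, and a rule determines its symbol. -/
theorem card_symbols_le [DecidableEq α] {T : List α} (h : G.expand G.start = T) :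
    T.dedup.length ≤ {X | G.IsAtom X}.ncard := by
  classical
  have hex : ∀ a, ∃ Y, a ∈ T → G.rule Y = .atom a := by
    intro a
    by_cases ha : a ∈ T
    · obtain ⟨Y, hY⟩ := exists_atom_of_mem_expand G.start (by rw [h]; exact ha)
      exact ⟨Y, fun _ => hY⟩
    · exact ⟨G.start, fun h => absurd h ha⟩
  choose g hg using hex
  have hcard : T.dedup.length = T.toFinset.card := (List.card_toFinset T).symm
  rw [hcard, ← Set.ncard_coe_finset]
  refine Set.ncard_le_ncard_of_injOn g ?_ ?_ (Set.toFinite _)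
  · intro a ha
    exact ⟨a, hg a (by simpa using ha)⟩
  · intro a ha b hb e
    have h1 := hg a (by simpa using ha)
    have h2 := hg b (by simpa using hb)
    rw [e, h2] at h1
    simpa using h1.symm

theorem size_eq : G.size = {X | G.IsBinary X}.ncard + {X | G.IsTrunc X}.ncard +
    {X | G.IsAtom X}.ncard := by
  classical
  have e : (Set.univ : Set (Fin G.size)) =
      {X | G.IsBinary X} ∪ {X | G.IsTrunc X} ∪ {X | G.IsAtom X} := by
    ext X
    rcases hr : G.rule X with b | ⟨Y, Z⟩ | ⟨Y, r⟩ | ⟨Y, b, e⟩ <;>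
      simp [IsBinary, IsTrunc, IsAtom, hr]
  have hd1 : Disjoint {X | G.IsBinary X} {X | G.IsTrunc X} := by
    rw [Set.disjoint_left]
    rintro X (⟨Y, Z, h⟩ | ⟨Y, r, h⟩) ⟨Y', b, e, h'⟩ <;> rw [h] at h' <;> cases h'
  have hd2 : Disjoint ({X | G.IsBinary X} ∪ {X | G.IsTrunc X}) {X | G.IsAtom X} := by
    rw [Set.disjoint_left]
    rintro X ((⟨Y, Z, h⟩ | ⟨Y, r, h⟩) | ⟨Y, b, e, h⟩) ⟨a, h'⟩ <;> rw [h] at h' <;> cases h'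
  have hu : (Set.univ : Set (Fin G.size)).ncard = G.size := by simp [Set.ncard_univ]
  rw [← Set.ncard_union_eq hd1, ← Set.ncard_union_eq hd2, ← e, hu]

end RuleSystem

namespace CatFactorization

open RuleSystem

variable {α : Type*} {G : RuleSystem α} {F : CatFactorization} {T : List α}

section OfSystem

variable (hG : G.IsICSFor T) (hF : F.IsICSFactorizationOf G)

include hF in
theorem IsICSFactorizationOf.pos_eq {k : ℕ} (hk : k ≤ F.count) :
    F.pos k = (yieldOf (G.grammarTree.leaves.take k)).length := by
  obtain ⟨h1, h2, h3, -⟩ := hF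
  induction k with
  | zero => simpa [yieldOf] using h2
  | succ k ih =>
    have hlt : k < G.grammarTree.leaves.length := by omega
    rw [h3 k _ (List.getElem?_eq_getElem hlt), ih (by omega), List.take_succ_eq_append_getElem hlt,
      yieldOf_append, yieldOf_singleton, List.length_append]

include hG in
theorem yieldOf_grammarTree : yieldOf G.grammarTree.leaves = T := by
  obtain ⟨S', hP⟩ := exists_pruned_grammarTree G
  rw [hP.yieldOf_leaves hG.1.1, hG.2.2]

include hG hF in
theorem IsICSFactorizationOf.substr_eq {A M B : List (NodeLabel α (Fin G.size))}
    (h : G.grammarTree.leaves = A ++ M ++ B) :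
    substr T (F.pos A.length) (F.pos (A.length + M.length) - F.pos A.length) = yieldOf M := by
  have hlen := congrArg List.length h
  simp only [List.length_append] at hlen
  have hc := hF.1
  have e1 : G.grammarTree.leaves.take A.length = A := by
    rw [h, List.append_assoc, List.take_left]
  have e2 : G.grammarTree.leaves.take (A.length + M.length) = A ++ M := by
    rw [h, ← List.length_append, List.take_left]
  rw [hF.pos_eq (by omega), hF.pos_eq (by omega), e1, e2, yieldOf_append, List.length_append,
    Nat.add_sub_cancel_left, ← yieldOf_grammarTree hG, h, yieldOf_append, yieldOf_append,
    substr_append_append]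

include hG hF in
theorem IsICSFactorizationOf.substr_leaf {k : ℕ} {l : NodeLabel α (Fin G.size)}
    (h : G.grammarTree.leaves[k]? = some l) : F.seg T k k = G.labelString l := by
  obtain ⟨hk, rfl⟩ := List.getElem?_eq_some_iff.1 h
  have e : G.grammarTree.leaves = G.grammarTree.leaves.take k ++ [G.grammarTree.leaves[k]] ++
      G.grammarTree.leaves.drop (k + 1) := by
    rw [← List.take_succ_eq_append_getElem hk, List.take_append_drop]
  have := hF.substr_eq hG e
  rwa [List.length_take, min_eq_left hk.le, List.length_singleton, yieldOf_singleton] at this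

include hG hF in
theorem IsICSFactorizationOf.substr_node {Y : Fin G.size} {i j : ℕ}
    (h : (.nt Y, i, j) ∈ G.grammarTree.nodes) :
    i < j ∧ j ≤ F.count ∧ substr T (F.pos i) (F.pos j - F.pos i) = G.expand Y := by
  obtain ⟨S', hP⟩ := exists_pruned_grammarTree G
  have hb := LTree.nodesFrom_bounds h
  obtain ⟨t', S₁, S₁', ht', -, A, B, e, e1, e2⟩ := hP.exists_subtree h
  have := hF.substr_eq hG e
  rw [ht'.yieldOf_leaves hG.1.1] at this
  have hc := hF.1
  refine ⟨hb.2.1, by have := hb.2.2; simp only at this; omega, ?_⟩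
  rw [e2, e1, Nat.zero_add]
  exact this

include hG hF in
theorem IsICSFactorizationOf.isFactorizationOf : F.IsFactorizationOf T := by
  obtain ⟨S', hP⟩ := exists_pruned_grammarTree G
  refine ⟨hF.2.1, ?_, ?_⟩
  · rw [hF.pos_eq le_rfl, hF.1, List.take_length, yieldOf_grammarTree hG]
  · intro k hk
    have hlt : k < G.grammarTree.leaves.length := by rw [← hF.1]; exact hk
    have h := hF.2.2.1 k _ (List.getElem?_eq_getElem hlt)
    have := List.length_pos_iff.2 (labelString_ne_nil hG.1.1 hP (List.getElem_mem hlt))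
    omega

/-- Several nodes can carry the label `X`, but one whose last leaf is `Y ^ m` has not been pruned to
a leaf labelled `X`. So it is expanded, and its left child covers the other leaves. -/
theorem rep_node {X Y : Fin G.size} {r i k m : ℕ} (hr : G.rule X = .rep Y r)
    (hk : G.grammarTree.leaves[k]? = some (.pow Y m))
    (hn : (.nt X, i, k + 1) ∈ G.grammarTree.nodes) :
    i < k ∧ (.nt Y, i, k) ∈ G.grammarTree.nodes := by
  obtain ⟨S', hP⟩ := exists_pruned_grammarTree G
  obtain ⟨t', S₁, S₁', ht', hsub, A, B, e, e1, e2⟩ := hP.exists_subtree hn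
  cases ht' with
  | seen hX =>
    simp only [LTree.leaves, List.length_singleton] at e2
    have hkA : k = A.length := by omega
    rw [e, hkA] at hk
    simp [LTree.leaves] at hk
  | atom hX hr' => rw [hr] at hr'; cases hr'
  | concat hX hr' h₁ h₂ => rw [hr] at hr'; cases hr'
  | rep hX hr' h₁ =>
    rename_i Y' r' t₁
    rw [hr] at hr'
    simp only [CollageRule.rep.injEq] at hr'
    obtain ⟨rfl, rfl⟩ := hr'
    simp only [LTree.leaves, List.length_append, List.length_singleton] at e2
    have hpos := t₁.leaves_length_pos
    refine ⟨by omega, hsub ?_⟩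
    have hroot := h₁.root_mem_nodesFrom i
    have ek : i + t₁.leaves.length = k := by omega
    rw [ek] at hroot
    exact List.mem_cons_of_mem _ (List.mem_append_left _ hroot)
  | trunc hX hr' => rw [hr] at hr'; cases hr'

include hF in
/-- Each interval of the tree structure belongs to a node. -/
theorem IsICSFactorizationOf.exists_node {x : ℕ × ℕ} (hx : x ∈ F.intervals) :
    ∃ Y : Fin G.size, (.nt Y, x.1, x.2) ∈ G.grammarTree.nodes := by
  obtain ⟨k, hk, ⟨i, j, hkind, h1, h2⟩ | ⟨i, j, hkind, rfl⟩⟩ := hx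
  · have hl := hF.2.2.2 k hk
    obtain ⟨a, b⟩ := x
    simp only at h1 h2
    subst h1 h2
    unfold LeafKind at hl
    rcases hkind with hkind | hkind | hkind
    · simp only [hkind] at hl
      obtain ⟨_, _, X, _, h⟩ := hl
      exact ⟨X, h⟩
    · simp only [hkind] at hl
      obtain ⟨e, X, Y, r, hr, hkl, h⟩ := hl
      rw [e]
      exact ⟨Y, (rep_node hr hkl h).2⟩
    · simp only [hkind] at hl
      obtain ⟨_, Y, b, e, _, h⟩ := hl
      exact ⟨Y, h⟩
  · have hl := hF.2.2.2 k hk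
    simp only [LeafKind, hkind] at hl
    obtain ⟨e, X, Y, r, hr, hkl, h⟩ := hl
    exact ⟨X, h⟩

/-- The labels below a node are smaller than its label. -/
theorem label_lt_of_node {Y : Fin G.size} {i j k : ℕ} {l : NodeLabel α (Fin G.size)}
    (hn : (.nt Y, i, j) ∈ G.grammarTree.nodes) (hk : G.grammarTree.leaves[k]? = some l)
    (h1 : i ≤ k) (h2 : k < j) : (l = .nt Y ∧ k = i ∧ j = i + 1) ∨ LabelLT l Y := by
  obtain ⟨S', hP⟩ := exists_pruned_grammarTree G
  obtain ⟨t', S₁, S₁', ht', -, A, B, e, e1, e2⟩ := hP.exists_subtree hn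
  have hmem : l ∈ t'.leaves := by
    rw [e, List.append_assoc, List.getElem?_append_right (by omega),
      List.getElem?_append_left (by omega)] at hk
    exact List.mem_of_getElem? hk
  rcases ht'.leaf_lt l hmem with ⟨h, h'⟩ | h
  · subst h'
    simp only [LTree.leaves, List.length_singleton] at e2
    exact Or.inl ⟨h, by omega, e2⟩
  · exact Or.inr h

/-- A reference depth for the leaves of a grammar tree with `h` leaves. -/
def leafDepth (G : RuleSystem α) (h k : ℕ) : NodeLabel α (Fin G.size) → ℕ
  | .nt Y => Y * (h + 1) + k + 1
  | .term _ => 0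
  | .pow Y _ => Y * (h + 1) + k + 1
  | .sub Y _ _ => Y * (h + 1) + h + 1

/-- The depth is lexicographic: the number of the nonterminal counts first, then the position of the
leaf. Each nonterminal owns a block of `h + 1` values, so a smaller nonterminal never reaches the
block of a larger one. Truncated leaves take the top of their block, since they may refer to either
side. -/
theorem leafDepth_le {h k : ℕ} (hk : k < h) {l : NodeLabel α (Fin G.size)} {Y : Fin G.size}
    (hl : LabelLT l Y) : leafDepth G h k l ≤ Y * (h + 1) := by
  have key : ∀ Z : Fin G.size, Z < Y → (Z : ℕ) * (h + 1) + h + 1 ≤ Y * (h + 1) := by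
    intro Z hZ
    have h1 : (Z : ℕ) + 1 ≤ Y := hZ
    calc (Z : ℕ) * (h + 1) + h + 1 = (Z + 1) * (h + 1) := by ring
      _ ≤ _ := Nat.mul_le_mul_right _ h1
  cases l with
  | nt Z => have := key Z hl; simp only [leafDepth]; omega
  | term a => exact Nat.zero_le _
  | pow Z m => have := key Z hl; simp only [leafDepth]; omega
  | sub Z b e => exact key Z hl

include hG hF in
/-- The factorization of an internal collage system has the required properties. -/
theorem IsICSFactorizationOf.isValidFor : F.IsValidFor T := by
  classical
  obtain ⟨S', hP⟩ := exists_pruned_grammarTree G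
  have hFac := hF.isFactorizationOf hG
  have hleaf : ∀ k < F.count, ∃ l, G.grammarTree.leaves[k]? = some l := fun k hk =>
    ⟨_, List.getElem?_eq_getElem (by rw [← hF.1]; exact hk)⟩
  refine ⟨hFac, ?_, ⟨?_, ?_⟩, ?_⟩
  · intro k hk
    have hl := hF.2.2.2 k hk
    unfold LeafKind at hl
    unfold KindOK
    cases hkind : F.kind k with
    | single => simpa [hkind] using hl
    | typeA i j =>
      simp only [hkind] at hl ⊢
      obtain ⟨h1, h2, X, h3, h4⟩ := hl
      obtain ⟨h5, h6, h7⟩ := hF.substr_node hG h4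
      exact ⟨h1, by omega, h2, by rw [hF.substr_leaf hG h3, seg, h7]; rfl⟩
    | typeB i j =>
      simp only [hkind] at hl ⊢
      obtain ⟨rfl, X, Y, r, hr, h3, h4⟩ := hl
      obtain ⟨h5, h6⟩ := rep_node hr h3 h4
      obtain ⟨h7, h8, h9⟩ := hF.substr_node hG h6
      have hr3 := hG.1.1 X
      simp only [RuleOK, hr] at hr3
      have hseg := hF.substr_leaf hG h3
      have hlen := hFac.length_seg (i := j + 1) (j := j + 1) (by omega) (by omega)
      rw [hseg, labelString, length_strPow] at hlen
      have hpos := List.length_pos_iff.2 (expand_ne_nil hG.1.1 Y)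
      -- The rule has `r > 2`, so the leaf holds at least two nonempty copies and is longer than 1.
      have : 2 * 1 ≤ (r - 1) * (G.expand Y).length := Nat.mul_le_mul (by omega) hpos
      refine ⟨by omega, by omega, rfl, r, hr3, ?_⟩
      rw [hseg, seg, h9]; rfl
    | typeC i j =>
      simp only [hkind] at hl ⊢
      obtain ⟨h1, Y, b, e, h3, h4⟩ := hl
      obtain ⟨h5, h6, h7⟩ := hF.substr_node hG h4
      refine ⟨h1, by omega, by omega, ?_, ?_⟩
      -- A leaf `Y[b..e)` inside the interval referred to would lie below a node labelled `Y`, where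
      -- labels are smaller.
      · by_contra hcon
        rcases label_lt_of_node h4 h3 (by omega) (by omega) with ⟨h, _⟩ | h
        · cases h
        · exact lt_irrefl _ (show Y < Y from h)
      · rw [hF.substr_leaf hG h3, seg, h7]
        exact substr_infix _ _ _
  · intro x hx y hy
    obtain ⟨X, hX⟩ := hF.exists_node hx
    obtain ⟨Y, hY⟩ := hF.exists_node hy
    exact LTree.nodesFrom_not_cross hX hY
  · intro k hk i j hkind hx
    obtain ⟨Z, hZ⟩ := hF.exists_node hx
    have hl := hF.2.2.2 k hk
    simp only [LeafKind, hkind] at hl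
    obtain ⟨_, X, Y, r, hr, h3, _⟩ := hl
    obtain ⟨t', S₁, S₁', ht', -, A, B, e, e1, e2⟩ := hP.exists_subtree hZ
    simp only at e1 e2
    -- The node covers one leaf only, which would be `Y ^ (r - 1)`; but such a leaf always has a
    -- left sibling under the same nonterminal node.
    obtain ⟨l, hl⟩ := List.length_eq_one_iff.1 (show t'.leaves.length = 1 by omega)
    rw [e, hl, e1] at h3
    simp at h3
    exact ht'.leaves_ne_pow Y (r - 1) (by rw [hl, h3])
  · set D : ℕ → ℕ := fun k => (G.grammarTree.leaves[k]?).elim 0 (leafDepth G F.count k) with hD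
    -- A leaf below a node labelled `Y` either has a smaller label, or is the node itself. In the
    -- latter case its depth within the block of `Y` is governed by its position, and references of
    -- types A and B go to the left.
    have hnode : ∀ {Y : Fin G.size} {i j t : ℕ}, (.nt Y, i, j) ∈ G.grammarTree.nodes → i ≤ t →
        t < j → D t ≤ Y * (F.count + 1) + t + 1 := by
      intro Y i j t hn h1 h2
      have hlt := (hF.substr_node hG hn).2.1
      obtain ⟨l, hl⟩ := hleaf t (by omega)
      simp only [hD, hl, Option.elim]
      rcases label_lt_of_node hn hl h1 h2 with ⟨rfl, _⟩ | h
      · exact le_rfl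
      · exact (leafDepth_le (by omega) h).trans (by omega)
    -- A leaf of length 1 may carry a nonterminal or truncation label, so its depth has to be reset
    -- to 0.
    refine ⟨fun k => if F.kind k = .single then 0 else D k, fun k hk => ⟨fun hs => if_pos hs, ?_⟩⟩
    rintro a b ⟨i, j, hkind, rfl, rfl⟩ t h1 h2
    have hns : F.kind k ≠ .single := by
      rcases hkind with hkk | hkk | hkk <;> rw [hkk] <;> simp
    simp only [if_neg hns]
    refine lt_of_le_of_lt (b := D t) (by split_ifs <;> omega) ?_
    have hl := hF.2.2.2 k hk
    unfold LeafKind at hl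
    rcases hkind with hkind | hkind | hkind
    · simp only [hkind] at hl
      obtain ⟨_, h4, X, h5, h6⟩ := hl
      have := hnode h6 h1 h2
      have e : D k = X * (F.count + 1) + k + 1 := by simp [hD, h5, leafDepth]
      omega
    · simp only [hkind] at hl
      obtain ⟨rfl, X, Y, r, hr, h5, h6⟩ := hl
      have := hnode (rep_node hr h5 h6).2 h1 h2
      have e : D (j + 1) = Y * (F.count + 1) + (j + 1) + 1 := by simp [hD, h5, leafDepth]
      omega
    · simp only [hkind] at hl
      obtain ⟨_, Y, b, e', h5, h6⟩ := hl
      have := hnode h6 h1 h2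
      have hlt := (hF.substr_node hG h6).2.1
      have e : D k = Y * (F.count + 1) + F.count + 1 := by simp [hD, h5, leafDepth]
      omega

include hG hF in
-- With every nonterminal seen, `h` leaves mean `h - 1` binary rules, and the truncated leaves match
-- the truncation rules. Only an inequality holds in general: a truncated leaf of length 1 is no
-- type-C factor, and a symbol may have several rules.
theorem IsICSFactorizationOf.count_add_le [DecidableEq α] :
    F.count + F.numC + T.dedup.length ≤ G.size + 1 := by
  obtain ⟨S', hP⟩ := exists_pruned_grammarTree G
  have hS := hP.eq_univ hG.2.1
  subst hS
  have h1 := hP.length_leaves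
  have h2 := hP.countP_leaves
  simp only [Set.mem_univ, Set.mem_empty_iff_false, true_and, false_and] at h1 h2
  have h0 : {Y : Fin G.size | False}.ncard = 0 := by simp
  rw [h0] at h1 h2
  have h3 := card_symbols_le hG.2.2
  have h4 := G.size_eq
  have h5 : F.numC ≤ G.grammarTree.leaves.countP isSubLabel := by
    classical
    -- Counting leaves by their positions makes them comparable with the indices of type-C factors.
    have e : ∀ L : List (NodeLabel α (Fin G.size)), L.countP isSubLabel =
        ((Finset.range L.length).filter fun k => (L[k]?).any isSubLabel = true).card := by
      intro L
      induction L using List.reverseRecOn with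
      | nil => simp
      | append_singleton L l ih =>
        rw [List.countP_append, List.length_append, List.length_singleton, Finset.range_add_one,
          Finset.filter_insert, ih]
        have hcongr : (Finset.range L.length).filter
            (fun k => ((L ++ [l])[k]?).any isSubLabel = true) =
            (Finset.range L.length).filter fun k => (L[k]?).any isSubLabel = true := by
          refine Finset.filter_congr fun k hk => ?_
          rw [List.getElem?_append_left (by simpa using hk)]
        rw [hcongr]
        cases hl : isSubLabel l <;> simp [hl]
    rw [e, numC, ← Set.ncard_coe_finset]
    refine Set.ncard_le_ncard ?_ (Finset.finite_toSet _)
    rintro k ⟨hk, i, j, hkind⟩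
    have hl := hF.2.2.2 k hk
    simp only [LeafKind, hkind] at hl
    obtain ⟨_, Y, b, e', h5, h6⟩ := hl
    exact Finset.mem_coe.2 (Finset.mem_filter.2
      ⟨by rw [Finset.mem_range, ← hF.1]; exact hk, by rw [h5]; rfl⟩)
  have h6 := hF.1
  omega

end OfSystem

/-- Every internal collage system has a categorized factorization. -/
theorem exists_isICSFactorizationOf (hG : G.IsICSFor T) :
    ∃ F : CatFactorization, F.IsICSFactorizationOf G := by
  obtain ⟨S', hP⟩ := exists_pruned_grammarTree G
  have hS := hP.eq_univ hG.2.1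
  subst hS
  let L := G.grammarTree.leaves
  let pos : ℕ → ℕ := fun k => (yieldOf (L.take k)).length
  have hpos : ∀ k l, L[k]? = some l → pos (k + 1) = pos k + (G.labelString l).length := by
    intro k l hl
    obtain ⟨hk, rfl⟩ := List.getElem?_eq_some_iff.1 hl
    simp only [pos, List.take_succ_eq_append_getElem hk, yieldOf_append, yieldOf_singleton,
      List.length_append]
  have hex : ∀ k, ∃ κ, k < L.length → (CatFactorization.mk L.length pos fun _ => κ).LeafKind G k := by
    intro k
    by_cases hk : k < L.length
    swap
    · exact ⟨.single, fun h => absurd h hk⟩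
    have hl := List.getElem?_eq_getElem hk
    obtain ⟨l, hl⟩ : ∃ l, L[k]? = some l := ⟨_, hl⟩
    have hp := hpos k l hl
    have hne := List.length_pos_iff.2 (labelString_ne_nil hG.1.1 hP (List.mem_of_getElem? hl))
    by_cases h1 : pos (k + 1) = pos k + 1
    · exact ⟨.single, fun _ => h1⟩
    cases l with
    | term a => exact absurd hp h1
    | nt X =>
      -- The set seen at the start is empty, so a nonterminal leaf must repeat a label found further
      -- left.
      rcases hP.nt_leaf (s := 0) hl with h | ⟨i, j, hn, hj⟩
      · exact absurd h (Set.notMem_empty _)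
      have hb := (LTree.nodesFrom_bounds hn).2.1
      simp only at hb
      obtain ⟨j, rfl⟩ := Nat.exists_eq_succ_of_ne_zero (n := j) (by omega)
      refine ⟨.typeA i j, fun _ => ⟨?_, by omega, X, hl, hn⟩⟩
      simp only
      omega
    | pow Y m =>
      obtain ⟨Z, r, i, hr, rfl, hn, hik⟩ := hP.pow_leaf (s := 0) hl
      obtain ⟨k, rfl⟩ := Nat.exists_eq_succ_of_ne_zero (n := k) (by omega)
      rw [Nat.zero_add] at hn
      exact ⟨.typeB i k, fun _ => ⟨rfl, Z, Y, r, hr, hl, hn⟩⟩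
    | sub Y b e =>
      -- Here internality is essential: every nonterminal labels some node of the grammar tree, so
      -- the truncated one can be referred to.
      rcases hP.exists_node 0 Y (Set.mem_univ _) with h | ⟨i, j, hn⟩
      · exact absurd h (Set.notMem_empty _)
      have hb := (LTree.nodesFrom_bounds hn).2.1
      simp only at hb
      obtain ⟨j, rfl⟩ := Nat.exists_eq_succ_of_ne_zero (n := j) (by omega)
      refine ⟨.typeC i j, fun _ => ⟨?_, Y, b, e, hl, hn⟩⟩
      simp only
      omega
  choose kind hkind using hex
  exact ⟨⟨L.length, pos, kind⟩, rfl, by simp [pos, yieldOf], hpos, hkind⟩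

end CatFactorization

/-! ### The tree of a categorized factorization -/

namespace CatFactorization

variable {α : Type*} (F : CatFactorization) (T : List α)

/-- The `k`-th factor has type B. -/
def IsB (k : ℕ) : Prop := ∃ i j, F.kind k = .typeB i j

/-- The string of the factors in an interval. -/
def str (x : ℕ × ℕ) : List α := substr T (F.pos x.1) (F.pos x.2 - F.pos x.1)

open Classical in
/-- Where a node covering the factors `a, …, b - 1` is split: at the end of the longest shorter
interval that starts at `a`, if there is one. -/
noncomputable def splitAt (a b : ℕ) : ℕ :=
  Nat.findGreatest (fun y => y = a + 1 ∨ (a, y) ∈ F.intervals) (b - 1)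

variable {F T}

theorem splitAt_bounds {a b : ℕ} (h : a + 2 ≤ b) : a < F.splitAt a b ∧ F.splitAt a b < b := by
  classical
  have h1 : a + 1 ≤ F.splitAt a b := Nat.le_findGreatest (by omega) (Or.inl rfl)
  have h2 : F.splitAt a b ≤ b - 1 := Nat.findGreatest_le _
  omega

theorem splitAt_spec {a b : ℕ} (h : a + 2 ≤ b) :
    F.splitAt a b = a + 1 ∨ (a, F.splitAt a b) ∈ F.intervals := by
  classical
  exact Nat.findGreatest_spec (P := fun y => y = a + 1 ∨ (a, y) ∈ F.intervals) (m := a + 1)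
    (by omega) (Or.inl rfl)

theorem le_splitAt {a b y : ℕ} (h : (a, y) ∈ F.intervals) (hy : y < b) : y ≤ F.splitAt a b := by
  classical
  exact Nat.le_findGreatest (by omega) (Or.inr h)

variable (F) in
/-- The inner nodes of the binary tree with root `[a..b)`. -/
noncomputable def treeNodes (a b : ℕ) : Finset (ℕ × ℕ) :=
  if h : a + 2 ≤ b then
    have := splitAt_bounds (F := F) h
    insert (a, b) (treeNodes a (F.splitAt a b) ∪ treeNodes (F.splitAt a b) b)
  else ∅
termination_by b - a

theorem treeNodes_of_le {a b : ℕ} (h : a + 2 ≤ b) : F.treeNodes a b =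
    insert (a, b) (F.treeNodes a (F.splitAt a b) ∪ F.treeNodes (F.splitAt a b) b) := by
  rw [treeNodes, dif_pos h]

theorem treeNodes_of_not_le {a b : ℕ} (h : ¬ a + 2 ≤ b) : F.treeNodes a b = ∅ := by
  rw [treeNodes, dif_neg h]

theorem self_mem_treeNodes {a b : ℕ} (h : a + 2 ≤ b) : (a, b) ∈ F.treeNodes a b := by
  rw [treeNodes_of_le h]; exact Finset.mem_insert_self _ _

/-- A binary tree with `b - a` leaves has `b - a - 1` inner nodes. -/
theorem card_treeNodes_le (a b : ℕ) : (F.treeNodes a b).card ≤ b - a - 1 := by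
  induction hn : b - a using Nat.strong_induction_on generalizing a b with
  | _ n ih =>
    by_cases h : a + 2 ≤ b
    · have hs := splitAt_bounds (F := F) h
      rw [treeNodes_of_le h]
      have h1 := ih _ (by omega) a (F.splitAt a b) rfl
      have h2 := ih _ (by omega) (F.splitAt a b) b rfl
      refine (Finset.card_insert_le _ _).trans ?_
      have := Finset.card_union_le (F.treeNodes a (F.splitAt a b)) (F.treeNodes (F.splitAt a b) b)
      omega
    · rw [treeNodes_of_not_le h]; simp

theorem treeNodes_bounds {a b : ℕ} {x : ℕ × ℕ} (hx : x ∈ F.treeNodes a b) :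
    a ≤ x.1 ∧ x.1 + 2 ≤ x.2 ∧ x.2 ≤ b := by
  induction hn : b - a using Nat.strong_induction_on generalizing a b with
  | _ n ih =>
    by_cases h : a + 2 ≤ b
    · have hs := splitAt_bounds (F := F) h
      rw [treeNodes_of_le h, Finset.mem_insert, Finset.mem_union] at hx
      rcases hx with rfl | hx | hx
      · exact ⟨le_rfl, h, le_rfl⟩
      · have := ih _ (by omega) hx rfl; omega
      · have := ih _ (by omega) hx rfl; omega
    · rw [treeNodes_of_not_le h] at hx; simp at hx

theorem treeNodes_subset {a b : ℕ} {x : ℕ × ℕ} (hx : x ∈ F.treeNodes a b) :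
    F.treeNodes x.1 x.2 ⊆ F.treeNodes a b := by
  induction hn : b - a using Nat.strong_induction_on generalizing a b with
  | _ n ih =>
    by_cases h : a + 2 ≤ b
    · have hs := splitAt_bounds (F := F) h
      rw [treeNodes_of_le h, Finset.mem_insert, Finset.mem_union] at hx
      rcases hx with rfl | hx | hx
      · exact subset_rfl
      · rw [treeNodes_of_le h]
        exact (ih _ (by omega) hx rfl).trans
          (Finset.subset_union_left.trans (Finset.subset_insert _ _))
      · rw [treeNodes_of_le h]
        exact (ih _ (by omega) hx rfl).trans
          (Finset.subset_union_right.trans (Finset.subset_insert _ _))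
    · rw [treeNodes_of_not_le h] at hx; simp at hx

variable (F) in
/-- No interval crosses `[a..b)`. -/
def Uncrossed (a b : ℕ) : Prop := ∀ x ∈ F.intervals,
  ¬ (x.1 < a ∧ a < x.2 ∧ x.2 < b) ∧ ¬ (a < x.1 ∧ x.1 < b ∧ b < x.2)

/-! ### How the intervals sit in the binary tree -/

section Valid

variable (hV : F.IsValidFor T)

include hV

theorem IsValidFor.feasKind {k : ℕ} (hk : k < F.count) : F.FeasKind T k :=
  (hV.1.kindOK_iff hk).1 (hV.2.1 k hk)

theorem IsValidFor.interval_bounds {x : ℕ × ℕ} (hx : x ∈ F.intervals) :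
    x.1 < x.2 ∧ x.2 ≤ F.count :=
  hV.1.interval_bounds (fun _ hk => hV.feasKind hk) hx

theorem IsValidFor.typeA_bounds {k i j : ℕ} (hk : k < F.count) (hkind : F.kind k = .typeA i j) :
    i ≤ j ∧ j < k ∧ (i, j + 1) ∈ F.intervals ∧ F.str T (k, k + 1) = F.str T (i, j + 1) := by
  have h := hV.2.1 k hk
  simp only [KindOK, hkind] at h
  exact ⟨h.2.1, h.2.2.1, ⟨k, hk, Or.inl ⟨i, j, Or.inl hkind, rfl, rfl⟩⟩, h.2.2.2⟩

theorem IsValidFor.typeB_bounds {k i j : ℕ} (hk : k < F.count) (hkind : F.kind k = .typeB i j) :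
    i ≤ j ∧ j + 1 = k ∧ (i, k) ∈ F.intervals ∧ (i, k + 1) ∈ F.intervals ∧
      ∃ r, 3 ≤ r ∧ F.str T (k, k + 1) = strPow (F.str T (i, k)) (r - 1) := by
  have h := hV.2.1 k hk
  simp only [KindOK, hkind] at h
  obtain ⟨_, h1, rfl, h2⟩ := h
  exact ⟨h1, rfl, ⟨_, hk, Or.inl ⟨i, j, Or.inr (Or.inl hkind), rfl, rfl⟩⟩,
    ⟨_, hk, Or.inr ⟨i, j, hkind, rfl⟩⟩, h2⟩

theorem IsValidFor.typeC_bounds {k i j : ℕ} (hk : k < F.count) (hkind : F.kind k = .typeC i j) :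
    i ≤ j ∧ j < F.count ∧ (i, j + 1) ∈ F.intervals ∧ F.str T (k, k + 1) <:+: F.str T (i, j + 1) := by
  have h := hV.2.1 k hk
  simp only [KindOK, hkind] at h
  exact ⟨h.2.1, h.2.2.1, ⟨k, hk, Or.inl ⟨i, j, Or.inr (Or.inr hkind), rfl, rfl⟩⟩, h.2.2.2.2⟩

theorem IsValidFor.not_isB_of_interval {k : ℕ} (h : (k, k + 1) ∈ F.intervals) : ¬ F.IsB k := by
  rintro ⟨i, j, hkind⟩
  have := hV.interval_bounds h
  exact hV.2.2.1.2 k (by simp only at this; omega) i j hkind h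

/-- A proper interval starting at `a` ends at or before the split by maximality. One starting later
and reaching across the split would cross the interval that determined the split; and if the split
is at `a + 1`, nothing that starts later reaches across it. -/
theorem IsValidFor.not_across_split {a b x y : ℕ} (hab : a + 2 ≤ b) (hx : (x, y) ∈ F.intervals)
    (h1 : a ≤ x) (h2 : y ≤ b) (hne : (x, y) ≠ (a, b)) :
    y ≤ F.splitAt a b ∨ F.splitAt a b ≤ x := by
  by_contra! hcon
  rcases h1.eq_or_lt with rfl | h1
  · have hy : y < b := lt_of_le_of_ne h2 fun e => hne (by rw [e])
    have := le_splitAt hx hy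
    omega
  · rcases splitAt_spec (F := F) hab with h | h
    · omega
    · exact hV.2.2.1.1 _ h _ hx ⟨h1, hcon.2, hcon.1⟩

/-- An interval other than the whole node lies within one of its children, so descending the tree
eventually reaches it as a node. -/
theorem IsValidFor.interval_mem_treeNodes {a b x y : ℕ} (hx : (x, y) ∈ F.intervals) (h1 : a ≤ x)
    (h2 : y ≤ b) (h3 : x + 2 ≤ y) : (x, y) ∈ F.treeNodes a b := by
  induction hn : b - a using Nat.strong_induction_on generalizing a b with
  | _ n ih =>
    have hab : a + 2 ≤ b := by omega
    have hs := splitAt_bounds (F := F) hab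
    rw [treeNodes_of_le hab, Finset.mem_insert, Finset.mem_union]
    by_cases hne : (x, y) = (a, b)
    · exact Or.inl hne
    · rcases hV.not_across_split hab hx h1 h2 hne with h | h
      · exact Or.inr (Or.inl (ih _ (by omega) h1 h rfl))
      · exact Or.inr (Or.inr (ih _ (by omega) h h2 rfl))

/-- An interval crossing the left child from the left would cross the parent as well; one crossing
it at its right end would cross the parent or reach across the split. The right child is symmetric.
-/
theorem IsValidFor.uncrossed_left {a b : ℕ} (hab : a + 2 ≤ b) (h : F.Uncrossed a b) :
    F.Uncrossed a (F.splitAt a b) := by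
  have hs := splitAt_bounds (F := F) hab
  rintro ⟨x, y⟩ hx
  have hxy := h _ hx
  simp only at hxy ⊢
  refine ⟨by omega, fun hcon => ?_⟩
  rcases hV.not_across_split hab hx hcon.1.le (by omega)
    (fun e => by simp only [Prod.mk.injEq] at e; omega) with h | h <;> omega

theorem IsValidFor.uncrossed_right {a b : ℕ} (hab : a + 2 ≤ b) (h : F.Uncrossed a b) :
    F.Uncrossed (F.splitAt a b) b := by
  have hs := splitAt_bounds (F := F) hab
  rintro ⟨x, y⟩ hx
  have hxy := h _ hx
  simp only at hxy ⊢
  refine ⟨fun hcon => ?_, by omega⟩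
  rcases hV.not_across_split hab hx (by omega) (by omega)
    (fun e => by simp only [Prod.mk.injEq] at e; omega) with h | h <;> omega

theorem IsValidFor.uncrossed_root : F.Uncrossed 0 F.count := by
  rintro ⟨x, y⟩ hx
  have := hV.interval_bounds hx
  simp only at this ⊢
  omega

theorem IsValidFor.uncrossed_of_mem {a b : ℕ} (h : F.Uncrossed a b) {x : ℕ × ℕ}
    (hx : x ∈ F.treeNodes a b) : F.Uncrossed x.1 x.2 := by
  induction hn : b - a using Nat.strong_induction_on generalizing a b with
  | _ n ih =>
    by_cases hab : a + 2 ≤ b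
    · have hs := splitAt_bounds (F := F) hab
      rw [treeNodes_of_le hab, Finset.mem_insert, Finset.mem_union] at hx
      rcases hx with rfl | hx | hx
      · exact h
      · exact ih _ (by omega) (hV.uncrossed_left hab h) hx rfl
      · exact ih _ (by omega) (hV.uncrossed_right hab h) hx rfl
    · rw [treeNodes_of_not_le hab] at hx; simp at hx

/-- A left child is not a type-B factor. -/
theorem IsValidFor.left_not_isB {a b : ℕ} (hab : a + 2 ≤ b) (hb : b ≤ F.count)
    (h : F.Uncrossed a b) (hs : F.splitAt a b = a + 1) : ¬ F.IsB a := by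
  rintro ⟨i, j, hkind⟩
  obtain ⟨h1, h2, -, h3, -⟩ := hV.typeB_bounds (by omega) hkind
  -- The reference ends at `a`, so the interval joining it with the factor is `[i..a+1)` with `i <
  -- a`, and it crosses `[a..b)`.
  have := (h _ h3).1
  simp only at this
  omega

/-- The left sibling of a type-B factor is what it refers to. -/
theorem IsValidFor.right_isB {a b k i j : ℕ} (hab : a + 2 ≤ b) (hb : b ≤ F.count)
    (h : F.Uncrossed a b) (hk : b = k + 1) (hs : F.splitAt a b = k) (hkind : F.kind k = .typeB i j) :
    i = a := by
  subst hk
  obtain ⟨h1, h2, h3, h4, -⟩ := hV.typeB_bounds (by omega) hkind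
  have hsb := splitAt_bounds (F := F) hab
  -- If `i < a`, the reference `[i..k)` crosses the node. If `a < i`, the joined interval `[i..k+1)`
  -- reaches across the split at `k`.
  have := (h _ h3).1
  simp only at this
  by_contra hne
  rcases hV.not_across_split hab h4 (by omega) le_rfl
    (fun e => by simp only [Prod.mk.injEq] at e; omega) with h | h <;> omega

end Valid

/-! ### The nonterminals of a categorized factorization -/

variable (F T)

/-- The first factor that consists of the same single symbol as the `k`-th one. -/
noncomputable def firstSingle (k : ℕ) : ℕ :=
  sInf {k' | F.kind k' = .single ∧ F.str T (k', k' + 1) = F.str T (k, k + 1)}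

/-- The nonterminal of the `k`-th leaf. -/
noncomputable def leafNT (k : ℕ) : ℕ × ℕ :=
  match F.kind k with
  | .single => (F.firstSingle T k, F.firstSingle T k + 1)
  | .typeA i j => if _h : j < k then (if i = j then leafNT j else (i, j + 1)) else (k, k + 1)
  | _ => (k, k + 1)
termination_by k

/-- The nonterminal of the node that covers the factors `a, …, b - 1`. -/
noncomputable def nodeNT (a b : ℕ) : ℕ × ℕ := if b = a + 1 then F.leafNT T a else (a, b)

open Classical in
/-- All nonterminals: the inner nodes, the type-C factors, and a factor for each symbol. -/
noncomputable def nonterminals : Finset (ℕ × ℕ) :=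
  F.treeNodes 0 F.count ∪
    (((Finset.range F.count).filter fun k => ∃ i j, F.kind k = .typeC i j).image
      fun k => (k, k + 1)) ∪
    ((Finset.range F.count).filter fun k => F.kind k = .single ∧ F.firstSingle T k = k).image
      fun k => (k, k + 1)

variable {F T}

theorem nodeNT_leaf (k : ℕ) : F.nodeNT T k (k + 1) = F.leafNT T k := by
  simp [nodeNT]

theorem nodeNT_of_le {a b : ℕ} (h : a + 2 ≤ b) : F.nodeNT T a b = (a, b) := by
  rw [nodeNT, if_neg (by omega)]

theorem leafNT_single {k : ℕ} (h : F.kind k = .single) :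
    F.leafNT T k = (F.firstSingle T k, F.firstSingle T k + 1) := by
  rw [leafNT, h]

theorem leafNT_typeC {k i j : ℕ} (h : F.kind k = .typeC i j) : F.leafNT T k = (k, k + 1) := by
  rw [leafNT, h]

/-- A type-A factor shares the nonterminal of what it refers to; references to a single factor are
followed further to the left. The test `j < k` in `leafNT` only ensures termination. -/
theorem leafNT_typeA {k i j : ℕ} (h : F.kind k = .typeA i j) (hjk : j < k) (hij : i ≤ j) :
    F.leafNT T k = F.nodeNT T i (j + 1) := by
  rw [leafNT, h]
  simp only [dif_pos hjk]
  split_ifs with e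
  · subst e; rw [nodeNT_leaf]
  · rw [nodeNT_of_le (by omega)]

theorem firstSingle_spec {k : ℕ} (h : F.kind k = .single) : F.kind (F.firstSingle T k) = .single ∧
    F.str T (F.firstSingle T k, F.firstSingle T k + 1) = F.str T (k, k + 1) :=
  Nat.sInf_mem (s := {k' | F.kind k' = .single ∧ F.str T (k', k' + 1) = F.str T (k, k + 1)})
    ⟨k, h, rfl⟩

theorem firstSingle_le {k : ℕ} (h : F.kind k = .single) : F.firstSingle T k ≤ k :=
  Nat.sInf_le ⟨h, rfl⟩

theorem firstSingle_congr {k k' : ℕ} (h : F.str T (k, k + 1) = F.str T (k', k' + 1)) :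
    F.firstSingle T k = F.firstSingle T k' := by
  rw [firstSingle, firstSingle, h]

theorem firstSingle_idem {k : ℕ} (h : F.kind k = .single) :
    F.firstSingle T (F.firstSingle T k) = F.firstSingle T k :=
  firstSingle_congr (firstSingle_spec h).2

theorem treeNodes_subset_nonterminals : F.treeNodes 0 F.count ⊆ F.nonterminals T :=
  Finset.subset_union_left.trans Finset.subset_union_left

theorem typeC_mem_nonterminals {k i j : ℕ} (hk : k < F.count) (h : F.kind k = .typeC i j) :
    (k, k + 1) ∈ F.nonterminals T := by
  classical
  refine Finset.mem_union_left _ (Finset.mem_union_right _ (Finset.mem_image_of_mem _ ?_))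
  simp [hk, h]

theorem single_mem_nonterminals {k : ℕ} (hk : k < F.count) (h : F.kind k = .single)
    (hf : F.firstSingle T k = k) : (k, k + 1) ∈ F.nonterminals T := by
  classical
  refine Finset.mem_union_right _ (Finset.mem_image_of_mem (fun k => (k, k + 1)) ?_)
  simp [hk, h, hf]

theorem mem_nonterminals {x : ℕ × ℕ} (hx : x ∈ F.nonterminals T) : x ∈ F.treeNodes 0 F.count ∨
    (∃ k < F.count, x = (k, k + 1) ∧ ∃ i j, F.kind k = .typeC i j) ∨
    ∃ k < F.count, x = (k, k + 1) ∧ F.kind k = .single ∧ F.firstSingle T k = k := by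
  classical
  simp only [nonterminals, Finset.mem_union, Finset.mem_image, Finset.mem_filter,
    Finset.mem_range] at hx
  rcases hx with (hx | ⟨k, ⟨hk, h⟩, rfl⟩) | ⟨k, ⟨hk, h⟩, rfl⟩
  · exact Or.inl hx
  · exact Or.inr (Or.inl ⟨k, hk, rfl, h⟩)
  · exact Or.inr (Or.inr ⟨k, hk, rfl, h⟩)

section Valid

variable (hV : F.IsValidFor T)

include hV

theorem IsValidFor.str_append {a b c : ℕ} (hab : a ≤ b) (hbc : b ≤ c) (hc : c ≤ F.count) :
    F.str T (a, c) = F.str T (a, b) ++ F.str T (b, c) := by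
  have h1 := (pos_le_iff hV.1.2.2 (a := a) (b := b) (by omega) (by omega)).2 hab
  have h2 := (pos_le_iff hV.1.2.2 (a := b) (b := c) (by omega) (by omega)).2 hbc
  simp only [str]
  have e1 : F.pos c - F.pos a = (F.pos b - F.pos a) + (F.pos c - F.pos b) := by omega
  have e2 : F.pos a + (F.pos b - F.pos a) = F.pos b := by omega
  rw [e1, substr_add, e2]

theorem IsValidFor.length_str {a b : ℕ} (hab : a ≤ b) (hb : b ≤ F.count) :
    (F.str T (a, b)).length = F.pos b - F.pos a := by
  have h1 := (pos_le_iff hV.1.2.2 (a := a) (b := b) (by omega) (by omega)).2 hab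
  have := hV.1.pos_le hb
  exact length_substr T (by simp only; omega)

theorem IsValidFor.str_root : F.str T (0, F.count) = T := by
  simp only [str, hV.1.1, hV.1.2.1, Nat.sub_zero]
  exact substr_zero_length T

/-- Chains of type-A references move left and never end in a type-B factor, because no interval of I
is just a type-B factor. For type-B factors the value `(k, k + 1)` is a dummy that is no
nonterminal. -/
theorem IsValidFor.leafNT_mem {k : ℕ} (hk : k < F.count) (hB : ¬ F.IsB k) :
    F.leafNT T k ∈ F.nonterminals T := by
  induction k using Nat.strong_induction_on with
  | _ k ih =>
    cases hkind : F.kind k with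
    | single =>
      rw [leafNT_single hkind]
      exact single_mem_nonterminals ((firstSingle_le hkind).trans_lt hk) (firstSingle_spec hkind).1
        (firstSingle_idem hkind)
    | typeA i j =>
      obtain ⟨h1, h2, h3, -⟩ := hV.typeA_bounds hk hkind
      rw [leafNT_typeA hkind h2 h1]
      rcases h1.eq_or_lt with rfl | h1
      · rw [nodeNT_leaf]
        exact ih i h2 (by omega) (hV.not_isB_of_interval h3)
      · rw [nodeNT_of_le (by omega)]
        exact treeNodes_subset_nonterminals
          (hV.interval_mem_treeNodes h3 (Nat.zero_le _) (by omega) (by omega))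
    | typeB i j => exact absurd ⟨i, j, hkind⟩ hB
    | typeC i j => rw [leafNT_typeC hkind]; exact typeC_mem_nonterminals hk hkind

theorem IsValidFor.nodeNT_interval_mem {x y : ℕ} (hx : (x, y) ∈ F.intervals) :
    F.nodeNT T x y ∈ F.nonterminals T := by
  have hb := hV.interval_bounds hx
  simp only at hb
  by_cases h : y = x + 1
  · subst h
    rw [nodeNT_leaf]
    exact hV.leafNT_mem (by omega) (hV.not_isB_of_interval hx)
  · rw [nodeNT_of_le (by omega)]
    exact treeNodes_subset_nonterminals
      (hV.interval_mem_treeNodes hx (Nat.zero_le _) (by omega) (by omega))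

theorem IsValidFor.str_leafNT {k : ℕ} (hk : k < F.count) :
    F.str T (F.leafNT T k) = F.str T (k, k + 1) := by
  induction k using Nat.strong_induction_on with
  | _ k ih =>
    cases hkind : F.kind k with
    | single => rw [leafNT_single hkind]; exact (firstSingle_spec hkind).2
    | typeA i j =>
      obtain ⟨h1, h2, h3, h4⟩ := hV.typeA_bounds hk hkind
      rw [leafNT_typeA hkind h2 h1, h4]
      rcases h1.eq_or_lt with rfl | h1
      · rw [nodeNT_leaf]
        exact ih i h2 (by omega)
      · rw [nodeNT_of_le (by omega)]
    | typeB i j => rw [leafNT, hkind]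
    | typeC i j => rw [leafNT_typeC hkind]

theorem IsValidFor.str_nodeNT {a b : ℕ} (hab : a < b) (hb : b ≤ F.count) :
    F.str T (F.nodeNT T a b) = F.str T (a, b) := by
  by_cases h : b = a + 1
  · subst h; rw [nodeNT_leaf]; exact hV.str_leafNT (by omega)
  · rw [nodeNT_of_le (by omega)]

/-- There are at most `h - 1` inner nodes, one nonterminal for each type-C factor, and one for the
first single factor with a given symbol. -/
theorem IsValidFor.card_nonterminals_le [DecidableEq α] (hT : T ≠ []) :
    (F.nonterminals T).card + 1 ≤ F.count + F.numC + T.dedup.length := by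
  classical
  have h0 : 0 < F.count := by
    rcases Nat.eq_zero_or_pos F.count with h | h
    · have h1 := hV.1.2.1
      rw [h, hV.1.1] at h1
      exact absurd (List.length_eq_zero_iff.1 h1.symm) hT
    · exact h
  have h1 := card_treeNodes_le (F := F) 0 F.count
  have h2 : (((Finset.range F.count).filter fun k => ∃ i j, F.kind k = .typeC i j).image
      fun k => (k, k + 1)).card ≤ F.numC := by
    refine Finset.card_image_le.trans ?_
    rw [numC, ← Set.ncard_coe_finset]
    refine Set.ncard_le_ncard ?_ ((Set.finite_lt_nat F.count).subset fun k hk => hk.1)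
    intro k hk
    simpa using hk
  have h3 : (((Finset.range F.count).filter
      fun k => F.kind k = .single ∧ F.firstSingle T k = k).image
      fun k => (k, k + 1)).card ≤ T.dedup.length := by
    refine Finset.card_image_le.trans ?_
    have e : T.dedup.length = (T.toFinset.image fun a => [a]).card := by
      rw [Finset.card_image_of_injective _ (fun a b h => by simpa using h), List.card_toFinset]
    rw [e]
    -- A first single factor is determined by its one-letter string, so these factors inject into
    -- the symbols of `T`.
    refine Finset.card_le_card_of_injOn (fun k => F.str T (k, k + 1)) ?_ ?_
    · intro k hk
      simp only [Finset.coe_filter, Finset.mem_range, Set.mem_ofPred_eq] at hk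
      have hK := hV.feasKind hk.1
      simp only [FeasKind, hk.2.1] at hK
      have hlt : F.pos k < T.length := by
        have := hV.1.pos_le (k := k + 1) hk.1
        omega
      simp only [str, hK, Nat.add_sub_cancel_left, substr_one T hlt, Finset.coe_image,
        Set.mem_image]
      exact ⟨_, by simp, rfl⟩
    · intro k hk k' hk' h
      simp only [Finset.coe_filter, Finset.mem_range, Set.mem_ofPred_eq] at hk hk'
      rw [← hk.2.2, ← hk'.2.2]
      exact firstSingle_congr h
  have h4 : (F.nonterminals T).card ≤ _ := (Finset.card_union_le _ _).trans
    (Nat.add_le_add_right (Finset.card_union_le _ _) _)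
  omega

end Valid

/-! ### An order of the nonterminals -/

variable (F) in
/-- The weight of a set of factors with reference depths `D`. -/
def weight (D : ℕ → ℕ) (x : ℕ × ℕ) : ℕ := ∑ k ∈ Finset.Ico x.1 x.2, (F.count + 1) ^ D k

theorem weight_single (D : ℕ → ℕ) (k : ℕ) : F.weight D (k, k + 1) = (F.count + 1) ^ D k := by
  simp [weight]

theorem weight_pos (D : ℕ → ℕ) {a b : ℕ} (hab : a < b) : 0 < F.weight D (a, b) :=
  Finset.sum_pos (fun _ _ => by positivity) (by simpa using hab)

theorem weight_add (D : ℕ → ℕ) {a b c : ℕ} (hab : a ≤ b) (hbc : b ≤ c) :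
    F.weight D (a, c) = F.weight D (a, b) + F.weight D (b, c) :=
  (Finset.sum_Ico_consecutive _ hab hbc).symm

/-- There are at most `h` summands, each at most `(h + 1) ^ (d - 1)`. The base `h + 1` makes one
factor of larger depth outweigh any set of factors of smaller depth. -/
theorem weight_lt {D : ℕ → ℕ} {a b d : ℕ} (hab : a < b) (hb : b ≤ F.count)
    (h : ∀ t, a ≤ t → t < b → D t < d) : F.weight D (a, b) < (F.count + 1) ^ d := by
  obtain ⟨d, rfl⟩ := Nat.exists_eq_succ_of_ne_zero (n := d) (by have := h a le_rfl hab; omega)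
  have h1 : F.weight D (a, b) ≤ (Finset.Ico a b).card • (F.count + 1) ^ d :=
    Finset.sum_le_card_nsmul _ _ _ fun k hk => by
      rw [Finset.mem_Ico] at hk
      exact Nat.pow_le_pow_right (by omega) (by have := h k hk.1 hk.2; omega)
  rw [Nat.card_Ico, smul_eq_mul] at h1
  refine h1.trans_lt ?_
  rw [Nat.pow_succ, mul_comm]
  exact Nat.mul_lt_mul_of_pos_left (by omega) (by positivity)

section Valid

variable (hV : F.IsValidFor T) {D : ℕ → ℕ} (hD : ∀ k < F.count, (F.kind k = .single → D k = 0) ∧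
  ∀ a b, F.RefInterval k a b → ∀ t, a ≤ t → t < b → D t < D k)

include hV hD

/-- Replacing a leaf by its nonterminal does not increase the weight: single symbols all have depth
0, and a type-A factor outweighs its reference. -/
theorem IsValidFor.weight_leafNT_le {k : ℕ} (hk : k < F.count) :
    F.weight D (F.leafNT T k) ≤ F.weight D (k, k + 1) := by
  induction k using Nat.strong_induction_on with
  | _ k ih =>
    cases hkind : F.kind k with
    | single =>
      rw [leafNT_single hkind, weight_single, weight_single, (hD k hk).1 hkind,
        (hD _ ((firstSingle_le hkind).trans_lt hk)).1 (firstSingle_spec hkind).1]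
    | typeA i j =>
      obtain ⟨h1, h2, h3, h4⟩ := hV.typeA_bounds hk hkind
      have hlt : F.weight D (i, j + 1) ≤ F.weight D (k, k + 1) := by
        rw [weight_single]
        exact (weight_lt (by omega) (by omega)
          ((hD k hk).2 _ _ ⟨i, j, Or.inl hkind, rfl, rfl⟩)).le
      rw [leafNT_typeA hkind h2 h1]
      rcases h1.eq_or_lt with rfl | h1
      · rw [nodeNT_leaf]
        exact (ih i h2 (by omega)).trans hlt
      · rwa [nodeNT_of_le (by omega)]
    | typeB i j => rw [leafNT, hkind]
    | typeC i j => rw [leafNT_typeC hkind]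

theorem IsValidFor.weight_nodeNT_le {a b : ℕ} (hab : a < b) (hb : b ≤ F.count) :
    F.weight D (F.nodeNT T a b) ≤ F.weight D (a, b) := by
  by_cases h : b = a + 1
  · subst h; rw [nodeNT_leaf]; exact hV.weight_leafNT_le hD (by omega)
  · rw [nodeNT_of_le (by omega)]

end Valid

/-! ### The rules of a categorized factorization -/

variable (F T)

/-- The rules of the nonterminals. -/
inductive HasRule : ℕ × ℕ → CollageRule α (ℕ × ℕ) → Prop
  | atom {k a} (hk : k < F.count) (hkind : F.kind k = .single) (hf : F.firstSingle T k = k)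
      (hs : F.str T (k, k + 1) = [a]) : HasRule (k, k + 1) (.atom a)
  | trunc {k i j b e} (hk : k < F.count) (hkind : F.kind k = .typeC i j) (hbe : b < e)
      (he : e ≤ (F.str T (i, j + 1)).length)
      (hs : F.str T (k, k + 1) = substr (F.str T (i, j + 1)) b (e - b)) :
      HasRule (k, k + 1) (.trunc (F.nodeNT T i (j + 1)) b e)
  | rep {a k j r} (hak : (a, k + 1) ∈ F.treeNodes 0 F.count) (hsp : F.splitAt a (k + 1) = k)
      (hkind : F.kind k = .typeB a j) (hr : 3 ≤ r)
      (hs : F.str T (k, k + 1) = strPow (F.str T (a, k)) (r - 1)) :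
      HasRule (a, k + 1) (.rep (F.nodeNT T a k) r)
  | concat {a b} (hab : (a, b) ∈ F.treeNodes 0 F.count)
      (hB : ¬ (b = F.splitAt a b + 1 ∧ F.IsB (F.splitAt a b))) :
      HasRule (a, b) (.concat (F.nodeNT T a (F.splitAt a b)) (F.nodeNT T (F.splitAt a b) b))

variable {F T}

/-- A node whose right child is a type-B factor can have a repetition rule because, by `right_isB`,
its left child is exactly the base of the repeat. -/
theorem IsValidFor.exists_rule (hV : F.IsValidFor T) {x : ℕ × ℕ} (hx : x ∈ F.nonterminals T) :
    ∃ ρ, F.HasRule T x ρ := by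
  rcases mem_nonterminals hx with hx | ⟨k, hk, rfl, i, j, hkind⟩ | ⟨k, hk, rfl, hkind, hf⟩
  · obtain ⟨a, b⟩ := x
    have hb := treeNodes_bounds hx
    simp only at hb
    by_cases h : b = F.splitAt a b + 1 ∧ F.IsB (F.splitAt a b)
    · obtain ⟨h1, i, j, hkind⟩ := h
      obtain ⟨k, hk⟩ : ∃ k, k = F.splitAt a b := ⟨_, rfl⟩
      rw [← hk] at h1 hkind
      subst h1
      have e := hV.right_isB hb.2.1 hb.2.2 (hV.uncrossed_of_mem hV.uncrossed_root hx) rfl hk.symm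
        hkind
      subst e
      obtain ⟨_, _, _, _, r, hr, hs⟩ := hV.typeB_bounds (by omega) hkind
      exact ⟨_, .rep hx hk.symm hkind hr hs⟩
    · exact ⟨_, .concat hx h⟩
  · obtain ⟨h1, h2, h3, h4⟩ := hV.typeC_bounds hk hkind
    obtain ⟨b, hb, hs⟩ := exists_substr_of_infix h4
    have hlen := hV.length_str (a := k) (b := k + 1) (by omega) (by omega)
    have := hV.1.2.2 k hk
    exact ⟨_, .trunc hk hkind (b := b) (e := b + (F.str T (k, k + 1)).length) (by omega) hb
      (by rw [Nat.add_sub_cancel_left, hs])⟩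
  · have hlen := hV.length_str (a := k) (b := k + 1) (by omega) (by omega)
    have hK := hV.feasKind hk
    simp only [FeasKind, hkind] at hK
    obtain ⟨a, ha⟩ := List.length_eq_one_iff.1 (show (F.str T (k, k + 1)).length = 1 by omega)
    exact ⟨_, .atom hk hkind hf ha⟩

/-- The only child without a nonterminal is a type-B factor on the right, which the repetition rule
absorbs into its exponent. -/
theorem IsValidFor.nodeNT_child_mem (hV : F.IsValidFor T) {a b : ℕ}
    (hab : (a, b) ∈ F.treeNodes 0 F.count) : F.nodeNT T a (F.splitAt a b) ∈ F.nonterminals T ∧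
      (¬ (b = F.splitAt a b + 1 ∧ F.IsB (F.splitAt a b)) →
        F.nodeNT T (F.splitAt a b) b ∈ F.nonterminals T) := by
  have hb := treeNodes_bounds hab
  simp only at hb
  have hs := splitAt_bounds (F := F) hb.2.1
  have hsub := (treeNodes_subset hab).trans (treeNodes_subset_nonterminals (T := T))
  simp only [treeNodes_of_le hb.2.1] at hsub
  constructor
  · by_cases h : F.splitAt a b = a + 1
    · rw [h, nodeNT_leaf]
      exact hV.leafNT_mem (by omega) (hV.left_not_isB hb.2.1 hb.2.2
        (hV.uncrossed_of_mem hV.uncrossed_root hab) h)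
    · rw [nodeNT_of_le (by omega)]
      exact hsub (Finset.mem_insert_of_mem (Finset.mem_union_left _
        (self_mem_treeNodes (by omega))))
  · intro hB
    by_cases h : b = F.splitAt a b + 1
    · have e : F.nodeNT T (F.splitAt a b) b = F.leafNT T (F.splitAt a b) := by
        rw [nodeNT, if_pos h]
      rw [e]
      exact hV.leafNT_mem (by omega) fun h' => hB ⟨h, h'⟩
    · rw [nodeNT_of_le (by omega)]
      exact hsub (Finset.mem_insert_of_mem (Finset.mem_union_right _
        (self_mem_treeNodes (by omega))))

/-- Children of an inner node carry a proper part of its weight, and a truncated factor has larger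
depth than everything in its reference. Sorting by weight therefore gives an admissible numbering of
the nonterminals. -/
theorem IsValidFor.refers_lt (hV : F.IsValidFor T) {D : ℕ → ℕ}
    (hD : ∀ k < F.count, (F.kind k = .single → D k = 0) ∧
      ∀ a b, F.RefInterval k a b → ∀ t, a ≤ t → t < b → D t < D k)
    {x y : ℕ × ℕ} {ρ : CollageRule α (ℕ × ℕ)} (hρ : F.HasRule T x ρ) (hy : ρ.Refers y) :
    y ∈ F.nonterminals T ∧ F.weight D y < F.weight D x := by
  cases hρ with
  | atom hk hkind hf hs => exact hy.elim
  | @trunc k i j b e hk hkind hbe he hs =>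
    simp only [CollageRule.Refers] at hy
    subst hy
    obtain ⟨h1, h2, h3, h4⟩ := hV.typeC_bounds hk hkind
    refine ⟨hV.nodeNT_interval_mem h3, ?_⟩
    refine (hV.weight_nodeNT_le hD (by omega) (by omega)).trans_lt ?_
    rw [weight_single]
    exact weight_lt (by omega) (by omega)
      ((hD k hk).2 _ _ ⟨i, j, Or.inr (Or.inr hkind), rfl, rfl⟩)
  | @rep a k j r hak hsp hkind hr hs =>
    simp only [CollageRule.Refers] at hy
    subst hy
    have hb := treeNodes_bounds hak
    simp only at hb
    have hmem := (hV.nodeNT_child_mem hak).1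
    rw [hsp] at hmem
    refine ⟨hmem, (hV.weight_nodeNT_le hD (by omega) (by omega)).trans_lt ?_⟩
    rw [weight_add D (a := a) (b := k) (c := k + 1) (by omega) (by omega)]
    have := weight_pos (F := F) D (a := k) (b := k + 1) (by omega)
    omega
  | @concat a b hab hB =>
    have hb := treeNodes_bounds hab
    simp only at hb
    have hs := splitAt_bounds (F := F) hb.2.1
    have hmem := hV.nodeNT_child_mem hab
    have h1 := weight_pos (F := F) D hs.1
    have h2 := weight_pos (F := F) D hs.2
    rw [weight_add D hs.1.le hs.2.le]
    rcases hy with rfl | rfl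
    · have := hV.weight_nodeNT_le hD hs.1 (by omega)
      exact ⟨hmem.1, by omega⟩
    · have := hV.weight_nodeNT_le hD hs.2 (by omega)
      exact ⟨hmem.2 hB, by omega⟩

end CatFactorization

/-! ### Systems with numbered nonterminals -/

/-- Rename the nonterminals in a rule. -/
def CollageRule.mapNT {α N M : Type*} (f : N → M) : CollageRule α N → CollageRule α M
  | .atom a => .atom a
  | .concat Y Z => .concat (f Y) (f Z)
  | .rep Y r => .rep (f Y) r
  | .trunc Y b e => .trunc (f Y) b e

theorem CollageRule.refers_mapNT {α N M : Type*} {f : N → M} {ρ : CollageRule α N} {w : M}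
    (h : (ρ.mapNT f).Refers w) : ∃ y, ρ.Refers y ∧ f y = w := by
  cases ρ with
  | atom a => exact h.elim
  | concat Y Z =>
    rcases h with rfl | rfl
    · exact ⟨Y, Or.inl rfl, rfl⟩
    · exact ⟨Z, Or.inr rfl, rfl⟩
  | rep Y r => exact ⟨Y, rfl, h.symm⟩
  | trunc Y b e => exact ⟨Y, rfl, h.symm⟩

/-- The elements of a finite type can be numbered such that the numbers respect a given weight. -/
theorem exists_numbering {ι : Type*} [Fintype ι] (w : ι → ℕ) :
    ∃ e : ι ≃ Fin (Fintype.card ι), ∀ x y, w x < w y → e x < e y := by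
  let e₀ := Fintype.equivFin ι
  let σ := Tuple.sort (w ∘ e₀.symm)
  have hmono : Monotone ((w ∘ e₀.symm) ∘ σ) := Tuple.monotone_sort _
  refine ⟨e₀.trans σ.symm, fun x y hxy => ?_⟩
  by_contra hcon
  have := hmono (not_lt.1 hcon)
  simp at this
  omega

/-- A set of rules whose references decrease a weight gives a system. -/
theorem exists_ruleSystem {α ι : Type*} (N : Finset ι) (ρ : ι → CollageRule α ι) (w : ι → ℕ) {s : ι}
    (hs : s ∈ N) (h : ∀ x ∈ N, ∀ y, (ρ x).Refers y → y ∈ N ∧ w y < w x) :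
    ∃ (G : RuleSystem α) (nt : ι → Fin G.size), G.size = N.card ∧ G.start = nt s ∧
      Set.InjOn nt N ∧ (∀ X, ∃ x ∈ N, nt x = X) ∧ ∀ x ∈ N, G.rule (nt x) = (ρ x).mapNT nt := by
  classical
  obtain ⟨e, he⟩ := exists_numbering fun x : N => w x
  let nt : ι → Fin (Fintype.card N) := fun x => if hx : x ∈ N then e ⟨x, hx⟩ else e ⟨s, hs⟩
  have hnt : ∀ x (hx : x ∈ N), nt x = e ⟨x, hx⟩ := fun x hx => dif_pos hx
  refine ⟨⟨Fintype.card N, nt s, fun X => (ρ (e.symm X).1).mapNT nt, ?_⟩, nt,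
    Fintype.card_coe N, rfl, ?_, ?_, ?_⟩
  · intro X Y hXY
    obtain ⟨y, hy, rfl⟩ := CollageRule.refers_mapNT hXY
    obtain ⟨hyN, hlt⟩ := h _ (e.symm X).2 y hy
    have := he ⟨y, hyN⟩ (e.symm X) hlt
    rwa [Equiv.apply_symm_apply, ← hnt] at this
  · intro x hx y hy hxy
    rw [hnt x hx, hnt y hy] at hxy
    exact congrArg Subtype.val (e.injective hxy)
  · intro X
    exact ⟨_, (e.symm X).2, by rw [hnt _ (e.symm X).2]; simp⟩
  · intro x hx
    simp only [hnt x hx, Equiv.symm_apply_apply]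

/-! ### The internal collage system of a categorized factorization -/

namespace CatFactorization

open RuleSystem

variable {α : Type*} {F : CatFactorization} {T : List α}

/-- `G` is a system with the nonterminals and rules of the factorization. -/
structure IsSystemOf (F : CatFactorization) (T : List α) (G : RuleSystem α)
    (nt : ℕ × ℕ → Fin G.size) : Prop where
  size_eq : G.size = (F.nonterminals T).card
  start_eq : G.start = nt (F.nodeNT T 0 F.count)
  inj : Set.InjOn nt (F.nonterminals T)
  surj : ∀ X, ∃ x ∈ F.nonterminals T, nt x = X
  rule : ∀ x ∈ F.nonterminals T, ∃ ρ, F.HasRule T x ρ ∧ G.rule (nt x) = ρ.mapNT nt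

theorem IsValidFor.count_pos (hV : F.IsValidFor T) (hT : T ≠ []) : 0 < F.count := by
  rcases Nat.eq_zero_or_pos F.count with h | h
  · have h1 := hV.1.2.1
    rw [h, hV.1.1] at h1
    exact absurd (List.length_eq_zero_iff.1 h1.symm) hT
  · exact h

theorem IsValidFor.not_isB_zero (hV : F.IsValidFor T) (h0 : 0 < F.count) : ¬ F.IsB 0 := by
  rintro ⟨i, j, hkind⟩
  have := hV.typeB_bounds h0 hkind
  omega

theorem IsValidFor.nodeNT_root_mem (hV : F.IsValidFor T) (hT : T ≠ []) :
    F.nodeNT T 0 F.count ∈ F.nonterminals T := by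
  have h0 := hV.count_pos hT
  by_cases h : F.count = 0 + 1
  · have e : F.nodeNT T 0 F.count = F.leafNT T 0 := by rw [nodeNT, if_pos h]
    rw [e]
    exact hV.leafNT_mem h0 (hV.not_isB_zero h0)
  · rw [nodeNT_of_le (by omega)]
    exact treeNodes_subset_nonterminals (self_mem_treeNodes (by omega))

theorem IsValidFor.exists_isSystemOf (hV : F.IsValidFor T) (hT : T ≠ []) :
    ∃ (G : RuleSystem α) (nt : ℕ × ℕ → Fin G.size), F.IsSystemOf T G nt := by
  obtain ⟨D, hD⟩ := hV.2.2.2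
  have hex : ∀ x, ∃ ρ, x ∈ F.nonterminals T → F.HasRule T x ρ := by
    intro x
    by_cases hx : x ∈ F.nonterminals T
    · obtain ⟨ρ, hρ⟩ := hV.exists_rule hx
      exact ⟨ρ, fun _ => hρ⟩
    -- An arbitrary rule outside the set of nonterminals.
    · exact ⟨.rep x 0, fun h => absurd h hx⟩
  choose ρ hρ using hex
  obtain ⟨G, nt, h1, h2, h3, h4, h5⟩ := exists_ruleSystem (F.nonterminals T) ρ (F.weight D)
    (hV.nodeNT_root_mem hT) fun x hx y hy => hV.refers_lt hD (hρ x hx) hy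
  exact ⟨G, nt, h1, h2, h3, h4, fun x hx => ⟨ρ x, hρ x hx, h5 x hx⟩⟩

section System

variable {G : RuleSystem α} {nt : ℕ × ℕ → Fin G.size} (hV : F.IsValidFor T)
  (hG : F.IsSystemOf T G nt)

include hV hG

theorem IsSystemOf.expand_eq {x : ℕ × ℕ} (hx : x ∈ F.nonterminals T) :
    G.expand (nt x) = F.str T x := by
  obtain ⟨D, hD⟩ := hV.2.2.2
  -- References decrease the weight, so the strings can be computed in order of weight.
  induction hn : F.weight D x using Nat.strong_induction_on generalizing x with
  | _ n ih =>
    obtain ⟨ρ, hρ, hr⟩ := hG.rule x hx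
    have ih' : ∀ y, ρ.Refers y → G.expand (nt y) = F.str T y := by
      intro y hy
      have := hV.refers_lt hD hρ hy
      exact ih _ (hn ▸ this.2) this.1 rfl
    cases hρ with
    | atom hk hkind hf hs => rw [expand_atom hr, hs]
    | @trunc k i j b e hk hkind hbe he hs =>
      obtain ⟨h1, h2, -⟩ := hV.typeC_bounds hk hkind
      rw [expand_trunc hr, ih' _ rfl, hV.str_nodeNT (by omega) (by omega), hs]
    | @rep a k j r hak hsp hkind hr3 hs =>
      have hb := treeNodes_bounds hak
      simp only at hb
      obtain ⟨r, rfl⟩ : ∃ m, r = m + 1 := ⟨r - 1, by omega⟩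
      rw [expand_rep hr, ih' _ rfl, hV.str_nodeNT (by omega) (by omega), strPow_succ,
        hV.str_append (a := a) (b := k) (c := k + 1) (by omega) (by omega) (by omega), hs, Nat.add_sub_cancel]
    | @concat a b hab hB =>
      have hb := treeNodes_bounds hab
      simp only at hb
      have hs := splitAt_bounds (F := F) hb.2.1
      rw [expand_concat hr, ih' _ (Or.inl rfl), ih' _ (Or.inr rfl),
        hV.str_nodeNT (by omega) (by omega), hV.str_nodeNT (by omega) (by omega),
        ← hV.str_append hs.1.le hs.2.le hb.2.2]

theorem IsSystemOf.expand_nodeNT_interval {i j : ℕ} (hij : (i, j) ∈ F.intervals) :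
    G.expand (nt (F.nodeNT T i j)) = F.str T (i, j) := by
  have hb := hV.interval_bounds hij
  rw [hG.expand_eq hV (hV.nodeNT_interval_mem hij), hV.str_nodeNT hb.1 hb.2]

theorem IsSystemOf.ruleOK (X : Fin G.size) : G.RuleOK X := by
  obtain ⟨x, hx, rfl⟩ := hG.surj X
  obtain ⟨ρ, hρ, hr⟩ := hG.rule x hx
  cases hρ with
  | atom hk hkind hf hs => simp only [CollageRule.mapNT] at hr; simp only [RuleOK, hr]
  | trunc hk hkind hbe he hs =>
    simp only [CollageRule.mapNT] at hr
    simp only [RuleOK, hr]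
    rw [hG.expand_nodeNT_interval hV (hV.typeC_bounds hk hkind).2.2.1]
    exact ⟨hbe, he⟩
  | rep hak hsp hkind hr3 hs =>
    simp only [CollageRule.mapNT] at hr; simp only [RuleOK, hr]; omega
  | concat hab hB => simp only [CollageRule.mapNT] at hr; simp only [RuleOK, hr]

omit hV hG in
/-- What the leaf of the `k`-th factor should look like. -/
def LeafSpec (F : CatFactorization) (T : List α) (G : RuleSystem α) (nt : ℕ × ℕ → Fin G.size)
    (k : ℕ) (l : NodeLabel α (Fin G.size)) : Prop :=
  G.labelString l = F.str T (k, k + 1) ∧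
  match F.kind k with
  | .single => True
  | .typeA _ _ => l = .nt (nt (F.leafNT T k))
  | .typeB i _ => ∃ Y r, l = .pow Y (r - 1) ∧ G.rule (nt (i, k + 1)) = .rep Y r
  | .typeC i j => ∃ b e, l = .sub (nt (F.nodeNT T i (j + 1))) b e

omit hV hG in
/-- What has to be seen before the node that covers the factors `a, …, b - 1`. -/
structure SeenBefore (F : CatFactorization) (T : List α) (a b : ℕ) (S : Set (ℕ × ℕ)) : Prop where
  subset : S ⊆ F.nonterminals T
  interval : ∀ x y, (x, y) ∈ F.intervals → x < a ∨ (x = a ∧ b < y) → F.nodeNT T x y ∈ S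
  leaf : ∀ k < a, ¬ F.IsB k → F.leafNT T k ∈ S
  new : ∀ y ∈ S, y.1 < a ∨ (y.1 = a ∧ b < y.2)

omit hV hG in
/-- What is seen after the node that covers the factors `a, …, b - 1`. -/
structure SeenAfter (F : CatFactorization) (T : List α) (b : ℕ) (S : Set (ℕ × ℕ)) : Prop where
  subset : S ⊆ F.nonterminals T
  interval : ∀ x y, (x, y) ∈ F.intervals → x < b → F.nodeNT T x y ∈ S
  leaf : ∀ k < b, ¬ F.IsB k → F.leafNT T k ∈ S
  new : ∀ y ∈ S, y.1 < b

omit hV in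
theorem IsSystemOf.nt_mem_image {S : Set (ℕ × ℕ)} (hS : S ⊆ F.nonterminals T) {x : ℕ × ℕ}
    (hx : x ∈ F.nonterminals T) : nt x ∈ nt '' S ↔ x ∈ S :=
  ⟨fun ⟨_, hy, e⟩ => hG.inj (hS hy) hx e ▸ hy, fun h => ⟨x, h, rfl⟩⟩

omit hV hG in
theorem HasRule.rule_leaf {k : ℕ} {ρ : CollageRule α (ℕ × ℕ)} (h : F.HasRule T (k, k + 1) ρ) :
    (∃ a, ρ = .atom a ∧ F.str T (k, k + 1) = [a]) ∨
    ∃ i j b e, F.kind k = .typeC i j ∧ ρ = .trunc (F.nodeNT T i (j + 1)) b e ∧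
      F.str T (k, k + 1) = substr (F.str T (i, j + 1)) b (e - b) := by
  generalize hx : (k, k + 1) = x at h
  cases h with
  | atom hk hkind hf hs =>
    simp only [Prod.mk.injEq] at hx; obtain ⟨rfl, -⟩ := hx
    exact Or.inl ⟨_, rfl, hs⟩
  | trunc hk hkind hbe he hs =>
    simp only [Prod.mk.injEq] at hx; obtain ⟨rfl, -⟩ := hx
    exact Or.inr ⟨_, _, _, _, hkind, rfl, hs⟩
  | rep hak hsp hkind hr hs =>
    have := treeNodes_bounds hak
    simp only [Prod.mk.injEq] at hx this; omega
  | concat hab hB =>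
    have := treeNodes_bounds hab
    simp only [Prod.mk.injEq] at hx this; omega

omit hV hG in
theorem HasRule.rule_node {a b : ℕ} (hab : a + 2 ≤ b) {ρ : CollageRule α (ℕ × ℕ)}
    (h : F.HasRule T (a, b) ρ) :
    (∃ k j r, b = k + 1 ∧ F.splitAt a b = k ∧ F.kind k = .typeB a j ∧ 3 ≤ r ∧
      F.str T (k, k + 1) = strPow (F.str T (a, k)) (r - 1) ∧ ρ = .rep (F.nodeNT T a k) r) ∨
    (¬ (b = F.splitAt a b + 1 ∧ F.IsB (F.splitAt a b)) ∧
      ρ = .concat (F.nodeNT T a (F.splitAt a b)) (F.nodeNT T (F.splitAt a b) b)) := by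
  generalize hx : (a, b) = x at h
  cases h with
  | atom hk hkind hf hs => simp only [Prod.mk.injEq] at hx; omega
  | trunc hk hkind hbe he hs => simp only [Prod.mk.injEq] at hx; omega
  | rep hak hsp hkind hr hs =>
    simp only [Prod.mk.injEq] at hx; obtain ⟨rfl, rfl⟩ := hx
    exact Or.inl ⟨_, _, _, rfl, hsp, hkind, hr, hs, rfl⟩
  | concat hab hB =>
    simp only [Prod.mk.injEq] at hx; obtain ⟨rfl, rfl⟩ := hx
    exact Or.inr ⟨hB, rfl⟩

/-- The part of the grammar tree that covers a single factor. -/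
theorem IsSystemOf.exists_tree_leaf {a : ℕ} (ha : a < F.count) (hB : ¬ F.IsB a) {S : Set (ℕ × ℕ)}
    (hS : F.SeenBefore T a (a + 1) S) :
    ∃ t S' l, G.Pruned (nt (F.leafNT T a)) t (nt '' S) (nt '' S') ∧ S ⊆ S' ∧
      F.SeenAfter T (a + 1) S' ∧ t.leaves = [l] ∧ F.LeafSpec T G nt a l := by
  have hmem := hV.leafNT_mem ha hB
  have hstr := hG.expand_eq hV hmem
  rw [hV.str_leafNT ha] at hstr
  -- the new set of nonterminals has the required properties
  have hafter : ∀ S', S ⊆ S' → S' ⊆ insert (F.leafNT T a) S → F.leafNT T a ∈ S' →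
      ((F.leafNT T a).1 ≤ a) → F.SeenAfter T (a + 1) S' := by
    intro S' h1 h2 h3 h4
    refine ⟨fun x hx => ?_, fun x y hxy hx => ?_, fun k hk hkB => ?_, fun y hy => ?_⟩
    · rcases h2 hx with rfl | hx
      · exact hmem
      · exact hS.subset hx
    · have hb := hV.interval_bounds hxy
      simp only at hb
      by_cases hy : x = a ∧ y = a + 1
      · obtain ⟨rfl, rfl⟩ := hy
        rw [nodeNT_leaf]; exact h3
      · exact h1 (hS.interval x y hxy (by omega))
    · rcases (Nat.lt_succ_iff.1 hk).lt_or_eq with hk | rfl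
      · exact h1 (hS.leaf k hk hkB)
      · exact h3
    · rcases h2 hy with rfl | hy
      · omega
      · have := hS.new y hy; omega
  -- If the nonterminal was seen, the leaf is a pruned node and nothing new is recorded.
  have hseen : F.leafNT T a ∈ S → (F.kind a = .single ∨ ∃ i j, F.kind a = .typeA i j) →
      ∃ t S' l, G.Pruned (nt (F.leafNT T a)) t (nt '' S) (nt '' S') ∧ S ⊆ S' ∧
        F.SeenAfter T (a + 1) S' ∧ t.leaves = [l] ∧ F.LeafSpec T G nt a l := by
    intro h hkind
    refine ⟨_, S, _, .seen ⟨_, h, rfl⟩, subset_rfl,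
      hafter S subset_rfl (Set.subset_insert _ _) h ?_, rfl, ?_⟩
    · have := hS.new _ h; omega
    · refine ⟨hstr, ?_⟩
      rcases hkind with hkind | ⟨i, j, hkind⟩ <;> simp [hkind]
  have hnew : F.leafNT T a = (a, a + 1) → nt (a, a + 1) ∉ nt '' S := by
    intro e h
    rw [hG.nt_mem_image hS.subset (e ▸ hmem)] at h
    have := hS.new _ h
    simp only at this; omega
  cases hkind : F.kind a with
  | single =>
    by_cases hf : F.firstSingle T a = a
    · have e : F.leafNT T a = (a, a + 1) := by rw [leafNT_single hkind, hf]
      rw [e] at hmem hafter ⊢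
      obtain ⟨ρ, hρ, hr⟩ := hG.rule _ hmem
      rcases hρ.rule_leaf with ⟨c, rfl, hs⟩ | ⟨i, j, b, e', hkind', _⟩
      · have hP := Pruned.atom (hnew e) hr
        rw [← Set.image_insert_eq] at hP
        refine ⟨_, _, .term c, hP, Set.subset_insert _ _, hafter _ (Set.subset_insert _ _)
          subset_rfl (Set.mem_insert _ _) le_rfl, rfl, ?_⟩
        exact ⟨hs.symm, by simp [hkind]⟩
      · rw [hkind] at hkind'; cases hkind'
    · refine hseen ?_ (Or.inl hkind)
      have h1 := firstSingle_spec (T := T) hkind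
      have hlt := lt_of_le_of_ne (firstSingle_le (T := T) hkind) hf
      have h2 : F.leafNT T a = F.leafNT T (F.firstSingle T a) := by
        rw [leafNT_single hkind, leafNT_single h1.1, firstSingle_idem hkind]
      rw [h2]
      -- A repeated symbol shares its nonterminal with an earlier factor, which has been visited.
      refine hS.leaf _ hlt ?_
      rintro ⟨i, j, h⟩
      rw [h1.1] at h; cases h
  | typeA i j =>
    obtain ⟨h1, h2, h3, -⟩ := hV.typeA_bounds ha hkind
    refine hseen ?_ (Or.inr ⟨i, j, hkind⟩)
    rw [leafNT_typeA hkind h2 h1]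
    -- The reference starts further left, so its node precedes this leaf in preorder.
    exact hS.interval _ _ h3 (Or.inl (by omega))
  | typeB i j => exact absurd ⟨i, j, hkind⟩ hB
  | typeC i j =>
    have e : F.leafNT T a = (a, a + 1) := leafNT_typeC hkind
    rw [e] at hmem hafter hstr ⊢
    obtain ⟨ρ, hρ, hr⟩ := hG.rule _ hmem
    have h3 := (hV.typeC_bounds ha hkind).2.2.1
    rcases hρ.rule_leaf with ⟨c, rfl, hs⟩ | ⟨i', j', b, e', hkind', rfl, hs⟩
    -- A type-C factor is longer than 1, so its rule does not derive a single symbol.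
    · have := hV.feasKind ha
      simp only [FeasKind, hkind] at this
      have hlen := congrArg List.length hs
      rw [hV.length_str (by omega) (by omega), List.length_singleton] at hlen
      have := this.2.2.1
      omega
    · rw [hkind] at hkind'
      simp only [FactorKind.typeC.injEq] at hkind'
      obtain ⟨rfl, rfl⟩ := hkind'
      have hP := Pruned.trunc (hnew e) hr
      rw [← Set.image_insert_eq] at hP
      refine ⟨_, _, .sub (nt (F.nodeNT T i (j + 1))) b e', hP, Set.subset_insert _ _,
        hafter _ (Set.subset_insert _ _) subset_rfl (Set.mem_insert _ _) le_rfl, rfl, ?_⟩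
      refine ⟨?_, ?_⟩
      · rw [labelString, hG.expand_nodeNT_interval hV h3, hs]
      · simp [hkind]

/-- The part of the grammar tree that covers the factors `a, …, b - 1`. -/
theorem IsSystemOf.exists_tree {a b : ℕ} (hab : a < b) (hb : b ≤ F.count) (hU : F.Uncrossed a b)
    (hB : ¬ (b = a + 1 ∧ F.IsB a)) (hsub : F.treeNodes a b ⊆ F.nonterminals T) {S : Set (ℕ × ℕ)}
    (hS : F.SeenBefore T a b S) :
    ∃ t S', G.Pruned (nt (F.nodeNT T a b)) t (nt '' S) (nt '' S') ∧ S ⊆ S' ∧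
      F.SeenAfter T b S' ∧ ↑(F.treeNodes a b) ⊆ S' ∧ t.leaves.length = b - a ∧
      (∀ k l, t.leaves[k]? = some l → F.LeafSpec T G nt (a + k) l) ∧
      ∀ x y, (x, y) ∈ F.intervals → a ≤ x → y ≤ b →
        (.nt (nt (F.nodeNT T x y)), x, y) ∈ t.nodesFrom a := by
  induction hn : b - a using Nat.strong_induction_on generalizing a b S with
  | _ n ih =>
    subst hn
    by_cases hlen : b = a + 1
    · subst hlen
      obtain ⟨t, S', l, hP, hSS, hA, ht, hl⟩ :=
        hG.exists_tree_leaf hV (by omega) (fun h => hB ⟨rfl, h⟩) hS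
      rw [nodeNT_leaf]
      refine ⟨t, S', hP, hSS, hA, by rw [treeNodes_of_not_le (by omega)]; simp, by simp [ht],
        ?_, ?_⟩
      · intro k l' hk
        rw [ht] at hk
        obtain ⟨hk0, rfl⟩ := List.getElem?_eq_some_iff.1 hk
        simp only [List.length_singleton, Nat.lt_one_iff] at hk0
        subst hk0
        exact hl
      · intro x y hxy hx hy
        have hbd := hV.interval_bounds hxy
        simp only at hbd
        obtain rfl : x = a := by omega
        obtain rfl : y = x + 1 := by omega
        have := hP.root_mem_nodesFrom x
        rw [ht, List.length_singleton] at this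
        rw [nodeNT_leaf]
        exact this
    · have hab2 : a + 2 ≤ b := by omega
      have hs := splitAt_bounds (F := F) hab2
      have hmem : (a, b) ∈ F.nonterminals T := hsub (self_mem_treeNodes hab2)
      have hroot : F.nodeNT T a b = (a, b) := nodeNT_of_le hab2
      have hnew : nt (a, b) ∉ nt '' S := by
        intro h
        rw [hG.nt_mem_image hS.subset hmem] at h
        have := hS.new _ h
        simp only at this; omega
      rw [treeNodes_of_le hab2] at hsub
      -- In preorder, the nodes before the left child start further left or are longer with the same
      -- start. The only new one is the parent `(a, b)`: by maximality of the split, no interval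
      -- starting at `a` ends strictly between the split and `b`.
      have hS₁ : F.SeenBefore T a (F.splitAt a b) (insert (a, b) S) := by
        refine ⟨?_, ?_, ?_, ?_⟩
        · rintro x (rfl | hx)
          · exact hmem
          · exact hS.subset hx
        · intro x y hxy h
          rcases lt_trichotomy b y with hy | rfl | hy
          · exact Or.inr (hS.interval x y hxy (by omega))
          · rcases h with h | ⟨rfl, h⟩
            · exact Or.inr (hS.interval x b hxy (Or.inl h))
            · exact Or.inl hroot
          · rcases h with h | ⟨rfl, h⟩
            · exact Or.inr (hS.interval x y hxy (Or.inl h))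
            · have := le_splitAt hxy hy
              omega
        · exact fun k hk hkB => Or.inr (hS.leaf k hk hkB)
        · rintro y (rfl | hy)
          · exact Or.inr ⟨rfl, hs.2⟩
          · have := hS.new y hy; omega
      obtain ⟨t₁, S₂, hP₁, hSS₁, hA₁, htn₁, hlen₁, hl₁, hn₁⟩ := ih _ (by omega) hs.1 (by omega)
        (hV.uncrossed_left hab2 hU) (fun h => hV.left_not_isB hab2 hb hU h.1 h.2)
        (fun x hx => hsub (Finset.mem_insert_of_mem (Finset.mem_union_left _ hx))) hS₁ rfl
      rw [Set.image_insert_eq] at hP₁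
      have hSS : S ⊆ S₂ := (Set.subset_insert _ _).trans hSS₁
      have hself : (a, b) ∈ S₂ := hSS₁ (Set.mem_insert _ _)
      obtain ⟨ρ, hρ, hr⟩ := hG.rule _ hmem
      rw [hroot]
      rcases hρ.rule_node hab2 with ⟨k, j, r, hbk, hsp, hkind, hr3, hstr, rfl⟩ | ⟨hnB, rfl⟩
      · subst hbk
        rw [hsp] at hP₁ hA₁ htn₁ hlen₁ hn₁ hs
        have hk : k < F.count := by omega
        have hI := (hV.typeB_bounds hk hkind).2.2.1
        -- The type-B leaf on the right adds no nonterminal, so the invariant must not ask for an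
        -- interval there; condition 2 ensures that there is none.
        have hno : ∀ y, y ≤ k + 1 → (k, y) ∉ F.intervals := by
          intro y hy hky
          have := hV.interval_bounds hky
          simp only at this
          obtain rfl : y = k + 1 := by omega
          exact hV.not_isB_of_interval hky ⟨a, j, hkind⟩
        refine ⟨_, S₂, .rep hnew hr hP₁, hSS, ?_, ?_, ?_, ?_, ?_⟩
        · refine ⟨hA₁.subset, fun x y hxy hx => ?_, fun k' hk' hkB => ?_, fun y hy => ?_⟩
          · by_cases hxk : x = k
            · subst hxk
              by_cases hy : y ≤ x + 1
              · exact absurd hxy (hno y hy)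
              -- A longer interval starting at the last factor would cross the node.
              · have := (hU _ hxy).2
                simp only at this; omega
            · exact hA₁.interval x y hxy (by omega)
          · rcases (Nat.lt_succ_iff.1 hk').lt_or_eq with hk' | rfl
            · exact hA₁.leaf k' hk' hkB
            · exact absurd ⟨a, j, hkind⟩ hkB
          · have := hA₁.new y hy; omega
        · rw [treeNodes_of_le hab2, hsp, treeNodes_of_not_le (a := k) (by omega)]
          intro x hx
          simp only [Finset.union_empty, Finset.coe_insert, Set.mem_insert_iff,
            Finset.mem_coe] at hx
          rcases hx with rfl | hx
          · exact hself
          · exact htn₁ hx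
        · simp only [LTree.leaves, List.length_append, List.length_singleton]
          omega
        · intro k' l hl
          simp only [LTree.leaves, List.getElem?_append] at hl
          split_ifs at hl with hlt
          · exact hl₁ k' l hl
          · have hl' := List.mem_of_getElem? hl
            simp only [List.mem_singleton] at hl'
            subst hl'
            have hk0 : k' - t₁.leaves.length < 1 := by
              by_contra hcon
              rw [List.getElem?_eq_none (by simp only [List.length_singleton]; omega)] at hl
              cases hl
            have e : a + k' = k := by omega
            rw [e]
            refine ⟨?_, ?_⟩
            · rw [labelString, hG.expand_nodeNT_interval hV hI, hstr]
            · simp only [hkind]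
              exact ⟨_, r, rfl, hr⟩
        · intro x y hxy hx hy
          by_cases hne : (x, y) = (a, k + 1)
          · simp only [Prod.mk.injEq] at hne
            obtain ⟨rfl, rfl⟩ := hne
            rw [hroot]
            have := (Pruned.rep hnew hr hP₁).root_mem_nodesFrom x
            simp only [LTree.leaves, List.length_append, List.length_singleton] at this
            rw [hlen₁, ← Nat.add_assoc, Nat.add_sub_of_le hs.1.le] at this
            exact this
          · rcases hV.not_across_split hab2 hxy hx hy hne with h | h
            · rw [hsp] at h
              exact List.mem_cons_of_mem _ (List.mem_append_left _ (hn₁ x y hxy hx h))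
            · rw [hsp] at h
              have hbd := hV.interval_bounds hxy
              simp only at hbd
              obtain rfl : x = k := by omega
              exact absurd hxy (hno y hy)
      -- The state after the left child is the state before the right one: a longer interval
      -- starting at the split would cross the parent.
      · have hS₂ : F.SeenBefore T (F.splitAt a b) b S₂ := by
          refine ⟨hA₁.subset, fun x y hxy h => ?_, hA₁.leaf, fun y hy => Or.inl (hA₁.new y hy)⟩
          rcases h with h | ⟨rfl, h⟩
          · exact hA₁.interval x y hxy h
          · have := (hU _ hxy).2
            simp only at this; omega
        obtain ⟨t₂, S₃, hP₂, hSS₂, hA₂, htn₂, hlen₂, hl₂, hn₂⟩ := ih _ (by omega) hs.2 hb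
          (hV.uncrossed_right hab2 hU) hnB
          (fun x hx => hsub (Finset.mem_insert_of_mem (Finset.mem_union_right _ hx))) hS₂ rfl
        refine ⟨_, S₃, .concat hnew hr hP₁ hP₂, hSS.trans hSS₂, hA₂, ?_, ?_, ?_, ?_⟩
        · rw [treeNodes_of_le hab2]
          intro x hx
          simp only [Finset.coe_insert, Finset.coe_union, Set.mem_insert_iff, Set.mem_union] at hx
          rcases hx with rfl | hx | hx
          · exact hSS₂ hself
          · exact hSS₂ (htn₁ hx)
          · exact htn₂ hx
        · simp only [LTree.leaves, List.length_append]
          omega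
        · intro k' l hl
          simp only [LTree.leaves, List.getElem?_append] at hl
          split_ifs at hl with hlt
          · exact hl₁ k' l hl
          · have := hl₂ _ l hl
            have e : F.splitAt a b + (k' - t₁.leaves.length) = a + k' := by omega
            rwa [e] at this
        · intro x y hxy hx hy
          by_cases hne : (x, y) = (a, b)
          · simp only [Prod.mk.injEq] at hne
            obtain ⟨rfl, rfl⟩ := hne
            rw [hroot]
            have := (Pruned.concat hnew hr hP₁ hP₂).root_mem_nodesFrom x
            have e : x + (LTree.two (.nt (nt (x, y))) t₁ t₂).leaves.length = y := by
              simp only [LTree.leaves, List.length_append]; omega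
            rwa [e] at this
          · rcases hV.not_across_split hab2 hxy hx hy hne with h | h
            · exact List.mem_cons_of_mem _ (List.mem_append_left _ (hn₁ x y hxy hx h))
            · have e : a + t₁.leaves.length = F.splitAt a b := by omega
              refine List.mem_cons_of_mem _ (List.mem_append_right _ ?_)
              rw [e]
              exact hn₂ x y hxy h hy

/-- `exists_tree` is applied at the root with nothing seen. The tree obtained is the grammar tree;
every nonterminal is seen in it, hence reachable by plain references, which gives internality and
usefulness at once. Its leaves and the nodes at the intervals of I are those prescribed by the
factorization. -/
theorem IsSystemOf.isICSFor (hT : T ≠ []) : G.IsICSFor T ∧ F.IsICSFactorizationOf G := by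
  have h0 := hV.count_pos hT
  have hS : F.SeenBefore T 0 F.count ∅ := by
    refine ⟨Set.empty_subset _, fun x y hxy h => ?_, by simp, by simp⟩
    have := hV.interval_bounds hxy
    simp only at this; omega
  obtain ⟨t, S', hP, -, hA, htn, hlen, hl, hnode⟩ := hG.exists_tree hV h0 le_rfl hV.uncrossed_root
    (fun h => hV.not_isB_zero h0 h.2) treeNodes_subset_nonterminals hS
  rw [Set.image_empty, ← hG.start_eq] at hP
  have htree := hP.grammarTree_eq
  have hInt : G.IsInternal := by
    intro X
    obtain ⟨x, hx, rfl⟩ := hG.surj X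
    have hxS : x ∈ S' := by
      rcases mem_nonterminals hx with h | ⟨k, hk, rfl, i, j, hkind⟩ | ⟨k, hk, rfl, hkind, hf⟩
      · exact htn h
      · rw [← leafNT_typeC (T := T) hkind]
        exact hA.leaf k hk fun ⟨_, _, h⟩ => by rw [hkind] at h; cases h
      · have := hA.leaf k hk fun ⟨_, _, h⟩ => by rw [hkind] at h; cases h
        rwa [leafNT_single hkind, hf] at this
    rcases hP.reach (nt x) ⟨x, hxS, rfl⟩ with h | h
    · exact absurd h (Set.notMem_empty _)
    · exact h
  have hplain : ∀ X Y, (G.rule X).RefersPlain Y → (G.rule X).Refers Y := by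
    intro X Y h
    cases hr : G.rule X <;> simp only [hr, CollageRule.RefersPlain] at h
    · exact h
    · exact h
  refine ⟨⟨⟨hG.ruleOK hV, fun X => Relation.ReflTransGen.mono hplain _ _ (hInt X)⟩, hInt, ?_⟩, ?_⟩
  · rw [hG.start_eq, hG.expand_eq hV (hV.nodeNT_root_mem hT), hV.str_nodeNT h0 le_rfl,
      hV.str_root]
  · refine ⟨by rw [htree, hlen, Nat.sub_zero], hV.1.1, ?_, ?_⟩
    · intro k l hk
      rw [htree] at hk
      have hk' : k < F.count := by
        by_contra hcon
        rw [List.getElem?_eq_none (by omega)] at hk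
        cases hk
      have hspec := (hl k l hk).1
      rw [Nat.zero_add] at hspec
      have := hV.1.2.2 k hk'
      rw [hspec, hV.length_str (b := k + 1) (by omega) hk']
      omega
    · intro k hk
      obtain ⟨l, hkl⟩ : ∃ l, t.leaves[k]? = some l :=
        ⟨_, List.getElem?_eq_getElem (by omega)⟩
      have hspec := hl k l hkl
      rw [Nat.zero_add] at hspec
      have hKO := hV.2.1 k hk
      unfold LeafKind
      rw [htree]
      cases hkind : F.kind k with
      | single =>
        simp only [KindOK, hkind] at hKO
        exact hKO
      | typeA i j =>
        obtain ⟨h1, h2, h3, -⟩ := hV.typeA_bounds hk hkind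
        simp only [LeafSpec, KindOK, hkind] at hspec hKO
        have hn := hnode i (j + 1) h3 (Nat.zero_le _) (by omega)
        refine ⟨hKO.1, h2, _, ?_, hn⟩
        rw [hkl, hspec.2, leafNT_typeA hkind h2 h1]
      | typeB i j =>
        obtain ⟨h1, h2, -, h3, -⟩ := hV.typeB_bounds hk hkind
        simp only [LeafSpec, hkind] at hspec
        obtain ⟨-, Y, r, rfl, hr⟩ := hspec
        have hn := hnode i (k + 1) h3 (Nat.zero_le _) (by omega)
        rw [nodeNT_of_le (by omega)] at hn
        exact ⟨h2, _, Y, r, hr, hkl, hn⟩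
      | typeC i j =>
        obtain ⟨h1, h2, h3, -⟩ := hV.typeC_bounds hk hkind
        simp only [LeafSpec, KindOK, hkind] at hspec hKO
        obtain ⟨-, b, e, rfl⟩ := hspec
        exact ⟨hKO.1, _, b, e, hkl, hnode i (j + 1) h3 (Nat.zero_le _) (by omega)⟩

end System

/-- Each categorized factorization with the required properties belongs to an internal collage
system with one nonterminal for each inner node, each type-C factor and each symbol. -/
theorem IsValidFor.exists_ics [DecidableEq α] (hV : F.IsValidFor T) (hT : T ≠ []) :
    ∃ G : RuleSystem α, G.IsICSFor T ∧ F.IsICSFactorizationOf G ∧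
      G.size + 1 ≤ F.count + F.numC + T.dedup.length := by
  obtain ⟨G, nt, hG⟩ := hV.exists_isSystemOf hT
  obtain ⟨h1, h2⟩ := hG.isICSFor hV hT
  exact ⟨G, h1, h2, by rw [hG.size_eq]; exact hV.card_nonterminals_le hT⟩

end CatFactorization

/-! ### Optimal solutions -/

theorem MaxSat.numSat_add_numViolated {V : Type*} (M : MaxSat V) (v : V → Bool) :
    M.numSat v + M.numViolated v = M.soft.length := by
  rw [numSat, numViolated, List.length_eq_countP_add_countP fun c => SatClause.holds v c]
  congr 2
  funext c
  cases SatClause.holds v c <;> rfl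

theorem MaxSat.isOptimal_iff {V : Type*} (M : MaxSat V) (v : V → Bool) :
    M.IsOptimal v ↔ M.SatHard v ∧ ∀ w, M.SatHard w → M.numViolated v ≤ M.numViolated w := by
  have hv := M.numSat_add_numViolated v
  refine and_congr_right fun _ => forall₂_congr fun w _ => ?_
  have hw := M.numSat_add_numViolated w
  omega

/-- Variables may be infinite in number, so a least number of violations is chosen instead of
searching through assignments. -/
theorem MaxSat.exists_isOptimal {V : Type*} (M : MaxSat V) (h : ∃ v, M.SatHard v) :
    ∃ v, M.IsOptimal v := by
  classical
  have hex : ∃ n v, M.SatHard v ∧ M.numViolated v = n := by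
    obtain ⟨v, hv⟩ := h
    exact ⟨_, v, hv, rfl⟩
  obtain ⟨v, hv, e⟩ := Nat.find_spec hex
  refine ⟨v, (M.isOptimal_iff v).2 ⟨hv, fun w hw => ?_⟩⟩
  rw [e]
  exact Nat.find_min' hex ⟨w, hw, rfl⟩

/-- The factorization into single symbols. -/
theorem exists_isValidFor {α : Type*} (T : List α) : ∃ F : CatFactorization, F.IsValidFor T := by
  refine ⟨⟨T.length, id, fun _ => .single⟩, ⟨rfl, rfl, fun k _ => Nat.lt_succ_self k⟩,
    fun k _ => rfl, ⟨?_, ?_⟩, ⟨fun _ => 0, fun k _ => ⟨fun _ => rfl, ?_⟩⟩⟩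
  · rintro x ⟨k, _, ⟨i, j, h | h | h, _⟩ | ⟨i, j, h, _⟩⟩ <;> cases h
  · intro k _ i j h; cases h
  · rintro a b ⟨i, j, h | h | h, _⟩ <;> cases h

theorem mainTheorem5 : ∃ C : ℕ, ∀ {α : Type*} [DecidableEq α] (T : List α), T ≠ [] →
    -- the size of the formulation
    (icsMaxSat T).size ≤ C * T.length ^ 4 ∧
    -- the hard clauses encode the conditions on categorized factorizations
    (∀ v, (icsMaxSat T).SatHard v →
      ∃ F : CatFactorization, F.IsValidFor T ∧ Describes T v F) ∧
    (∀ F : CatFactorization, F.IsValidFor T →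
      ∃ v, (icsMaxSat T).SatHard v ∧ Describes T v F) ∧
    -- the conditions characterize the factorizations of internal collage systems
    (∀ F : CatFactorization, F.IsValidFor T ↔
      ∃ G : RuleSystem α, G.IsICSFor T ∧ F.IsICSFactorizationOf G) ∧
    (∀ G : RuleSystem α, G.IsICSFor T → ∃ F : CatFactorization, F.IsICSFactorizationOf G) ∧
    -- the soft clauses count the factors and the type-C factors
    (∀ v (F : CatFactorization), (icsMaxSat T).SatHard v → F.IsValidFor T → Describes T v F →
      (icsMaxSat T).numViolated v = F.count + 1 + F.numC) ∧
    -- optimal solutions exist, and they correspond to smallest internal collage systems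
    (∃ v, (icsMaxSat T).IsOptimal v) ∧
    (∀ v, (icsMaxSat T).IsOptimal v →
      ∃ (F : CatFactorization) (G : RuleSystem α),
        Describes T v F ∧ F.IsICSFactorizationOf G ∧ G.IsSmallestICSFor T) ∧
    (∀ G : RuleSystem α, G.IsSmallestICSFor T →
      ∃ v, ∃ F : CatFactorization,
        (icsMaxSat T).IsOptimal v ∧ Describes T v F ∧ F.IsICSFactorizationOf G) ∧
    -- the optimum determines the smallest size
    (∀ v (G : RuleSystem α), (icsMaxSat T).IsOptimal v → G.IsSmallestICSFor T →
      G.size + 2 = (icsMaxSat T).numViolated v + T.dedup.length) := by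
  refine ⟨2000, fun {α} _ T hT => ?_⟩
  have sound : ∀ v, (icsMaxSat T).SatHard v →
      ∃ F : CatFactorization, F.IsValidFor T ∧ Describes T v F :=
    fun v hv => ((ICSFormula.satHard_iff_sem v).1 hv).exists_factorization
  have complete : ∀ F : CatFactorization, F.IsValidFor T →
      ∃ v, (icsMaxSat T).SatHard v ∧ Describes T v F := fun F hF => hF.exists_assignment
  have count : ∀ v (F : CatFactorization), F.IsValidFor T → Describes T v F →
      (icsMaxSat T).numViolated v = F.count + 1 + F.numC :=
    fun v F hF hD => hD.numViolated_eq hF.1 hF.2.1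
  have toICS : ∀ F : CatFactorization, F.IsValidFor T → ∃ G : RuleSystem α, G.IsICSFor T ∧
      F.IsICSFactorizationOf G ∧ G.size + 1 ≤ F.count + F.numC + T.dedup.length :=
    fun F hF => hF.exists_ics hT
  have ofICS : ∀ G : RuleSystem α, G.IsICSFor T → ∃ F : CatFactorization,
      F.IsICSFactorizationOf G ∧ F.IsValidFor T ∧
        F.count + F.numC + T.dedup.length ≤ G.size + 1 := by
    intro G hG
    obtain ⟨F, hF⟩ := CatFactorization.exists_isICSFactorizationOf hG
    exact ⟨F, hF, hF.isValidFor hG, hF.count_add_le hG⟩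
  -- the size of an internal collage system bounds the violations of optimal solutions
  have lower : ∀ v, (icsMaxSat T).IsOptimal v → ∀ G : RuleSystem α, G.IsICSFor T →
      (icsMaxSat T).numViolated v + T.dedup.length ≤ G.size + 2 := by
    intro v hv G hG
    obtain ⟨F, -, hV, hle⟩ := ofICS G hG
    obtain ⟨w, hw, hwF⟩ := complete F hV
    have h1 := (((icsMaxSat T).isOptimal_iff v).1 hv).2 w hw
    rw [count w F hV hwF] at h1
    omega
  refine ⟨ICSFormula.size_icsMaxSat_le T hT, sound, complete, ?_, ?_, ?_, ?_, ?_, ?_, ?_⟩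
  · refine fun F => ⟨fun hF => ?_, fun ⟨G, hG, hF⟩ => hF.isValidFor hG⟩
    obtain ⟨G, h1, h2, -⟩ := toICS F hF
    exact ⟨G, h1, h2⟩
  · exact fun G hG => CatFactorization.exists_isICSFactorizationOf hG
  · exact fun v F _ hF hD => count v F hF hD
  · obtain ⟨F, hF⟩ := exists_isValidFor T
    obtain ⟨v, hv, -⟩ := complete F hF
    exact (icsMaxSat T).exists_isOptimal ⟨v, hv⟩
  · intro v hv
    obtain ⟨F, hF, hD⟩ := sound v hv.1
    obtain ⟨G, h1, h2, h3⟩ := toICS F hF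
    -- The constructed system has at most `N + σ - 2` nonterminals, where `N` is the number of
    -- violations, and `lower` says that no ICS has fewer than that.
    refine ⟨F, G, hD, h2, h1, fun H hH => ?_⟩
    have h4 := lower v hv H hH
    rw [count v F hF hD] at h4
    omega
  · intro G hG
    obtain ⟨F, h1, h2, h3⟩ := ofICS G hG.1
    obtain ⟨v, hv, hD⟩ := complete F h2
    -- An assignment with fewer violations would yield, through its factorization, an ICS smaller
    -- than `G`.
    refine ⟨v, F, ((icsMaxSat T).isOptimal_iff v).2 ⟨hv, fun w hw => ?_⟩, hD, h1⟩
    obtain ⟨F', hF', hD'⟩ := sound w hw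
    obtain ⟨G', h4, -, h5⟩ := toICS F' hF'
    have h6 := hG.2 G' h4
    rw [count v F h2 hD, count w F' hF' hD']
    omega
  · intro v G hv hG
    have h1 := lower v hv G hG.1
    obtain ⟨F, hF, hD⟩ := sound v hv.1
    obtain ⟨G', h2, -, h3⟩ := toICS F hF
    have h4 := hG.2 G' h2
    rw [count v F hF hD] at h1 ⊢
    omega
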